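/- There are absolute constants $c_1,c_2>0$ and numbers $\eta(d)>0$ with $c_1/d^2\le \eta(d)\le c_2/d^2$ for all integers $d\ge 3$, such that the following holds. For every $d\ge 3$ there is a constant $C_d>0$, depending only on $d$, such that for every integer $n\ge 1$ and all choices of real coefficients $\alpha(R)$, $$2^{-n}\sum_{|R|=2^{-n}}|\alpha(R)| \;\le\; C_d\, n^{\frac{d-1}{2}-\eta(d)}\,\Bigl\|\sum_{|R|\ge 2^{-n}}\alpha(R)\,h_R\Bigr\|_{L^\infty([0,1]^d)} .$$ Here the sums run over the (finitely many) dyadic rectangles $R\subset[0,1]^d$ of the indicated volume: a dyadic rectangle is a product $R=R_1\times\cdots\times R_d$ of dyadic intervals $[j2^k,(j+1)2^k)$, $j,k\in\mathbb Z$, and $|R|$ is its volume. For a dyadic interval $I$, $h_I=-\mathbf 1_{I_{\mathrm{left}}}+\mathbf 1_{I_{\mathrm{right}}}$, where $I_{\mathrm{left}}$ and $I_{\mathrm{right}}$ are its left and right halves, and $h_R(x_1,\dots,x_d)=\prod_{j=1}^d h_{R_j}(x_j)$. -/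

import Mathlib

open MeasureTheory

namespace SmallBall

noncomputable section

/-- The dyadic interval `[j 2^k, (j+1) 2^k)` of the real line, given by its scale `k : ℤ` and
its position `j : ℤ` (the pair `(k, j)` is determined by the interval). -/
@[ext]
structure DyadicInterval where
  scale : ℤ
  pos : ℤ

namespace DyadicInterval

/-- The length `2^k` of `[j 2^k, (j+1) 2^k)`. -/
def length (I : DyadicInterval) : ℝ := (2 : ℝ) ^ I.scale

/-- The set of points `[j 2^k, (j+1) 2^k)`. -/
def toSet (I : DyadicInterval) : Set ℝ :=
  Set.Ico ((I.pos : ℝ) * (2 : ℝ) ^ I.scale) (((I.pos : ℝ) + 1) * (2 : ℝ) ^ I.scale)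

/-- The left half of a dyadic interval, again a dyadic interval. -/
def left (I : DyadicInterval) : DyadicInterval := ⟨I.scale - 1, 2 * I.pos⟩

/-- The right half of a dyadic interval, again a dyadic interval. -/
def right (I : DyadicInterval) : DyadicInterval := ⟨I.scale - 1, 2 * I.pos + 1⟩

/-- The `L^∞`-normalized Haar function of `I`: `-1` on the left half, `1` on the right half and
`0` off `I`. -/
def haar (I : DyadicInterval) (x : ℝ) : ℝ :=
  -I.left.toSet.indicator 1 x + I.right.toSet.indicator 1 x

end DyadicInterval

/-- A dyadic rectangle in `ℝ^d`: a product of `d` dyadic intervals. -/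
abbrev DyadicRectangle (d : ℕ) : Type := Fin d → DyadicInterval

namespace DyadicRectangle

variable {d : ℕ}

/-- The set of points of the rectangle. -/
def toSet (R : DyadicRectangle d) : Set (Fin d → ℝ) := Set.univ.pi fun t => (R t).toSet

/-- The volume `|R|` of the rectangle, the product of its side lengths. -/
def vol (R : DyadicRectangle d) : ℝ := ∏ t, (R t).length

/-- The Haar function of the rectangle, the product of the Haar functions of its sides. -/
def haar (R : DyadicRectangle d) (x : Fin d → ℝ) : ℝ := ∏ t, (R t).haar (x t)

end DyadicRectangle

/-- There are only finitely many dyadic rectangles `R ⊆ [0,1]^d` with `|R| ≥ 2^{-n}`. -/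
theorem finite_rectangles (d n : ℕ) :
    {R : DyadicRectangle d | R.toSet ⊆ Set.Icc 0 1 ∧ (2 : ℝ) ^ (-(n : ℤ)) ≤ R.vol}.Finite := by
  have hfin : ({I : DyadicInterval | I.scale ∈ Set.Icc (-(n : ℤ)) 0 ∧
      I.pos ∈ Set.Icc (0 : ℤ) (2 ^ n)}).Finite := by
    refine Set.Finite.subset (((Set.finite_Icc (-(n : ℤ)) 0).prod
      (Set.finite_Icc (0 : ℤ) (2 ^ n))).image fun p => DyadicInterval.mk p.1 p.2) ?_
    rintro ⟨k, j⟩ h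
    exact ⟨(k, j), h, rfl⟩
  refine Set.Finite.subset (Set.Finite.pi fun _ : Fin d => hfin) ?_
  rintro R ⟨hsub, hvol⟩
  have hpos : ∀ t, 0 < (R t).length := fun t => zpow_pos two_pos _
  -- every point of a side lies in `[0,1]`
  have hside : ∀ t, ∀ x ∈ (R t).toSet, 0 ≤ x ∧ x ≤ 1 := by
    intro t x hx
    let y : Fin d → ℝ := Function.update (fun s => ((R s).pos : ℝ) * (2 : ℝ) ^ (R s).scale) t x
    have hy : y ∈ DyadicRectangle.toSet R := by
      intro s _
      by_cases hs : s = t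
      · subst hs
        simpa [y] using hx
      · have := hpos s
        simp only [DyadicInterval.length] at this
        simp only [y, Function.update_of_ne hs]
        exact ⟨le_rfl, by nlinarith⟩
    have h := hsub hy
    have h0 := h.1 t
    have h1 := h.2 t
    simp only [y, Function.update_self] at h0 h1
    exact ⟨h0, h1⟩
  have hleft : ∀ t, 0 ≤ ((R t).pos : ℝ) * (R t).length := by
    intro t
    have := hpos t
    refine (hside t _ ⟨le_rfl, ?_⟩).1
    simp only [DyadicInterval.length] at this
    nlinarith
  have hright : ∀ t, (((R t).pos : ℝ) + 1) * (R t).length ≤ 1 := by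
    intro t
    have hp := hpos t
    by_contra hc
    push Not at hc
    have hm : max (((R t).pos : ℝ) * (R t).length) 1 < (((R t).pos : ℝ) + 1) * (R t).length :=
      max_lt (by nlinarith) hc
    obtain ⟨x, hx1, hx2⟩ := exists_between hm
    have := (hside t x ⟨(le_max_left _ _).trans hx1.le, hx2⟩).2
    exact absurd this (not_le.mpr ((le_max_right _ _).trans_lt hx1))
  have hj : ∀ t, (0 : ℤ) ≤ (R t).pos := by
    intro t
    have := nonneg_of_mul_nonneg_left (hleft t) (hpos t)
    exact_mod_cast this
  have hlen : ∀ t, (R t).length ≤ 1 := fun t => by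
    have := hright t
    have := hleft t
    linarith
  have hge : ∀ t, (2 : ℝ) ^ (-(n : ℤ)) ≤ (R t).length := by
    intro t
    refine hvol.trans ?_
    unfold DyadicRectangle.vol
    rw [← Finset.mul_prod_erase _ _ (Finset.mem_univ t)]
    refine mul_le_of_le_one_right (hpos t).le ?_
    exact Finset.prod_le_one (fun s _ => (hpos s).le) fun s _ => hlen s
  intro t _
  refine ⟨⟨?_, ?_⟩, hj t, ?_⟩
  · exact (zpow_le_zpow_iff_right₀ (one_lt_two : (1 : ℝ) < 2)).1 (hge t)
  · exact (zpow_le_zpow_iff_right₀ (one_lt_two : (1 : ℝ) < 2)).1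
      (by simpa [DyadicInterval.length] using hlen t)
  · have h1 := hright t
    have h2 := hge t
    have h3 : (0 : ℝ) ≤ (R t).pos := by exact_mod_cast hj t
    rw [zpow_neg, zpow_natCast] at h2
    have h4 : (((R t).pos : ℝ) + 1) * ((2 : ℝ) ^ n)⁻¹ ≤ 1 :=
      (mul_le_mul_of_nonneg_left h2 (by linarith)).trans h1
    rw [← div_eq_mul_inv, div_le_one (by positivity)] at h4
    have h5 : ((R t).pos : ℝ) ≤ ((2 ^ n : ℤ) : ℝ) := by push_cast; linarith
    exact_mod_cast h5

/-- The dyadic rectangles `R ⊆ [0,1]^d` with `|R| ≥ 2^{-n}`. -/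
def rectanglesGE (d n : ℕ) : Finset (DyadicRectangle d) := (finite_rectangles d n).toFinset

open Classical in
/-- The dyadic rectangles `R ⊆ [0,1]^d` with `|R| = 2^{-n}`. -/
def rectanglesEQ (d n : ℕ) : Finset (DyadicRectangle d) :=
  (rectanglesGE d n).filter fun R => R.vol = (2 : ℝ) ^ (-(n : ℤ))

/-- The sum `∑_{|R| ≥ 2^{-n}} α(R) h_R`. -/
def haarSum (d n : ℕ) (α : DyadicRectangle d → ℝ) (x : Fin d → ℝ) : ℝ :=
  ∑ R ∈ rectanglesGE d n, α R * R.haar x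

end

end SmallBall

/-!
The proof is by duality with a Riesz product, after the digits of a point turn the cube into the
finite probability space `BitCube d n`. There the Haar functions of the rectangles with scales
`r = (r₁, …, r_d)` change sign under a flip of the digit `r m` of the coordinate `m` and ignore the
later digits (`IsScaleAt`). For `∑ r = n` let `f r` be the `r`-function with the signs of the
coefficients. The left side of the inequality is the pairing of `H = ∑ α(R) h_R` with `∑_r f r`
(`sum_abs_eq_expect`), so it suffices to find a function `T` with `𝔼 |T| ≤ 28` whose pairing with
`H` is `ρ` times that, with `ρ` as large as possible.

*The Riesz product.* Sort the `r` by `r o` modulo `q`, for a fixed coordinate `o`, into `q` blocks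
with sums `F_t`, and let `ρ² = q / (2 (n+1)^{d-1})`. The factor `1 + ρ F_t + ρ²/2 (F_t² - #block)`
is nonnegative since `ρ² #block ≤ 1`, and its square part consists of pairs of distinct vectors. The
pairs that agree in some coordinate form the `defect`. Without defects, the expansion of the product
has only terms with distinct scales in the coordinate `o`, so its mean is one
(`expect_prod_factor`); since the defects are small in all moments that matter, the product is a
density up to a constant, and it absorbs further factors with small moments
(`Admissible.expect_abs_mul_abs_prod_factor_le`).

*Beck's gain.* Sums of products `f r * f s` over pairs with one coincidence `r j = s j` are smaller
in `L^p` than the order `n^{d-1}` of the square of `∑ f r`, by `n^{1/4}` up to logarithms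
(`momentBound_coincidenceSum`). The scales in a second coordinate `i` are compared by dyadic levels,
the Littlewood-Paley inequality in that coordinate leaves a quadratic form in a matrix of sums of
`r`-functions, and the Schatten-4 norm of the matrix has an inequality of type two.

*Removal of coincidences.* `testFun` is the product restricted to the terms in which all vectors
differ in all coordinates. For such terms the largest scales of two or more vectors add up to more
than `n`, so against `H` only the linear part `ρ ∑ f r` remains
(`expect_testFun_mul_of_isScaleAt`). The restriction is a product of factors `1 - ∑ (coincidence)`,
each counting the earlier factors that coincide with a given vector; it is expanded over all
patterns `φ` of coincidences. For one pattern, equalities of scales are encoded by averages over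
random signs, which decouples the factors, except for a matching of a fixed proportion of the
factors involved; each pair of the matching is a sum with a coincidence and gains by Beck's estimate
(`coincidentPart_eq`, `Admissible.expect_abs_coincidentPart_le`). The gain beats the number of
patterns if `q` is a small power of `n`, namely `n^{1/(800 d²)}`, and `q^{1/2}` is the gain over the
trivial exponent, so that `η(d) = 1/(1600 d²)`.
-/

namespace SmallBall

open Finset
open scoped BigOperators

/-! ### Moment bounds on finite probability spaces -/

/-- `MomentBound p f a` says `‖f‖_p ≤ a` for the uniform probability on `Ω`, written without
roots so that `p` can stay a natural number. -/
def MomentBound {Ω : Type*} [Fintype Ω] (p : ℕ) (f : Ω → ℝ) (a : ℝ) : Prop :=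
  0 ≤ a ∧ 𝔼 ω, |f ω| ^ p ≤ a ^ p

section Moments

variable {Ω : Type*} [Fintype Ω] {p : ℕ} {f g : Ω → ℝ} {a b : ℝ}

theorem expect_const_univ [Nonempty Ω] (c : ℝ) : 𝔼 _ω : Ω, c = c :=
  Finset.expect_const univ_nonempty c

theorem MomentBound.mono (h : MomentBound p f a) (hab : a ≤ b) : MomentBound p f b :=
  ⟨h.1.trans hab, h.2.trans (pow_le_pow_left₀ h.1 hab p)⟩

theorem MomentBound.of_abs_le (h : MomentBound p g a) (hfg : ∀ ω, |f ω| ≤ |g ω|) :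
    MomentBound p f a :=
  ⟨h.1, le_trans (expect_le_expect fun ω _ => pow_le_pow_left₀ (abs_nonneg _) (hfg ω) p) h.2⟩

theorem momentBound_of_le [Nonempty Ω] (p : ℕ) (h : ∀ ω, |f ω| ≤ a) : MomentBound p f a := by
  have ha : 0 ≤ a := (abs_nonneg _).trans (h (Classical.arbitrary Ω))
  refine ⟨ha, ?_⟩
  calc 𝔼 ω, |f ω| ^ p ≤ 𝔼 _ω : Ω, a ^ p :=
        expect_le_expect fun ω _ => pow_le_pow_left₀ (abs_nonneg _) (h ω) p
    _ = a ^ p := expect_const_univ _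

theorem MomentBound.eq_zero (h : MomentBound p f 0) (hp : p ≠ 0) (ω : Ω) : f ω = 0 := by
  have h0 := h.2
  rw [zero_pow hp, Fintype.expect_eq_sum_div_card] at h0
  have hnn : ∀ ω, 0 ≤ |f ω| ^ p := fun ω => by positivity
  have hcard : (0 : ℝ) < Fintype.card Ω := by
    exact_mod_cast Fintype.card_pos_iff.2 ⟨ω⟩
  have hs : ∑ ω, |f ω| ^ p ≤ 0 := by
    by_contra hc
    push Not at hc
    exact absurd h0 (not_le.2 (div_pos hc hcard))
  have h1 := (sum_eq_zero_iff_of_nonneg fun ω _ => hnn ω).1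
    (le_antisymm hs (sum_nonneg fun ω _ => hnn ω)) ω (mem_univ ω)
  exact abs_eq_zero.1 (pow_eq_zero_iff hp |>.1 h1)

/-- After normalization, a moment bound reads `𝔼 (|f|/a)^p ≤ 1`. -/
theorem MomentBound.normalized (h : MomentBound p f a) (ha : 0 < a) :
    𝔼 ω, (|f ω| / a) ^ p ≤ 1 := by
  simp only [div_pow]
  rw [← expect_div, div_le_one (by positivity)]
  exact h.2

theorem momentBound_of_normalized (ha : 0 < a) (h : 𝔼 ω, (|f ω| / a) ^ p ≤ 1) :
    MomentBound p f a := by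
  simp only [div_pow] at h
  rw [← expect_div, div_le_one (by positivity)] at h
  exact ⟨ha.le, h⟩

theorem MomentBound.exponent_le [Nonempty Ω] {p' : ℕ} (h : MomentBound p' f a) (hp : p ≤ p') :
    MomentBound p f a := by
  rcases Nat.eq_zero_or_pos p' with h0 | h0
  · have : p = p' := by omega
    exact this ▸ h
  rcases h.1.eq_or_lt with ha | ha
  · subst ha
    exact momentBound_of_le p fun ω => by simp [h.eq_zero h0.ne' ω]
  refine momentBound_of_normalized ha ?_
  have hp' : (0 : ℝ) < p' := by exact_mod_cast h0
  have hle : (p : ℝ) / p' ≤ 1 := by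
    rw [div_le_one hp']; exact_mod_cast hp
  have key : ∀ t : ℝ, 0 ≤ t → t ^ p ≤ (p : ℝ) / p' * t ^ p' + (1 - (p : ℝ) / p') := by
    intro t ht
    have := Real.geom_mean_le_arith_mean2_weighted (w₁ := (p : ℝ) / p') (w₂ := 1 - (p : ℝ) / p')
      (p₁ := t ^ p') (p₂ := 1) (by positivity) (by linarith) (by positivity) zero_le_one (by ring)
    rw [Real.one_rpow, mul_one, mul_one, ← Real.rpow_natCast t p', ← Real.rpow_mul ht,
      mul_div_cancel₀ _ hp'.ne', Real.rpow_natCast, Real.rpow_natCast] at this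
    exact this
  calc 𝔼 ω, (|f ω| / a) ^ p
      ≤ 𝔼 ω, ((p : ℝ) / p' * (|f ω| / a) ^ p' + (1 - (p : ℝ) / p')) :=
        expect_le_expect fun ω _ => key _ (by positivity)
    _ = (p : ℝ) / p' * 𝔼 ω, (|f ω| / a) ^ p' + (1 - (p : ℝ) / p') := by
        rw [expect_add_distrib, ← mul_expect, expect_const_univ]
    _ ≤ (p : ℝ) / p' * 1 + (1 - (p : ℝ) / p') := by
        gcongr
        exact h.normalized ha
    _ = 1 := by ring

theorem MomentBound.const_mul (h : MomentBound p f a) (c : ℝ) :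
    MomentBound p (fun ω => c * f ω) (|c| * a) := by
  refine ⟨mul_nonneg (abs_nonneg _) h.1, ?_⟩
  simp only [abs_mul, mul_pow]
  rw [← mul_expect]
  exact mul_le_mul_of_nonneg_left h.2 (by positivity)

/-- Minkowski's inequality. -/
theorem MomentBound.add [Nonempty Ω] (hp : p ≠ 0) (hf : MomentBound p f a)
    (hg : MomentBound p g b) : MomentBound p (fun ω => f ω + g ω) (a + b) := by
  rcases hf.1.eq_or_lt with ha | ha
  · subst ha
    have : (fun ω => f ω + g ω) = g := by
      funext ω; rw [hf.eq_zero hp ω, zero_add]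
    rw [this, zero_add]; exact hg
  rcases hg.1.eq_or_lt with hb | hb
  · subst hb
    have : (fun ω => f ω + g ω) = f := by
      funext ω; rw [hg.eq_zero hp ω, add_zero]
    rw [this, add_zero]; exact hf
  refine momentBound_of_normalized (by positivity) ?_
  have key : ∀ ω, (|f ω + g ω| / (a + b)) ^ p ≤
      a / (a + b) * (|f ω| / a) ^ p + b / (a + b) * (|g ω| / b) ^ p := by
    intro ω
    have h1 : |f ω + g ω| / (a + b) ≤ a / (a + b) * (|f ω| / a) + b / (a + b) * (|g ω| / b) := by
      have h2 : a / (a + b) * (|f ω| / a) + b / (a + b) * (|g ω| / b)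
          = (|f ω| + |g ω|) / (a + b) := by field_simp
      rw [h2]
      gcongr
      exact abs_add_le _ _
    refine (pow_le_pow_left₀ (by positivity) h1 p).trans ?_
    have hx : |f ω| / a ∈ Set.Ici (0 : ℝ) := Set.mem_Ici.2 (by positivity)
    have hy : |g ω| / b ∈ Set.Ici (0 : ℝ) := Set.mem_Ici.2 (by positivity)
    have hwa : 0 ≤ a / (a + b) := by positivity
    have hwb : 0 ≤ b / (a + b) := by positivity
    have := (convexOn_pow (𝕜 := ℝ) p).2 hx hy hwa hwb (by field_simp)
    simpa [smul_eq_mul] using this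
  calc 𝔼 ω, (|f ω + g ω| / (a + b)) ^ p
      ≤ 𝔼 ω, (a / (a + b) * (|f ω| / a) ^ p + b / (a + b) * (|g ω| / b) ^ p) :=
        expect_le_expect fun ω _ => key ω
    _ = a / (a + b) * 𝔼 ω, (|f ω| / a) ^ p + b / (a + b) * 𝔼 ω, (|g ω| / b) ^ p := by
        rw [expect_add_distrib, ← mul_expect, ← mul_expect]
    _ ≤ a / (a + b) * 1 + b / (a + b) * 1 := by
        gcongr
        · exact hf.normalized ha
        · exact hg.normalized hb
    _ = 1 := by field_simp

theorem MomentBound.sum [Nonempty Ω] {ι : Type*} (hp : p ≠ 0) (s : Finset ι) {F : ι → Ω → ℝ}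
    {A : ι → ℝ} (h : ∀ i ∈ s, MomentBound p (F i) (A i)) :
    MomentBound p (fun ω => ∑ i ∈ s, F i ω) (∑ i ∈ s, A i) := by
  classical
  induction s using Finset.induction_on with
  | empty => simpa using momentBound_of_le (f := fun _ : Ω => (0 : ℝ)) (a := 0) p (by simp)
  | insert i s hi ih =>
    simp only [sum_insert hi]
    exact (h i (mem_insert_self _ _)).add hp (ih fun j hj => h j (mem_insert_of_mem hj))

/-- Averages of functions with a common moment bound satisfy that bound. -/
theorem momentBound_expect [Nonempty Ω] {Z : Type*} [Fintype Z] [Nonempty Z] (hp : p ≠ 0)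
    {F : Z → Ω → ℝ} (h : ∀ z, MomentBound p (F z) a) :
    MomentBound p (fun ω => 𝔼 z, F z ω) a := by
  have hc : (0 : ℝ) < Fintype.card Z := by exact_mod_cast Fintype.card_pos
  have h1 := MomentBound.sum hp univ (F := fun z ω => (Fintype.card Z : ℝ)⁻¹ * F z ω)
    (A := fun _ => |(Fintype.card Z : ℝ)⁻¹| * a) fun z _ => (h z).const_mul _
  have h2 : ∑ _z : Z, |(Fintype.card Z : ℝ)⁻¹| * a = a := by
    rw [sum_const, card_univ, nsmul_eq_mul, abs_of_pos (inv_pos.2 hc)]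
    field_simp
  have h3 : (fun ω => 𝔼 z, F z ω) = fun ω => ∑ z, (Fintype.card Z : ℝ)⁻¹ * F z ω := by
    funext ω
    rw [Fintype.expect_eq_sum_div_card, ← mul_sum, div_eq_inv_mul]
  rw [h3, ← h2]
  exact h1

theorem momentBound_sq_iff (p : ℕ) (ha : 0 ≤ a) :
    MomentBound p (fun ω => f ω ^ 2) (a ^ 2) ↔ MomentBound (2 * p) f a := by
  unfold MomentBound
  simp only [abs_pow, pow_mul, ha, sq_nonneg, true_and]

theorem MomentBound.of_sq (h : MomentBound p (fun ω => f ω ^ 2) a) :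
    MomentBound (2 * p) f (√a) := by
  rw [← momentBound_sq_iff p (Real.sqrt_nonneg a), Real.sq_sqrt h.1]
  exact h

/-- Hölder's inequality for finite products. -/
theorem MomentBound.prod [Nonempty Ω] {ι : Type*} {v : ℕ} (s : Finset ι) {F : ι → Ω → ℝ}
    {A : ι → ℝ} (hp : p ≠ 0) (hs : #s ≤ v) (h : ∀ i ∈ s, MomentBound (p * v) (F i) (A i)) :
    MomentBound p (fun ω => ∏ i ∈ s, F i ω) (∏ i ∈ s, A i) := by
  classical
  rcases s.eq_empty_or_nonempty with he | hne
  · subst he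
    simpa using momentBound_of_le (f := fun _ : Ω => (1 : ℝ)) (a := 1) p (by simp)
  have hc : 0 < #s := hne.card_pos
  have h' : ∀ i ∈ s, MomentBound (p * #s) (F i) (A i) := fun i hi =>
    (h i hi).exponent_le (Nat.mul_le_mul_left p hs)
  have hA : 0 ≤ ∏ i ∈ s, A i := prod_nonneg fun i hi => (h i hi).1
  by_cases hz : ∃ i ∈ s, A i = 0
  · obtain ⟨i, hi, hAi⟩ := hz
    refine (momentBound_of_le (a := 0) p fun ω => ?_).mono hA
    have h0 := h' i hi
    rw [hAi] at h0
    rw [prod_eq_zero hi (h0.eq_zero (by positivity) ω), abs_zero]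
  push Not at hz
  have hpos : ∀ i ∈ s, 0 < A i := fun i hi => lt_of_le_of_ne (h i hi).1 (Ne.symm (hz i hi))
  refine momentBound_of_normalized (prod_pos hpos) ?_
  have hcr : (0 : ℝ) < #s := by exact_mod_cast hc
  have key : ∀ ω, (|∏ i ∈ s, F i ω| / ∏ i ∈ s, A i) ^ p ≤
      ∑ i ∈ s, (#s : ℝ)⁻¹ * (|F i ω| / A i) ^ (p * #s) := by
    intro ω
    have hg := Real.geom_mean_le_arith_mean_weighted s (fun _ => (#s : ℝ)⁻¹)
      (fun i => (|F i ω| / A i) ^ (p * #s)) (fun _ _ => by positivity)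
      (by rw [sum_const, nsmul_eq_mul]; field_simp)
      (fun i hi => pow_nonneg (div_nonneg (abs_nonneg _) (hpos i hi).le) _)
    refine le_trans (le_of_eq ?_) hg
    rw [abs_prod, ← prod_div_distrib, ← prod_pow]
    refine prod_congr rfl fun i hi => ?_
    rw [pow_mul, Real.pow_rpow_inv_natCast
      (pow_nonneg (div_nonneg (abs_nonneg _) (hpos i hi).le) _) hc.ne']
  calc 𝔼 ω, (|∏ i ∈ s, F i ω| / ∏ i ∈ s, A i) ^ p
      ≤ 𝔼 ω, ∑ i ∈ s, (#s : ℝ)⁻¹ * (|F i ω| / A i) ^ (p * #s) :=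
        expect_le_expect fun ω _ => key ω
    _ = ∑ i ∈ s, (#s : ℝ)⁻¹ * 𝔼 ω, (|F i ω| / A i) ^ (p * #s) := by
        rw [expect_sum_comm]
        exact sum_congr rfl fun i _ => (mul_expect _ _ _).symm
    _ ≤ ∑ i ∈ s, (#s : ℝ)⁻¹ * 1 := by
        gcongr with i hi
        exact (h' i hi).normalized (hpos i hi)
    _ = 1 := by rw [sum_const, nsmul_eq_mul]; field_simp

theorem MomentBound.mul [Nonempty Ω] (hp : p ≠ 0) (hf : MomentBound (2 * p) f a)
    (hg : MomentBound (2 * p) g b) : MomentBound p (fun ω => f ω * g ω) (a * b) := by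
  have := MomentBound.prod (v := 2) (univ : Finset Bool)
    (F := fun i => bif i then f else g) (A := fun i => bif i then a else b) hp (by simp)
    (by intro i _; cases i <;> simpa [mul_comm p 2])
  simpa using this

/-- If `S` has a bound on a moment of order comparable to the logarithm of the second moment of
`Ψ`, then `S` is essentially bounded as far as the integral of `|S|Ψ` is concerned. -/
theorem MomentBound.expect_abs_mul_le [Nonempty Ω] (hp : p ≠ 0) {Ψ : Ω → ℝ}
    (hf : MomentBound (2 * p) f a) (h0 : ∀ ω, 0 ≤ Ψ ω)
    (h2 : 𝔼 ω, Ψ ω ^ 2 ≤ Real.exp p ^ 2) :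
    𝔼 ω, |f ω| * Ψ ω ≤ Real.exp 1 * a * (𝔼 ω, Ψ ω + 1) := by
  rcases hf.1.eq_or_lt with ha | ha
  · subst ha
    simp [hf.eq_zero (by omega)]
  set e := Real.exp 1 with he
  have hepos : 0 < e := Real.exp_pos 1
  have hexp : Real.exp p = e ^ p := by rw [he, ← Real.exp_nat_mul, mul_one]
  have hcs : 𝔼 ω, |f ω| ^ p * Ψ ω ≤ a ^ p * e ^ p := by
    have h3 : (𝔼 ω, |f ω| ^ p * Ψ ω) ^ 2 ≤ (𝔼 ω, (|f ω| ^ p) ^ 2) * 𝔼 ω, Ψ ω ^ 2 := by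
      have := sum_mul_sq_le_sq_mul_sq univ (fun ω => |f ω| ^ p) Ψ
      simp only [Fintype.expect_eq_sum_div_card]
      rw [div_pow, div_mul_div_comm, ← pow_two]
      gcongr
    refine abs_le_of_sq_le_sq' (h3.trans ?_) (by positivity) |>.2
    rw [mul_pow, ← pow_mul, ← hexp]
    refine mul_le_mul ?_ h2 (expect_nonneg fun ω _ => by positivity) (by positivity)
    have := hf.2
    simpa only [← pow_mul, mul_comm p 2] using this
  have hpt : ∀ ω, |f ω| * Ψ ω ≤ e * a * Ψ ω + e * a * ((e * a) ^ p)⁻¹ * (|f ω| ^ p * Ψ ω) := by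
    intro ω
    have hea : 0 < e * a := by positivity
    have h4 : |f ω| ≤ e * a + e * a * ((e * a) ^ p)⁻¹ * |f ω| ^ p := by
      by_cases hc : |f ω| ≤ e * a
      · have : 0 ≤ e * a * ((e * a) ^ p)⁻¹ * |f ω| ^ p := by positivity
        linarith
      · push Not at hc
        have h5 : 1 ≤ |f ω| / (e * a) := by rw [one_le_div hea]; exact hc.le
        have h6 := le_self_pow₀ h5 hp
        rw [div_pow, div_le_div_iff₀ hea (by positivity)] at h6
        have h7 : |f ω| ≤ e * a * ((e * a) ^ p)⁻¹ * |f ω| ^ p := by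
          rw [mul_assoc, mul_comm (((e * a) ^ p)⁻¹), ← mul_assoc, ← div_eq_mul_inv,
            le_div_iff₀ (by positivity)]
          linarith
        linarith
    calc |f ω| * Ψ ω ≤ (e * a + e * a * ((e * a) ^ p)⁻¹ * |f ω| ^ p) * Ψ ω :=
          mul_le_mul_of_nonneg_right h4 (h0 ω)
      _ = _ := by ring
  calc 𝔼 ω, |f ω| * Ψ ω
      ≤ 𝔼 ω, (e * a * Ψ ω + e * a * ((e * a) ^ p)⁻¹ * (|f ω| ^ p * Ψ ω)) :=
        expect_le_expect fun ω _ => hpt ω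
    _ = e * a * 𝔼 ω, Ψ ω + e * a * ((e * a) ^ p)⁻¹ * 𝔼 ω, |f ω| ^ p * Ψ ω := by
        rw [expect_add_distrib, ← mul_expect, ← mul_expect]
    _ ≤ e * a * 𝔼 ω, Ψ ω + e * a * ((e * a) ^ p)⁻¹ * (a ^ p * e ^ p) := by gcongr
    _ = e * a * (𝔼 ω, Ψ ω + 1) := by
        rw [← mul_pow, mul_comm a e, mul_assoc (e * a), inv_mul_cancel₀ (by positivity)]
        ring

end Moments

/-! ### Two-point inequalities -/

/-- A two-point hypercontractive inequality: the even part of `(x + y + e)^m` in `e` is at most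
`(x + 4my)^m` when `e` is no larger than `2√(xy)`. -/
theorem two_point_inequality {x y e : ℝ} (hx : 0 ≤ x) (hy : 0 ≤ y) (he : e ^ 2 ≤ 4 * x * y)
    (m : ℕ) : ((x + y + e) ^ m + (x + y - e) ^ m) / 2 ≤ (x + 4 * m * y) ^ m := by
  set c := x + y with hc
  have hc0 : 0 ≤ c := by positivity
  -- even and odd parts `E`, `O` satisfy a linear recursion in `m`
  have key : ∀ m : ℕ, 0 ≤ ((c + e) ^ m + (c - e) ^ m) / 2 ∧
      0 ≤ e * (((c + e) ^ m - (c - e) ^ m) / 2) ∧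
      e * (((c + e) ^ m - (c - e) ^ m) / 2) ≤
        4 * m * y * (((c + e) ^ m + (c - e) ^ m) / 2) := by
    intro m
    induction m with
    | zero => simp
    | succ m ih =>
      obtain ⟨h1, h2, h3⟩ := ih
      set E := ((c + e) ^ m + (c - e) ^ m) / 2 with hE
      set O := ((c + e) ^ m - (c - e) ^ m) / 2 with hO
      have hE' : ((c + e) ^ (m + 1) + (c - e) ^ (m + 1)) / 2 = c * E + e * O := by
        rw [hE, hO]; ring
      have hO' : e * (((c + e) ^ (m + 1) - (c - e) ^ (m + 1)) / 2) = c * (e * O) + e ^ 2 * E := by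
        rw [hE, hO]; ring
      rw [hE', hO']
      refine ⟨by positivity, by positivity, ?_⟩
      have h4 : c * (e * O) ≤ c * (4 * m * y * E) := mul_le_mul_of_nonneg_left h3 hc0
      have h5 : e ^ 2 * E ≤ 4 * c * y * E := by
        refine mul_le_mul_of_nonneg_right (he.trans ?_) h1
        gcongr
        linarith
      have h6 : 0 ≤ 4 * ((m : ℝ) + 1) * y * (e * O) := by positivity
      push_cast
      nlinarith
  have hstep : ∀ k ≤ m, ((c + e) ^ k + (c - e) ^ k) / 2 ≤ (x + 4 * m * y) ^ k := by
    intro k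
    induction k with
    | zero => intro _; simp
    | succ k ih =>
      intro hk
      obtain ⟨h1, h2, h3⟩ := key k
      have ih := ih (by omega)
      have hE' : ((c + e) ^ (k + 1) + (c - e) ^ (k + 1)) / 2 =
          c * (((c + e) ^ k + (c - e) ^ k) / 2) + e * (((c + e) ^ k - (c - e) ^ k) / 2) := by
        ring
      have hkm : ((k : ℝ) + 1) ≤ m := by exact_mod_cast hk
      rw [hE', pow_succ]
      calc c * (((c + e) ^ k + (c - e) ^ k) / 2) + e * (((c + e) ^ k - (c - e) ^ k) / 2)
          ≤ (((c + e) ^ k + (c - e) ^ k) / 2) * (c + 4 * k * y) := by linarith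
        _ ≤ (x + 4 * m * y) ^ k * (x + 4 * m * y) := by
            refine mul_le_mul ih ?_ (by positivity) (by positivity)
            rw [hc]
            nlinarith
  exact hstep m le_rfl

theorem two_point_inequality_real (a b : ℝ) (m : ℕ) :
    (((a + b) ^ 2) ^ m + ((a - b) ^ 2) ^ m) / 2 ≤ (a ^ 2 + 4 * m * b ^ 2) ^ m := by
  have := two_point_inequality (sq_nonneg a) (sq_nonneg b) (e := 2 * a * b)
    (by nlinarith) m
  calc _ = ((a ^ 2 + b ^ 2 + 2 * a * b) ^ m + (a ^ 2 + b ^ 2 - 2 * a * b) ^ m) / 2 := by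
        congr 3 <;> ring
    _ ≤ _ := this

/-- The square of the Hilbert–Schmidt norm of `G Gᵀ`, i.e. the fourth power of the Schatten
`4`-norm of the matrix `G`. -/
def schattenFour {U W : Type*} [Fintype U] [Fintype W] (G : U → W → ℝ) : ℝ :=
  ∑ u, ∑ v, (∑ w, G u w * G v w) ^ 2

section Schatten

variable {U W : Type*} [Fintype U] [Fintype W]

theorem schattenFour_nonneg (G : U → W → ℝ) : 0 ≤ schattenFour G :=
  sum_nonneg fun _ _ => sum_nonneg fun _ _ => sq_nonneg _

theorem sum_sq_gram_mul (A B : U → W → ℝ) :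
    ∑ u, ∑ v, (∑ w, A u w * B v w) ^ 2 =
      ∑ w, ∑ w', (∑ u, A u w * A u w') * ∑ v, B v w * B v w' := by
  simp only [pow_two, sum_mul_sum]
  rw [sum_congr rfl fun u _ => sum_comm]
  rw [sum_comm]
  refine sum_congr rfl fun w _ => ?_
  rw [sum_congr rfl fun u _ => sum_comm, sum_comm]
  refine sum_congr rfl fun w' _ => ?_
  refine sum_congr rfl fun u _ => sum_congr rfl fun v _ => ?_
  ring

theorem schattenFour_eq_transpose (A : U → W → ℝ) :
    schattenFour A = ∑ w, ∑ w', (∑ u, A u w * A u w') ^ 2 := by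
  unfold schattenFour
  rw [sum_sq_gram_mul]
  simp only [pow_two]

theorem double_sum_mul_sq_le {X Y : Type*} [Fintype X] [Fintype Y] (a b : X → Y → ℝ) :
    (∑ x, ∑ y, a x y * b x y) ^ 2 ≤ (∑ x, ∑ y, a x y ^ 2) * ∑ x, ∑ y, b x y ^ 2 := by
  simp only [← Fintype.sum_prod_type']
  exact sum_mul_sq_le_sq_mul_sq _ _ _

theorem sum_sq_gram_mul_le (A B : U → W → ℝ) :
    (∑ u, ∑ v, (∑ w, A u w * B v w) ^ 2) ^ 2 ≤ schattenFour A * schattenFour B := by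
  rw [sum_sq_gram_mul, schattenFour_eq_transpose A, schattenFour_eq_transpose B]
  exact double_sum_mul_sq_le _ _

/-- The quadratic form of a Gram matrix is bounded by its Hilbert–Schmidt norm. -/
theorem sum_sq_mulVec_le (F : U → ℝ) (G : U → W → ℝ) :
    ∑ w, (∑ u, F u * G u w) ^ 2 ≤ (∑ u, F u ^ 2) * √(schattenFour G) := by
  have h1 : ∑ w, (∑ u, F u * G u w) ^ 2 = ∑ u, ∑ v, (F u * F v) * ∑ w, G u w * G v w := by
    have h0 : ∀ w, (∑ u, F u * G u w) ^ 2 = ∑ u, ∑ v, (F u * G u w) * (F v * G v w) :=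
      fun w => by rw [pow_two, sum_mul_sum]
    rw [sum_congr rfl fun w _ => h0 w, sum_comm]
    refine sum_congr rfl fun u _ => ?_
    rw [sum_comm]
    refine sum_congr rfl fun v _ => ?_
    rw [mul_sum]
    refine sum_congr rfl fun w _ => ?_
    ring
  have h2 : ∑ u, ∑ v, (F u * F v) ^ 2 = (∑ u, F u ^ 2) ^ 2 := by
    rw [pow_two (∑ u, F u ^ 2), sum_mul_sum]
    simp only [mul_pow]
  have h3 := double_sum_mul_sq_le (fun u v => F u * F v) (fun u v => ∑ w, G u w * G v w)
  rw [h2, ← h1] at h3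
  refine abs_le_of_sq_le_sq' (h3.trans (le_of_eq ?_)) (by positivity) |>.2
  rw [mul_pow, Real.sq_sqrt (schattenFour_nonneg G)]
  rfl

/-- The Schatten `4`-norm has type two: this is the two-point inequality behind it. -/
theorem two_point_inequality_schattenFour (A B : U → W → ℝ) (m : ℕ) (hm : m ≠ 0) :
    (√(schattenFour (A + B)) ^ (2 * m) + √(schattenFour (A - B)) ^ (2 * m)) / 2 ≤
      (√(schattenFour A) + 9 * m * √(schattenFour B)) ^ (2 * m) := by
  set α := √(schattenFour A) with hα
  set β := √(schattenFour B) with hβ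
  have hα0 : 0 ≤ α := Real.sqrt_nonneg _
  have hβ0 : 0 ≤ β := Real.sqrt_nonneg _
  have hα2 : α ^ 2 = schattenFour A := Real.sq_sqrt (schattenFour_nonneg A)
  have hβ2 : β ^ 2 = schattenFour B := Real.sq_sqrt (schattenFour_nonneg B)
  -- `(A ± B)(A ± B)ᵀ = P ± Q`
  set P : U → U → ℝ := fun u v => ∑ w, A u w * A v w + ∑ w, B u w * B v w with hP
  set Q : U → U → ℝ := fun u v => ∑ w, A u w * B v w + ∑ w, B u w * A v w with hQ
  set X := ∑ u, ∑ v, P u v ^ 2 with hX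
  set Y := ∑ u, ∑ v, Q u v ^ 2 with hY
  set e := 2 * ∑ u, ∑ v, P u v * Q u v with he
  have hX0 : 0 ≤ X := sum_nonneg fun _ _ => sum_nonneg fun _ _ => sq_nonneg _
  have hY0 : 0 ≤ Y := sum_nonneg fun _ _ => sum_nonneg fun _ _ => sq_nonneg _
  have hplus : schattenFour (A + B) = X + Y + e := by
    simp only [schattenFour, hX, hY, he, mul_sum, ← sum_add_distrib, Pi.add_apply]
    refine sum_congr rfl fun u _ => sum_congr rfl fun v _ => ?_
    have : ∑ w, (A u w + B u w) * (A v w + B v w) = P u v + Q u v := by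
      simp only [hP, hQ, ← sum_add_distrib]
      exact sum_congr rfl fun w _ => by ring
    rw [this]; ring
  have hminus : schattenFour (A - B) = X + Y - e := by
    simp only [schattenFour, hX, hY, he, mul_sum, ← sum_add_distrib, ← sum_sub_distrib,
      Pi.sub_apply]
    refine sum_congr rfl fun u _ => sum_congr rfl fun v _ => ?_
    have : ∑ w, (A u w - B u w) * (A v w - B v w) = P u v - Q u v := by
      simp only [hP, hQ, ← sum_add_distrib, ← sum_sub_distrib]
      exact sum_congr rfl fun w _ => by ring
    rw [this]; ring
  have hcs : e ^ 2 ≤ 4 * X * Y := by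
    have := double_sum_mul_sq_le P Q
    rw [he, mul_pow]
    linarith
  have hXle : X ≤ (α + β) ^ 2 := by
    have h1 := double_sum_mul_sq_le (fun u v => ∑ w, A u w * A v w)
      (fun u v => ∑ w, B u w * B v w)
    have h2 : ∑ u, ∑ v, (∑ w, A u w * A v w) * (∑ w, B u w * B v w) ≤ α * β := by
      refine abs_le_of_sq_le_sq' (h1.trans (le_of_eq ?_)) (by positivity) |>.2
      rw [mul_pow, hα2, hβ2]; rfl
    have h3 : X = schattenFour A + schattenFour B +
        2 * ∑ u, ∑ v, (∑ w, A u w * A v w) * (∑ w, B u w * B v w) := by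
      have h4 : ∀ u v, P u v ^ 2 = (∑ w, A u w * A v w) ^ 2 + (∑ w, B u w * B v w) ^ 2 +
          2 * ((∑ w, A u w * A v w) * ∑ w, B u w * B v w) := fun u v => by
        simp only [hP]; ring
      simp only [hX, h4, schattenFour, sum_add_distrib, ← mul_sum]
    rw [h3, ← hα2, ← hβ2]
    nlinarith
  have hYle : Y ≤ 4 * (α * β) := by
    have hab : ∑ u, ∑ v, (∑ w, A u w * B v w) ^ 2 ≤ α * β := by
      refine abs_le_of_sq_le_sq' ((sum_sq_gram_mul_le A B).trans (le_of_eq ?_))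
        (by positivity) |>.2
      rw [mul_pow, hα2, hβ2]
    have hba : ∑ u, ∑ v, (∑ w, B u w * A v w) ^ 2 ≤ α * β := by
      refine abs_le_of_sq_le_sq' ((sum_sq_gram_mul_le B A).trans (le_of_eq ?_))
        (by positivity) |>.2
      rw [mul_pow, hα2, hβ2, mul_comm]
    calc Y ≤ ∑ u, ∑ v, (2 * (∑ w, A u w * B v w) ^ 2 + 2 * (∑ w, B u w * A v w) ^ 2) := by
          refine sum_le_sum fun u _ => sum_le_sum fun v _ => ?_
          simp only [hQ]
          nlinarith [sq_nonneg ((∑ w, A u w * B v w) - ∑ w, B u w * A v w)]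
      _ = 2 * ∑ u, ∑ v, (∑ w, A u w * B v w) ^ 2 + 2 * ∑ u, ∑ v, (∑ w, B u w * A v w) ^ 2 := by
          simp only [sum_add_distrib, mul_sum]
      _ ≤ 4 * (α * β) := by linarith
  have hm1 : (1 : ℝ) ≤ m := by exact_mod_cast Nat.one_le_iff_ne_zero.2 hm
  rw [pow_mul, pow_mul, pow_mul, Real.sq_sqrt (schattenFour_nonneg _),
    Real.sq_sqrt (schattenFour_nonneg _), hplus, hminus]
  refine (two_point_inequality hX0 hY0 hcs m).trans (pow_le_pow_left₀ (by positivity) ?_ m)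
  have h1 : 4 * (m : ℝ) * Y ≤ 4 * m * (4 * (α * β)) := by gcongr
  have h2 : 0 ≤ α * β := by positivity
  have h3 : β ^ 2 ≤ (9 * m * β) ^ 2 := by
    refine pow_le_pow_left₀ hβ0 ?_ 2
    nlinarith
  nlinarith

end Schatten

/-! ### The bit cube and martingale inequalities -/

/-- Points of the dyadic grid of mesh `2^{-(n+1)}` in `[0,1)^d`, by the binary digits of their
coordinates: `ω m k` is the digit of `2^{-(k+1)}` in the coordinate `m`. -/
abbrev BitCube (d n : ℕ) : Type := Fin d → Fin (n + 1) → Bool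

namespace BitCube

variable {d n : ℕ}

/-- Flip the `k`-th digit of the `m`-th coordinate. -/
def flipBit (m : Fin d) (k : Fin (n + 1)) (ω : BitCube d n) : BitCube d n :=
  Function.update ω m (Function.update (ω m) k (!ω m k))

theorem flipBit_apply_same (m : Fin d) (k : Fin (n + 1)) (ω : BitCube d n) :
    flipBit m k ω m k = !ω m k := by
  simp [flipBit]

theorem flipBit_apply_ne (m : Fin d) (k : Fin (n + 1)) (ω : BitCube d n) {m' : Fin d}
    {k' : Fin (n + 1)} (h : m' ≠ m ∨ k' ≠ k) : flipBit m k ω m' k' = ω m' k' := by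
  unfold flipBit
  by_cases hm : m' = m
  · subst hm
    have hk : k' ≠ k := by simpa using h
    simp [hk]
  · simp [hm]

theorem flipBit_flipBit (m : Fin d) (k : Fin (n + 1)) :
    Function.Involutive (flipBit (n := n) m k) := by
  intro ω
  funext m' k'
  by_cases h : m' ≠ m ∨ k' ≠ k
  · rw [flipBit_apply_ne m k _ h, flipBit_apply_ne m k _ h]
  · push Not at h
    obtain ⟨rfl, rfl⟩ := h
    rw [flipBit_apply_same, flipBit_apply_same, Bool.not_not]

theorem expect_flipBit (m : Fin d) (k : Fin (n + 1)) (f : BitCube d n → ℝ) :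
    𝔼 ω, f (flipBit m k ω) = 𝔼 ω, f ω :=
  Fintype.expect_equiv (flipBit_flipBit m k).toPerm _ _ fun _ => rfl

theorem expect_eq_expect_average (m : Fin d) (k : Fin (n + 1)) (f : BitCube d n → ℝ) :
    𝔼 ω, f ω = 𝔼 ω, (f ω + f (flipBit m k ω)) / 2 := by
  rw [← expect_div, expect_add_distrib, expect_flipBit]
  ring

theorem expect_eq_zero_of_flipBit (m : Fin d) (k : Fin (n + 1)) {f : BitCube d n → ℝ}
    (h : ∀ ω, f (flipBit m k ω) = -f ω) : 𝔼 ω, f ω = 0 := by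
  have := expect_flipBit m k f
  simp only [h, expect_neg_distrib] at this
  linarith

end BitCube

open BitCube

section Martingale

variable {d n : ℕ} {W : Type*} [AddCommGroup W]

/-- `g` has scale `k` in the `m`-th coordinate, like a combination of Haar functions of intervals
of length `2^{-k}`: it is odd in the `k`-th digit and does not depend on the later ones. -/
def IsScaleAt (m : Fin d) (k : Fin (n + 1)) (g : BitCube d n → W) : Prop :=
  (∀ ω, g (flipBit m k ω) = -g ω) ∧ ∀ k', k < k' → ∀ ω, g (flipBit m k' ω) = g ω

theorem IsScaleAt.sum {ι : Type*} {m : Fin d} {k : Fin (n + 1)} (s : Finset ι)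
    {g : ι → BitCube d n → W} (h : ∀ i ∈ s, IsScaleAt m k (g i)) :
    IsScaleAt m k (fun ω => ∑ i ∈ s, g i ω) := by
  refine ⟨fun ω => ?_, fun k' hk ω => ?_⟩
  · rw [← sum_neg_distrib]
    exact sum_congr rfl fun i hi => (h i hi).1 ω
  · exact sum_congr rfl fun i hi => (h i hi).2 k' hk ω

/-- Martingale type two: if a nonnegative functional `h` satisfies a two-point inequality, then so
it does for sums of functions of distinct scales in one coordinate. -/
theorem momentBound_sum_of_isScaleAt {m : Fin d} {p : ℕ} (hp : p ≠ 0) {h : W → ℝ} {c : ℝ}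
    (hc : 0 ≤ c) (h_nonneg : ∀ A, 0 ≤ h A) (h_zero : h 0 = 0)
    (h_two : ∀ A B, (h (A + B) ^ p + h (A - B) ^ p) / 2 ≤ (h A + c * h B) ^ p)
    {D : Fin (n + 1) → BitCube d n → W} (hD : ∀ k, IsScaleAt m k (D k)) {b : Fin (n + 1) → ℝ}
    (hb : ∀ k, MomentBound p (fun ω => h (D k ω)) (b k)) (s : Finset (Fin (n + 1))) :
    MomentBound p (fun ω => h (∑ k ∈ s, D k ω)) (c * ∑ k ∈ s, b k) := by
  induction s using Finset.induction_on_max with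
  | empty =>
    simp only [sum_empty, mul_zero, h_zero]
    exact momentBound_of_le p fun ω => by simp
  | insert a s ha ih =>
    have has : a ∉ s := fun h => lt_irrefl a (ha a h)
    have hsum := ih.add hp ((hb a).const_mul c)
    rw [abs_of_nonneg hc, ← mul_add, add_comm (∑ k ∈ s, b k), ← sum_insert has] at hsum
    refine ⟨hsum.1, le_trans ?_ hsum.2⟩
    rw [expect_eq_expect_average m a]
    refine expect_le_expect fun ω _ => ?_
    have h1 : ∑ k ∈ s, D k (flipBit m a ω) = ∑ k ∈ s, D k ω :=
      sum_congr rfl fun k hk => (hD k).2 a (ha k hk) ω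
    beta_reduce
    rw [sum_insert has, sum_insert has, h1, (hD a).1 ω, abs_of_nonneg (h_nonneg _),
      abs_of_nonneg (h_nonneg _), abs_of_nonneg (add_nonneg (h_nonneg _)
      (mul_nonneg hc (h_nonneg _))), add_comm (D a ω), add_comm (-D a ω), ← sub_eq_add_neg]
    exact h_two _ _

/-- Martingale type two for real functions. -/
theorem momentBound_sq_sum_of_isScaleAt {m : Fin d} {p : ℕ} (hp : p ≠ 0)
    {D : Fin (n + 1) → BitCube d n → ℝ} (hD : ∀ k, IsScaleAt m k (D k)) {b : Fin (n + 1) → ℝ}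
    (hb : ∀ k, MomentBound p (fun ω => D k ω ^ 2) (b k)) :
    MomentBound p (fun ω => (∑ k, D k ω) ^ 2) (4 * p * ∑ k, b k) :=
  momentBound_sum_of_isScaleAt (h := fun x : ℝ => x ^ 2) hp (by positivity) (fun _ => sq_nonneg _)
    (by simp) (fun A B => two_point_inequality_real A B p) hD hb univ

theorem expect_pow_le_expect_squareFunction {m : Fin d} (p : ℕ)
    {D : Fin (n + 1) → BitCube d n → ℝ} (hD : ∀ k, IsScaleAt m k (D k))
    (s : Finset (Fin (n + 1))) :
    𝔼 ω, ((∑ k ∈ s, D k ω) ^ 2) ^ (p + 1) ≤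
      4 * (p + 1) ^ 2 * 𝔼 ω, (∑ k ∈ s, D k ω ^ 2) *
        ((∑ k ∈ s, D k ω) ^ 2 + 4 * (p + 1) * ∑ k ∈ s, D k ω ^ 2) ^ p := by
  induction s using Finset.induction_on_max with
  | empty => simp
  | insert a s ha ih =>
    have has : a ∉ s := fun h => lt_irrefl a (ha a h)
    set S : BitCube d n → ℝ := fun ω => ∑ k ∈ s, D k ω with hS
    set V : BitCube d n → ℝ := fun ω => ∑ k ∈ s, D k ω ^ 2 with hV
    have hSf : ∀ ω, S (flipBit m a ω) = S ω := fun ω =>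
      sum_congr rfl fun k hk => (hD k).2 a (ha k hk) ω
    have hVf : ∀ ω, V (flipBit m a ω) = V ω := fun ω =>
      sum_congr rfl fun k hk => by rw [(hD k).2 a (ha k hk) ω]
    have hV0 : ∀ ω, 0 ≤ V ω := fun ω => sum_nonneg fun _ _ => sq_nonneg _
    set c : ℝ := 4 * (p + 1) with hc
    have hc0 : 0 ≤ c := by positivity
    simp only [sum_insert has]
    -- one step of the martingale, by the two-point inequality
    have h1 : 𝔼 ω, ((D a ω + S ω) ^ 2) ^ (p + 1) ≤ 𝔼 ω, (S ω ^ 2 + c * D a ω ^ 2) ^ (p + 1) := by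
      rw [expect_eq_expect_average m a]
      refine expect_le_expect fun ω _ => ?_
      rw [hSf, (hD a).1 ω]
      have := two_point_inequality_real (S ω) (D a ω) (p + 1)
      push_cast at this
      rw [add_comm (D a ω), add_comm (-D a ω), ← sub_eq_add_neg]
      exact this
    have h2 : ∀ ω, (S ω ^ 2 + c * D a ω ^ 2) ^ (p + 1) ≤ (S ω ^ 2) ^ (p + 1) +
        (p + 1) * c * (D a ω ^ 2 * (S ω ^ 2 + c * D a ω ^ 2) ^ p) := by
      intro ω
      have hconv : ∀ (x y : ℝ), 0 ≤ x → 0 ≤ y → ∀ j : ℕ,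
          (x + y) ^ (j + 1) ≤ x ^ (j + 1) + (j + 1) * y * (x + y) ^ j := by
        intro x y hx hy j
        induction j with
        | zero => simp
        | succ j ihj =>
          have h3 : x ^ (j + 1) ≤ (x + y) ^ (j + 1) := pow_le_pow_left₀ hx (by linarith) _
          calc (x + y) ^ (j + 1 + 1) = (x + y) ^ (j + 1) * (x + y) := pow_succ _ _
            _ ≤ (x ^ (j + 1) + (j + 1) * y * (x + y) ^ j) * (x + y) :=
              mul_le_mul_of_nonneg_right ihj (by linarith)
            _ = x ^ (j + 1 + 1) + x ^ (j + 1) * y + (j + 1) * y * (x + y) ^ (j + 1) := by ring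
            _ ≤ x ^ (j + 1 + 1) + (x + y) ^ (j + 1) * y + (j + 1) * y * (x + y) ^ (j + 1) := by
              gcongr
            _ = x ^ (j + 1 + 1) + ((j + 1 : ℕ) + 1) * y * (x + y) ^ (j + 1) := by
              push_cast; ring
      have := hconv (S ω ^ 2) (c * D a ω ^ 2) (sq_nonneg _) (by positivity) p
      linarith
    -- by convexity and invariance, `S` may be replaced by `S + D a` and the form enlarged
    have h4 : 𝔼 ω, (D a ω ^ 2 + V ω) * (S ω ^ 2 + c * (D a ω ^ 2 + V ω)) ^ p ≤
        𝔼 ω, (D a ω ^ 2 + V ω) * ((D a ω + S ω) ^ 2 + c * (D a ω ^ 2 + V ω)) ^ p := by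
      rw [expect_eq_expect_average m a
        (fun ω => (D a ω ^ 2 + V ω) * ((D a ω + S ω) ^ 2 + c * (D a ω ^ 2 + V ω)) ^ p)]
      refine expect_le_expect fun ω _ => ?_
      simp only [hSf, hVf, (hD a).1 ω, neg_sq]
      have hv : 0 ≤ D a ω ^ 2 + V ω := add_nonneg (sq_nonneg _) (hV0 ω)
      rw [← mul_add, mul_div_assoc]
      refine mul_le_mul_of_nonneg_left ?_ hv
      set C := c * (D a ω ^ 2 + V ω) with hC
      have hC0 : 0 ≤ C := mul_nonneg hc0 hv
      have hx : 0 ≤ (D a ω + S ω) ^ 2 + C := by positivity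
      have hy : 0 ≤ (-D a ω + S ω) ^ 2 + C := by positivity
      have h5 := add_pow_le hx hy p
      have h6 : (2 * (S ω ^ 2 + C)) ^ p ≤
          ((D a ω + S ω) ^ 2 + C + ((-D a ω + S ω) ^ 2 + C)) ^ p := by
        refine pow_le_pow_left₀ (by positivity) ?_ p
        nlinarith [sq_nonneg (D a ω)]
      rw [mul_pow] at h6
      have h7 := h6.trans h5
      rcases Nat.eq_zero_or_pos p with hp | hp
      · subst hp; norm_num
      · obtain ⟨j, rfl⟩ : ∃ j, p = j + 1 := ⟨p - 1, by omega⟩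
        rw [Nat.add_sub_cancel, pow_succ 2 j, mul_assoc] at h7
        have h8 := le_of_mul_le_mul_left h7 (by positivity)
        linarith
    have h9 : ∀ ω, V ω * (S ω ^ 2 + c * V ω) ^ p +
        D a ω ^ 2 * (S ω ^ 2 + c * D a ω ^ 2) ^ p ≤
        (D a ω ^ 2 + V ω) * (S ω ^ 2 + c * (D a ω ^ 2 + V ω)) ^ p := by
      intro ω
      have hv := hV0 ω
      have hd := sq_nonneg (D a ω)
      have i1 : (S ω ^ 2 + c * V ω) ^ p ≤ (S ω ^ 2 + c * (D a ω ^ 2 + V ω)) ^ p :=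
        pow_le_pow_left₀ (by positivity) (by nlinarith) p
      have i2 : (S ω ^ 2 + c * D a ω ^ 2) ^ p ≤ (S ω ^ 2 + c * (D a ω ^ 2 + V ω)) ^ p :=
        pow_le_pow_left₀ (by positivity) (by nlinarith) p
      nlinarith [mul_le_mul_of_nonneg_left i1 hv, mul_le_mul_of_nonneg_left i2 hd]
    have hK : 4 * ((p : ℝ) + 1) ^ 2 = (p + 1) * c := by rw [hc]; ring
    rw [hK] at ih ⊢
    calc 𝔼 ω, ((D a ω + S ω) ^ 2) ^ (p + 1)
        ≤ 𝔼 ω, ((S ω ^ 2) ^ (p + 1) +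
          (p + 1) * c * (D a ω ^ 2 * (S ω ^ 2 + c * D a ω ^ 2) ^ p)) :=
          h1.trans (expect_le_expect fun ω _ => h2 ω)
      _ = 𝔼 ω, (S ω ^ 2) ^ (p + 1) +
          (p + 1) * c * 𝔼 ω, D a ω ^ 2 * (S ω ^ 2 + c * D a ω ^ 2) ^ p := by
          rw [expect_add_distrib, ← mul_expect]
      _ ≤ (p + 1) * c * 𝔼 ω, V ω * (S ω ^ 2 + c * V ω) ^ p +
          (p + 1) * c * 𝔼 ω, D a ω ^ 2 * (S ω ^ 2 + c * D a ω ^ 2) ^ p := by gcongr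
      _ = (p + 1) * c * 𝔼 ω, (V ω * (S ω ^ 2 + c * V ω) ^ p +
          D a ω ^ 2 * (S ω ^ 2 + c * D a ω ^ 2) ^ p) := by
          rw [expect_add_distrib, mul_add]
      _ ≤ (p + 1) * c *
          𝔼 ω, (D a ω ^ 2 + V ω) * (S ω ^ 2 + c * (D a ω ^ 2 + V ω)) ^ p := by
          refine mul_le_mul_of_nonneg_left (expect_le_expect fun ω _ => h9 ω) (by positivity)
      _ ≤ _ := mul_le_mul_of_nonneg_left h4 (by positivity)

/-- The square function (Littlewood–Paley) inequality in one coordinate, with a constant that is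
polynomial in the exponent. -/
theorem momentBound_sq_of_squareFunction {m : Fin d} {p : ℕ} (hp : p ≠ 0)
    {D : Fin (n + 1) → BitCube d n → ℝ} (hD : ∀ k, IsScaleAt m k (D k)) {v : ℝ}
    (hv : MomentBound p (fun ω => ∑ k, D k ω ^ 2) v) :
    MomentBound p (fun ω => (∑ k, D k ω) ^ 2) (28 * p ^ 2 * v) := by
  obtain ⟨j, rfl⟩ : ∃ j, p = j + 1 := ⟨p - 1, by omega⟩
  refine ⟨mul_nonneg (by positivity) hv.1, ?_⟩
  set Y : BitCube d n → ℝ := fun ω => (∑ k, D k ω) ^ 2 with hY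
  set V : BitCube d n → ℝ := fun ω => ∑ k, D k ω ^ 2 with hV
  have hY0 : ∀ ω, 0 ≤ Y ω := fun ω => sq_nonneg _
  have hV0 : ∀ ω, 0 ≤ V ω := fun ω => sum_nonneg fun _ _ => sq_nonneg _
  have h1 := expect_pow_le_expect_squareFunction j hD univ
  set P : ℝ := j + 1 with hP
  have hP1 : 1 ≤ P := by rw [hP]; linarith [(Nat.cast_nonneg j : (0 : ℝ) ≤ j)]
  have key : ∀ ω, 4 * P ^ 2 * (V ω * (Y ω + 4 * P * V ω) ^ j) ≤
      1 / 2 * Y ω ^ (j + 1) + 1 / 2 * ((28 * P ^ 2) ^ (j + 1) * V ω ^ (j + 1)) := by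
    intro ω
    have hv := hV0 ω
    have hy := hY0 ω
    by_cases hcase : 24 * P ^ 2 * V ω ≤ Y ω
    · have i1 : Y ω + 4 * P * V ω ≤ (1 + 1 / P) * Y ω := by
        have : 4 * P * V ω ≤ 1 / P * Y ω := by
          rw [div_mul_eq_mul_div, one_mul, le_div_iff₀ (by positivity)]
          nlinarith
        linarith
      have i2 : (1 + 1 / P) ^ j ≤ 3 := by
        have e1 : 1 + 1 / P ≤ Real.exp (1 / P) := by
          rw [add_comm]; exact Real.add_one_le_exp _
        calc (1 + 1 / P) ^ j ≤ Real.exp (1 / P) ^ j := pow_le_pow_left₀ (by positivity) e1 j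
          _ = Real.exp (j * (1 / P)) := (Real.exp_nat_mul _ _).symm
          _ ≤ Real.exp 1 := by
            refine Real.exp_le_exp.2 ?_
            rw [mul_one_div, div_le_one (by positivity), hP]
            linarith
          _ ≤ 3 := by linarith [Real.exp_one_lt_d9]
      have i3 : (Y ω + 4 * P * V ω) ^ j ≤ 3 * Y ω ^ j := by
        calc (Y ω + 4 * P * V ω) ^ j ≤ ((1 + 1 / P) * Y ω) ^ j :=
              pow_le_pow_left₀ (by positivity) i1 j
          _ = (1 + 1 / P) ^ j * Y ω ^ j := mul_pow _ _ _
          _ ≤ _ := by gcongr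
      have i4 : 0 ≤ (28 * P ^ 2) ^ (j + 1) * V ω ^ (j + 1) := by positivity
      have i5 : 4 * P ^ 2 * (V ω * (Y ω + 4 * P * V ω) ^ j) ≤ 1 / 2 * Y ω ^ (j + 1) := by
        calc 4 * P ^ 2 * (V ω * (Y ω + 4 * P * V ω) ^ j)
            ≤ 4 * P ^ 2 * (V ω * (3 * Y ω ^ j)) := by gcongr
          _ = 1 / 2 * ((24 * P ^ 2 * V ω) * Y ω ^ j) := by ring
          _ ≤ 1 / 2 * (Y ω * Y ω ^ j) := by gcongr
          _ = _ := by ring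
      linarith
    · push Not at hcase
      have i1 : Y ω + 4 * P * V ω ≤ 28 * P ^ 2 * V ω := by nlinarith
      have i2 : 4 * P ^ 2 * (V ω * (Y ω + 4 * P * V ω) ^ j) ≤
          1 / 2 * ((28 * P ^ 2) ^ (j + 1) * V ω ^ (j + 1)) := by
        calc 4 * P ^ 2 * (V ω * (Y ω + 4 * P * V ω) ^ j)
            ≤ 14 * P ^ 2 * (V ω * (28 * P ^ 2 * V ω) ^ j) := by gcongr; norm_num
          _ = _ := by rw [mul_pow]; ring
      have i3 : 0 ≤ Y ω ^ (j + 1) := by positivity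
      linarith
  have h2 : 𝔼 ω, Y ω ^ (j + 1) ≤
      1 / 2 * 𝔼 ω, Y ω ^ (j + 1) + 1 / 2 * ((28 * P ^ 2) ^ (j + 1) * 𝔼 ω, V ω ^ (j + 1)) := by
    refine h1.trans ?_
    simp only [mul_expect, ← expect_add_distrib]
    exact expect_le_expect fun ω _ => key ω
  have h3 := hv.2
  simp only [abs_of_nonneg (hV0 _)] at h3
  simp only [abs_of_nonneg (hY0 _)]
  have h4 : (28 * P ^ 2) ^ (j + 1) * 𝔼 ω, V ω ^ (j + 1) ≤ (28 * P ^ 2) ^ (j + 1) * v ^ (j + 1) :=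
    mul_le_mul_of_nonneg_left h3 (by positivity)
  push_cast
  rw [mul_pow]
  linarith

end Martingale

open BitCube

/-! ### Sums of `r`-functions -/

/-- A vector of scales: `r m = k` stands for side length `2^{-k}` in the `m`-th coordinate. -/
abbrev ScaleVec (d n : ℕ) : Type := Fin d → Fin (n + 1)

/-- The scale vectors of rectangles of volume `2^{-n}`. -/
def hyperbolic (d n : ℕ) : Finset (ScaleVec d n) := univ.filter fun r => ∑ m, (r m : ℕ) = n

/-- A family of `r`-functions with coefficients bounded by one: `f r` is a combination, with
coefficients in `[-1,1]`, of the Haar functions of the rectangles with scale vector `r`. Only the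
behaviour under flips of digits matters. -/
structure IsRFamily {d n : ℕ} (f : ScaleVec d n → BitCube d n → ℝ) : Prop where
  bound : ∀ r ω, |f r ω| ≤ 1
  scale : ∀ r m, IsScaleAt m (r m) (f r)

section Sums

variable {d n : ℕ} {f g : ScaleVec d n → BitCube d n → ℝ}

theorem mem_hyperbolic {r : ScaleVec d n} : r ∈ hyperbolic d n ↔ ∑ m, (r m : ℕ) = n := by
  simp [hyperbolic]

theorem IsScaleAt.const_mul {m : Fin d} {k : Fin (n + 1)} {F : BitCube d n → ℝ}
    (h : IsScaleAt m k F) (c : ℝ) : IsScaleAt m k (fun ω => c * F ω) :=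
  ⟨fun ω => by beta_reduce; rw [h.1 ω, mul_neg], fun k' hk ω => by beta_reduce; rw [h.2 k' hk ω]⟩

theorem IsScaleAt.mul_of_invariant {m : Fin d} {k : Fin (n + 1)} {F G : BitCube d n → ℝ}
    (h : IsScaleAt m k F) (hG : ∀ k', k ≤ k' → ∀ ω, G (flipBit m k' ω) = G ω) :
    IsScaleAt m k (fun ω => F ω * G ω) :=
  ⟨fun ω => by beta_reduce; rw [h.1 ω, hG k le_rfl ω, neg_mul],
    fun k' hk ω => by beta_reduce; rw [h.2 k' hk ω, hG k' hk.le ω]⟩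

theorem IsRFamily.mul (hf : IsRFamily f) {y : ScaleVec d n → ℝ} (hy : ∀ r, |y r| ≤ 1) :
    IsRFamily (fun r ω => y r * f r ω) where
  bound r ω := by
    rw [abs_mul]
    exact mul_le_one₀ (hy r) (abs_nonneg _) (hf.bound r ω)
  scale r m := (hf.scale r m).const_mul _

theorem coord_add_eq_of_mem_hyperbolic {r s : ScaleVec d n} (hr : r ∈ hyperbolic d n)
    (hs : s ∈ hyperbolic d n) {j l : Fin d} (hjl : j ≠ l)
    (h : ∀ m, m ≠ j → m ≠ l → r m = s m) : (r j : ℕ) + r l = s j + s l := by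
  rw [mem_hyperbolic] at hr hs
  have h1 : ∑ m, ((r m : ℤ) - s m) = 0 := by
    rw [sum_sub_distrib]
    have hr' : ∑ m, (r m : ℤ) = n := by exact_mod_cast hr
    have hs' : ∑ m, (s m : ℤ) = n := by exact_mod_cast hs
    rw [hr', hs', sub_self]
  rw [Fintype.sum_eq_add j l hjl (fun m hm => by rw [h m hm.1 hm.2, sub_self])] at h1
  omega

theorem eq_of_mem_hyperbolic {r s : ScaleVec d n} (hr : r ∈ hyperbolic d n)
    (hs : s ∈ hyperbolic d n) (l : Fin d) (h : ∀ m, m ≠ l → r m = s m) : r = s := by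
  rw [mem_hyperbolic] at hr hs
  rw [← add_sum_erase _ _ (mem_univ l)] at hr hs
  have h1 : ∑ m ∈ univ.erase l, (r m : ℕ) = ∑ m ∈ univ.erase l, (s m : ℕ) :=
    sum_congr rfl fun m hm => by rw [h m (ne_of_mem_erase hm)]
  funext m
  by_cases hm : m = l
  · subst hm
    exact Fin.ext (by omega)
  · exact h m hm

theorem card_hyperbolic_filter_le {o l : Fin d} (hol : o ≠ l) (B : Finset (Fin (n + 1))) :
    #{r ∈ hyperbolic d n | r o ∈ B} ≤ #B * (n + 1) ^ (d - 2) := by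
  classical
  let T : Fin d → Finset (Fin (n + 1)) := fun m => if m = o then B else if m = l then {0} else univ
  have h1 : #{r ∈ hyperbolic d n | r o ∈ B} ≤ #(Fintype.piFinset T) := by
    refine card_le_card_of_injOn (fun r => Function.update r l 0) ?_ ?_
    · intro r hr
      rw [mem_coe, mem_filter] at hr
      rw [mem_coe, Fintype.mem_piFinset]
      intro m
      by_cases hml : m = l
      · subst hml
        simp [T, hol.symm]
      · by_cases hmo : m = o
        · subst hmo
          simpa [T, hml] using hr.2
        · simp [T, hml, hmo]
    · intro r hr s hs hrs
      rw [mem_coe, mem_filter] at hr hs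
      refine eq_of_mem_hyperbolic hr.1 hs.1 l fun m hm => ?_
      have := congrFun hrs m
      simpa [hm] using this
  refine h1.trans (le_of_eq ?_)
  rw [Fintype.card_piFinset, ← mul_prod_erase _ _ (mem_univ o),
    ← mul_prod_erase _ _ (mem_erase.2 ⟨hol.symm, mem_univ l⟩)]
  have h2 : ∏ m ∈ (univ.erase o).erase l, #(T m) = (n + 1) ^ (d - 2) := by
    rw [prod_congr rfl (g := fun _ => n + 1), prod_const]
    · congr 1
      rw [card_erase_of_mem (mem_erase.2 ⟨hol.symm, mem_univ l⟩),
        card_erase_of_mem (mem_univ o), card_univ, Fintype.card_fin]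
      omega
    · intro m hm
      rw [mem_erase, mem_erase] at hm
      simp [T, hm.1, hm.2.1]
  rw [h2]
  simp [T, hol.symm]

theorem card_hyperbolic_le {o l : Fin d} (hol : o ≠ l) :
    #(hyperbolic d n) ≤ (n + 1) ^ (d - 1) := by
  have h := card_hyperbolic_filter_le (n := n) hol univ
  have hd : 2 ≤ d := by
    have := o.2; have := l.2
    by_contra hc
    exact hol (Fin.ext (by omega))
  rw [filter_true_of_mem (fun r _ => mem_univ _), card_univ, Fintype.card_fin, ← pow_succ'] at h
  rwa [show d - 2 + 1 = d - 1 by omega] at h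

theorem abs_sum_le_one_of_card_le_one {ι : Type*} {s : Finset ι} (hs : #s ≤ 1) {a : ι → ℝ}
    (ha : ∀ i ∈ s, |a i| ≤ 1) : |∑ i ∈ s, a i| ≤ 1 := by
  refine (abs_sum_le_sum_abs _ _).trans ((sum_le_card_nsmul s _ 1 ha).trans ?_)
  rw [nsmul_eq_mul, mul_one]
  exact_mod_cast hs

theorem momentBound_sq_sum_of_agree (hf : IsRFamily f) {p : ℕ} (hp : p ≠ 0) (K : Finset (Fin d)) :
    ∀ A : Finset (ScaleVec d n), (∀ r ∈ A, ∀ s ∈ A, ∀ m ∉ K, r m = s m) →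
      MomentBound p (fun ω => (∑ r ∈ A, f r ω) ^ 2) ((4 * p) ^ #K * #A) := by
  induction K using Finset.induction_on with
  | empty =>
    intro A hA
    have hcard : #A ≤ 1 := card_le_one.2 fun r hr s hs =>
      funext fun m => hA r hr s hs m (notMem_empty m)
    rcases Nat.eq_zero_or_pos #A with h0 | h0
    · rw [card_eq_zero] at h0
      subst h0
      exact momentBound_of_le p fun ω => by simp
    · have h1 : #A = 1 := by omega
      rw [h1]
      refine momentBound_of_le p fun ω => ?_
      simp only [card_empty, pow_zero, Nat.cast_one, mul_one, abs_pow]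
      exact pow_le_one₀ (abs_nonneg _)
        (abs_sum_le_one_of_card_le_one hcard fun r _ => hf.bound r ω)
  | insert j K hj ih =>
    intro A hA
    have h1 := momentBound_sq_sum_of_isScaleAt (m := j) hp
      (D := fun k ω => ∑ r ∈ A with r j = k, f r ω)
      (b := fun k => (4 * p) ^ #K * #{r ∈ A | r j = k})
      (fun k => IsScaleAt.sum _ fun r hr => by
        have := hf.scale r j
        rwa [(mem_filter.1 hr).2] at this)
      (fun k => ih _ fun r hr s hs m hm => by
        rw [mem_filter] at hr hs
        by_cases hmj : m = j
        · subst hmj; rw [hr.2, hs.2]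
        · exact hA r hr.1 s hs.1 m (by simp [hmj, hm]))
    simp only [sum_fiberwise] at h1
    have h2 : ∑ k, (#{r ∈ A | r j = k} : ℝ) = #A := by
      rw [← Nat.cast_sum]
      congr 1
      have := sum_fiberwise A (fun r => r j) (fun _ => 1)
      simpa using this
    rwa [← mul_sum, h2, ← mul_assoc, ← pow_succ', ← card_insert_of_notMem hj] at h1

/-- Square root cancellation in every `L^p`, with polynomial dependence on `p`. -/
theorem momentBound_sq_sum (hf : IsRFamily f) {p : ℕ} (hp : p ≠ 0) (A : Finset (ScaleVec d n)) :
    MomentBound p (fun ω => (∑ r ∈ A, f r ω) ^ 2) ((4 * p) ^ d * #A) := by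
  have := momentBound_sq_sum_of_agree hf hp univ A fun _ _ _ _ m hm => absurd (mem_univ m) hm
  simpa using this

/-- The matrix whose entry at `(u, w)` is the sum of the `f r` with `r j = u` and `r i = w`. -/
def scaleMatrix (f : ScaleVec d n → BitCube d n → ℝ) (i j : Fin d) (A : Finset (ScaleVec d n))
    (ω : BitCube d n) : Fin (n + 1) → Fin (n + 1) → ℝ :=
  fun u w => ∑ r ∈ A with r j = u ∧ r i = w, f r ω

theorem abs_scaleMatrix_le_one (hf : IsRFamily f) {i j l : Fin d}
    {A : Finset (ScaleVec d n)} (hA : A ⊆ hyperbolic d n)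
    (hagree : ∀ r ∈ A, ∀ s ∈ A, ∀ m, m ≠ i → m ≠ j → m ≠ l → r m = s m) (ω : BitCube d n)
    (u w : Fin (n + 1)) : |scaleMatrix f i j A ω u w| ≤ 1 := by
  refine abs_sum_le_one_of_card_le_one (card_le_one.2 fun r hr s hs => ?_)
    fun r _ => hf.bound r ω
  rw [mem_filter] at hr hs
  refine eq_of_mem_hyperbolic (hA hr.1) (hA hs.1) l fun m hm => ?_
  by_cases hmi : m = i
  · subst hmi; rw [hr.2.2, hs.2.2]
  by_cases hmj : m = j
  · subst hmj; rw [hr.2.1, hs.2.1]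
  exact hagree r hr.1 s hs.1 m hmi hmj hm

/-- Off-diagonal entries of the Gram matrix: products of two rows of the matrix have distinct scales
in a third coordinate `l`, whence square root cancellation. -/
theorem momentBound_gram_of_lt (hf : IsRFamily f) {p : ℕ} (hp : p ≠ 0) {i j l : Fin d}
    (hij : i ≠ j) (hil : i ≠ l) (hjl : j ≠ l) {A : Finset (ScaleVec d n)}
    (hA : A ⊆ hyperbolic d n)
    (hagree : ∀ r ∈ A, ∀ s ∈ A, ∀ m, m ≠ i → m ≠ j → m ≠ l → r m = s m) {u v : Fin (n + 1)}
    (huv : u < v) :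
    MomentBound p (fun ω => (∑ w, scaleMatrix f i j A ω u w * scaleMatrix f i j A ω v w) ^ 2)
      (4 * p * (n + 1)) := by
  have h1 : ∀ ω, ∑ w, scaleMatrix f i j A ω u w * scaleMatrix f i j A ω v w =
      ∑ k, ∑ r ∈ A with r j = u ∧ r l = k, f r ω * scaleMatrix f i j A ω v (r i) := by
    intro ω
    have h2 : ∀ w, scaleMatrix f i j A ω u w * scaleMatrix f i j A ω v w =
        ∑ r ∈ {r ∈ A | r j = u} with r i = w, f r ω * scaleMatrix f i j A ω v (r i) := by
      intro w
      rw [filter_filter]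
      conv_lhs => rw [scaleMatrix, sum_mul]
      refine sum_congr rfl fun r hr => ?_
      rw [(mem_filter.1 hr).2.2]
    rw [sum_congr rfl fun w _ => h2 w, sum_fiberwise]
    simp only [← filter_filter]
    rw [sum_fiberwise]
  simp only [h1]
  have h3 := momentBound_sq_sum_of_isScaleAt (m := l) hp (n := n)
    (D := fun k ω => ∑ r ∈ A with r j = u ∧ r l = k, f r ω * scaleMatrix f i j A ω v (r i))
    (b := fun _ => 1) ?_ ?_
  · simpa using h3
  · intro k
    refine IsScaleAt.sum _ fun r hr => ?_
    rw [mem_filter] at hr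
    have hk := hf.scale r l
    rw [hr.2.2] at hk
    refine hk.mul_of_invariant fun k' hk' ω => ?_
    refine sum_congr rfl fun s hs => ?_
    rw [mem_filter] at hs
    refine (hf.scale s l).2 k' ?_ ω
    have h4 := coord_add_eq_of_mem_hyperbolic (hA hr.1) (hA hs.1) hjl fun m hmj hml => by
      by_cases hmi : m = i
      · subst hmi; exact hs.2.2.symm
      · exact hagree r hr.1 s hs.1 m hmi hmj hml
    rw [hr.2.1, hs.2.1, hr.2.2] at h4
    rw [Fin.lt_def] at huv ⊢
    rw [Fin.le_def] at hk'
    omega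
  · intro k
    refine momentBound_of_le p fun ω => ?_
    rw [abs_pow]
    refine pow_le_one₀ (abs_nonneg _) (abs_sum_le_one_of_card_le_one
      (card_le_one.2 fun r hr s hs => ?_) fun r _ => ?_)
    · rw [mem_filter] at hr hs
      refine eq_of_mem_hyperbolic (hA hr.1) (hA hs.1) i fun m hmi => ?_
      by_cases hmj : m = j
      · subst hmj; rw [hr.2.1, hs.2.1]
      by_cases hml : m = l
      · subst hml; rw [hr.2.2, hs.2.2]
      exact hagree r hr.1 s hs.1 m hmi hmj hml
    · rw [abs_mul]
      exact mul_le_one₀ (hf.bound r ω) (abs_nonneg _)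
        (abs_scaleMatrix_le_one hf hA hagree ω v (r i))

theorem momentBound_schattenFour_of_agree (hf : IsRFamily f) {p : ℕ} (hp : p ≠ 0) {i j l : Fin d}
    (hij : i ≠ j) (hil : i ≠ l) (hjl : j ≠ l) {A : Finset (ScaleVec d n)}
    (hA : A ⊆ hyperbolic d n)
    (hagree : ∀ r ∈ A, ∀ s ∈ A, ∀ m, m ≠ i → m ≠ j → m ≠ l → r m = s m) :
    MomentBound p (fun ω => schattenFour (scaleMatrix f i j A ω)) (5 * p * (n + 1) ^ 3) := by
  have hp1 : (1 : ℝ) ≤ p := by exact_mod_cast Nat.one_le_iff_ne_zero.2 hp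
  have hentry : ∀ u v : Fin (n + 1), MomentBound p
      (fun ω => (∑ w, scaleMatrix f i j A ω u w * scaleMatrix f i j A ω v w) ^ 2)
      ((if u = v then ((n : ℝ) + 1) ^ 2 else 0) + 4 * p * (n + 1)) := by
    intro u v
    rcases lt_trichotomy u v with h | h | h
    · rw [if_neg h.ne, zero_add]
      exact momentBound_gram_of_lt hf hp hij hil hjl hA hagree h
    · rw [if_pos h]
      refine (momentBound_of_le (a := ((n : ℝ) + 1) ^ 2) p fun ω => ?_).mono
        (le_add_of_nonneg_right (by positivity))
      rw [abs_pow]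
      refine pow_le_pow_left₀ (abs_nonneg _) ?_ 2
      refine (abs_sum_le_sum_abs _ _).trans
        ((sum_le_card_nsmul univ _ 1 fun w _ => ?_).trans (by simp))
      rw [abs_mul]
      exact mul_le_one₀ (abs_scaleMatrix_le_one hf hA hagree ω u w) (abs_nonneg _)
        (abs_scaleMatrix_le_one hf hA hagree ω v w)
    · rw [if_neg h.ne', zero_add]
      have := momentBound_gram_of_lt hf hp hij hil hjl hA hagree h
      simpa only [mul_comm] using this
  have h1 := MomentBound.sum hp univ fun u _ => MomentBound.sum hp univ fun v _ => hentry u v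
  refine MomentBound.mono h1 ?_
  simp only [sum_add_distrib, sum_ite_eq, mem_univ, if_true, sum_const, card_univ,
    Fintype.card_fin, nsmul_eq_mul]
  push_cast
  have : 0 ≤ ((n : ℝ) + 1) ^ 3 := by positivity
  nlinarith

/-- The Schatten `4`-norm of the matrix of sums: the remaining coordinates are removed one at a time
by martingale type two. -/
theorem momentBound_sqrt_schattenFour (hf : IsRFamily f) {p : ℕ} (hp : p ≠ 0) {i j l : Fin d}
    (hij : i ≠ j) (hil : i ≠ l) (hjl : j ≠ l) (K : Finset (Fin d)) :
    ∀ A : Finset (ScaleVec d n), A ⊆ hyperbolic d n →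
      (∀ r ∈ A, ∀ s ∈ A, ∀ m ∉ K, m ≠ i → m ≠ j → m ≠ l → r m = s m) →
      MomentBound (2 * p) (fun ω => √(schattenFour (scaleMatrix f i j A ω)))
        ((9 * p * (n + 1)) ^ #K * √(5 * p * (n + 1) ^ 3)) := by
  induction K using Finset.induction_on with
  | empty =>
    intro A hA hagree
    rw [card_empty, pow_zero, one_mul]
    refine MomentBound.of_sq ?_
    simp only [Real.sq_sqrt (schattenFour_nonneg _)]
    exact momentBound_schattenFour_of_agree hf hp hij hil hjl hA fun r hr s hs m h1 h2 h3 =>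
      hagree r hr s hs m (notMem_empty m) h1 h2 h3
  | insert a K ha ih =>
    intro A hA hagree
    have h1 := momentBound_sum_of_isScaleAt (m := a) (p := 2 * p) (n := n) (by omega)
      (h := fun G : Fin (n + 1) → Fin (n + 1) → ℝ => √(schattenFour G)) (c := 9 * p)
      (by positivity) (fun _ => Real.sqrt_nonneg _) (by simp [schattenFour])
      (fun A B => two_point_inequality_schattenFour A B p hp)
      (D := fun k ω => scaleMatrix f i j {r ∈ A | r a = k} ω)
      (b := fun _ => (9 * p * (n + 1)) ^ #K * √(5 * p * (n + 1) ^ 3)) ?_ ?_ univ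
    · have h2 : ∀ ω, ∑ k, scaleMatrix f i j {r ∈ A | r a = k} ω = scaleMatrix f i j A ω := by
        intro ω
        funext u w
        rw [Finset.sum_apply, Finset.sum_apply]
        unfold scaleMatrix
        rw [← sum_fiberwise _ (fun r => r a) (fun r => f r ω)]
        refine sum_congr rfl fun k _ => ?_
        rw [filter_comm]
      simp only [h2] at h1
      refine h1.mono (le_of_eq ?_)
      rw [card_insert_of_notMem ha, sum_const, card_univ, Fintype.card_fin, nsmul_eq_mul]
      push_cast
      ring
    · intro k
      have hsc : ∀ r ∈ {r ∈ A | r a = k}, IsScaleAt a k (f r) := fun r hr => by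
        have := hf.scale r a
        rwa [(mem_filter.1 hr).2] at this
      refine ⟨fun ω => ?_, fun k' hk' ω => ?_⟩
      · funext u w
        exact (IsScaleAt.sum _ fun r hr => hsc r (mem_filter.1 hr).1).1 ω
      · funext u w
        exact (IsScaleAt.sum _ fun r hr => hsc r (mem_filter.1 hr).1).2 k' hk' ω
    · intro k
      refine ih _ ((filter_subset _ _).trans hA) fun r hr s hs m hm h1 h2 h3 => ?_
      rw [mem_filter] at hr hs
      by_cases hma : m = a
      · subst hma; rw [hr.2, hs.2]
      · exact hagree r hr.1 s hs.1 m (by simp [hma, hm]) h1 h2 h3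

end Sums

/-! ### The gain from a coincidence of scales -/

/-- The dyadic levels: `x < y` exactly when, for one `κ`, the numbers `x` and `y` lie in the left
and the right half of one dyadic interval of length `2^{κ+1}`. -/
theorem sum_dyadic_levels (L : ℕ) : ∀ x y : ℕ, x < 2 ^ L → y < 2 ^ L →
    ∑ κ ∈ range L, (if y / 2 ^ κ % 2 = 1 ∧ x / 2 ^ κ + 1 = y / 2 ^ κ then (1 : ℝ) else 0) =
      if x < y then 1 else 0 := by
  induction L with
  | zero => intro x y hx hy; simp at hx hy; simp [hx, hy]
  | succ L ih =>
    intro x y hx hy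
    have hx2 : x / 2 < 2 ^ L := by rw [pow_succ] at hx; omega
    have hy2 : y / 2 < 2 ^ L := by rw [pow_succ] at hy; omega
    have h := ih (x / 2) (y / 2) hx2 hy2
    rw [sum_range_succ']
    simp only [Nat.div_div_eq_div_mul, ← pow_succ'] at h
    rw [h, pow_zero, Nat.div_one, Nat.div_one]
    by_cases h1 : x / 2 < y / 2
    · rw [if_pos h1, if_neg (by omega), if_pos (by omega), add_zero]
    · rw [if_neg h1, zero_add]
      by_cases h2 : x < y
      · rw [if_pos h2, if_pos (by omega)]
      · rw [if_neg h2, if_neg (by omega)]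

section Coincidence

variable {d n : ℕ} {f g : ScaleVec d n → BitCube d n → ℝ}

/-- The sum of the products `f r * g s` over the pairs of scale vectors that coincide in the
coordinate `j` and differ in the coordinate `i`. -/
def coincidenceSum (i j : Fin d) (f g : ScaleVec d n → BitCube d n → ℝ) (ω : BitCube d n) : ℝ :=
  ∑ r ∈ hyperbolic d n, ∑ s ∈ hyperbolic d n,
    (if r j = s j ∧ r i ≠ s i then 1 else 0) * (f r ω * g s ω)

/-- `x` and `y` lie in the left and the right half of a dyadic interval of length `2^{κ+1}`. -/
def DyadicBelow (κ : ℕ) (x y : ℕ) : Prop := y / 2 ^ κ % 2 = 1 ∧ x / 2 ^ κ + 1 = y / 2 ^ κ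

instance (κ x y : ℕ) : Decidable (DyadicBelow κ x y) := by unfold DyadicBelow; infer_instance

theorem DyadicBelow.lt {κ x y : ℕ} (h : DyadicBelow κ x y) : x < y := by
  by_contra hc
  push Not at hc
  have := Nat.div_le_div_right (c := 2 ^ κ) hc
  have := h.2
  omega

/-- The part of `coincidenceSum` where `r i < s i` are separated at the dyadic level `κ`. -/
def coincidenceLevel (i j : Fin d) (κ : ℕ) (f g : ScaleVec d n → BitCube d n → ℝ)
    (ω : BitCube d n) : ℝ :=
  ∑ s ∈ hyperbolic d n, ∑ r ∈ hyperbolic d n,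
    (if r j = s j ∧ DyadicBelow κ (r i) (s i) then 1 else 0) * (f r ω * g s ω)

theorem coincidenceSum_eq_sum_levels (i j : Fin d) (f g : ScaleVec d n → BitCube d n → ℝ)
    {L : ℕ} (hL : n < 2 ^ L) (ω : BitCube d n) :
    coincidenceSum i j f g ω = ∑ κ ∈ range L,
      (coincidenceLevel i j κ f g ω + coincidenceLevel i j κ g f ω) := by
  have hlt : ∀ k : Fin (n + 1), (k : ℕ) < 2 ^ L := fun k => by have := k.2; omega
  have h1 : ∀ r s : ScaleVec d n, (if r j = s j ∧ r i ≠ s i then (1 : ℝ) else 0) =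
      ∑ κ ∈ range L, ((if r j = s j ∧ DyadicBelow κ (r i) (s i) then (1 : ℝ) else 0) +
        if s j = r j ∧ DyadicBelow κ (s i) (r i) then (1 : ℝ) else 0) := by
    intro r s
    by_cases hj : r j = s j
    · have e1 := sum_dyadic_levels L (r i) (s i) (hlt _) (hlt _)
      have e2 := sum_dyadic_levels L (s i) (r i) (hlt _) (hlt _)
      simp only [hj, true_and, sum_add_distrib, DyadicBelow, e1, e2]
      rcases lt_trichotomy (r i) (s i) with h | h | h
      · rw [if_pos h.ne, if_pos (by exact_mod_cast h), if_neg (by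
          have : (r i : ℕ) < s i := h
          omega), add_zero]
      · rw [h]; simp
      · rw [if_pos h.ne', if_pos (by exact_mod_cast h : (s i : ℕ) < r i), if_neg (by
          have : (s i : ℕ) < r i := h
          omega), zero_add]
    · simp [hj, Ne.symm hj]
  unfold coincidenceSum coincidenceLevel
  simp only [sum_add_distrib]
  have e3 : ∑ κ ∈ range L, ∑ s ∈ hyperbolic d n, ∑ r ∈ hyperbolic d n,
      (if r j = s j ∧ DyadicBelow κ (r i) (s i) then (1 : ℝ) else 0) * (f r ω * g s ω) =
      ∑ r ∈ hyperbolic d n, ∑ s ∈ hyperbolic d n, ∑ κ ∈ range L,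
      (if r j = s j ∧ DyadicBelow κ (r i) (s i) then (1 : ℝ) else 0) * (f r ω * g s ω) := by
    rw [sum_comm]
    rw [sum_congr rfl fun s _ => sum_comm]
    exact sum_comm
  have e4 : ∑ κ ∈ range L, ∑ s ∈ hyperbolic d n, ∑ r ∈ hyperbolic d n,
      (if r j = s j ∧ DyadicBelow κ (r i) (s i) then (1 : ℝ) else 0) * (g r ω * f s ω) =
      ∑ r ∈ hyperbolic d n, ∑ s ∈ hyperbolic d n, ∑ κ ∈ range L,
      (if s j = r j ∧ DyadicBelow κ (s i) (r i) then (1 : ℝ) else 0) * (f r ω * g s ω) := by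
    rw [sum_comm]
    refine sum_congr rfl fun s _ => ?_
    rw [sum_comm]
    exact sum_congr rfl fun r _ => sum_congr rfl fun κ _ => by rw [mul_comm (g r ω)]
  rw [e3, e4, ← sum_add_distrib]
  refine sum_congr rfl fun r _ => ?_
  rw [← sum_add_distrib]
  refine sum_congr rfl fun s _ => ?_
  rw [h1 r s, sum_mul, ← sum_add_distrib]
  exact sum_congr rfl fun κ _ => by ring

/-- The moment bound of one dyadic level of a coincidence sum. The square function in the coordinate
`i` turns the sum over `s i` into a quadratic form, to which the operator norm bound applies. -/
theorem momentBound_sq_coincidenceLevel (hf : IsRFamily f) (hg : IsRFamily g) {p : ℕ}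
    (hp : p ≠ 0) {i j l : Fin d} (hij : i ≠ j) (hil : i ≠ l) (hjl : j ≠ l) (κ : ℕ) :
    MomentBound p (fun ω => coincidenceLevel i j κ f g ω ^ 2)
      (28 * p ^ 2 * ((8 * p) ^ d * #(hyperbolic d n) *
        ((9 * p * (n + 1)) ^ (d - 3) * √(5 * p * (n + 1) ^ 3)))) := by
  set H := hyperbolic d n with hH
  set D : Fin (n + 1) → BitCube d n → ℝ := fun w ω => ∑ s ∈ H with s i = w, ∑ r ∈ H,
    (if r j = s j ∧ DyadicBelow κ (r i) (s i) then 1 else 0) * (f r ω * g s ω) with hD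
  have h1 : ∀ ω, coincidenceLevel i j κ f g ω = ∑ w, D w ω := fun ω =>
    (sum_fiberwise _ _ _).symm
  simp only [h1]
  refine momentBound_sq_of_squareFunction (m := i) hp (fun w => ?_) ?_
  · refine IsScaleAt.sum _ fun s hs => IsScaleAt.sum _ fun r _ => ?_
    rw [mem_filter] at hs
    by_cases hc : r j = s j ∧ DyadicBelow κ (r i) (s i)
    · simp only [if_pos hc, one_mul]
      have hsc := hg.scale s i
      rw [hs.2] at hsc
      simp only [mul_comm (f r _)]
      refine hsc.mul_of_invariant fun k' hk' ω => (hf.scale r i).2 k' ?_ ω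
      have h2 := hc.2.lt
      rw [hs.2] at h2
      rw [Fin.lt_def]
      rw [Fin.le_def] at hk'
      omega
    · simp only [if_neg hc, zero_mul]
      exact ⟨fun ω => by simp, fun k' _ ω => rfl⟩
  -- the vector of sums of `f` over one dyadic block of the coordinate `i`
  set F : ℕ → Fin (n + 1) → BitCube d n → ℝ := fun b u ω =>
    ∑ r ∈ H with r j = u ∧ (r i : ℕ) / 2 ^ κ = b, f r ω with hF
  have h2 : ∀ w ω, D w ω ^ 2 ≤
      (∑ u, F ((w : ℕ) / 2 ^ κ - 1) u ω * scaleMatrix g i j H ω u w) ^ 2 := by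
    intro w ω
    by_cases hodd : (w : ℕ) / 2 ^ κ % 2 = 1
    · refine le_of_eq ?_
      congr 1
      have h3 : ∀ s ∈ {s ∈ H | s i = w}, ∑ r ∈ H,
          (if r j = s j ∧ DyadicBelow κ (r i) (s i) then 1 else 0) * (f r ω * g s ω) =
          F ((w : ℕ) / 2 ^ κ - 1) (s j) ω * g s ω := by
        intro s hs
        rw [mem_filter] at hs
        rw [hF, sum_mul, sum_filter]
        refine sum_congr rfl fun r _ => ?_
        rw [hs.2]
        have : (r j = s j ∧ DyadicBelow κ (r i) w) ↔
            (r j = s j ∧ (r i : ℕ) / 2 ^ κ = (w : ℕ) / 2 ^ κ - 1) := by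
          unfold DyadicBelow
          generalize (w : ℕ) / 2 ^ κ = x at hodd ⊢
          generalize (r i : ℕ) / 2 ^ κ = z
          constructor
          · rintro ⟨e1, e2, e3⟩; exact ⟨e1, by omega⟩
          · rintro ⟨e1, e2⟩; exact ⟨e1, hodd, by omega⟩
        simp only [this]
        split_ifs <;> simp
      rw [hD]
      beta_reduce
      rw [sum_congr rfl h3, ← sum_fiberwise _ (fun s => s j)]
      refine sum_congr rfl fun u _ => ?_
      rw [scaleMatrix, mul_sum, filter_filter]
      refine sum_congr (filter_congr fun s _ => and_comm) fun s hs => ?_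
      rw [(mem_filter.1 hs).2.1]
    · have h3 : D w ω = 0 := by
        refine sum_eq_zero fun s hs => sum_eq_zero fun r _ => ?_
        rw [mem_filter] at hs
        rw [if_neg, zero_mul]
        rintro ⟨-, e2, -⟩
        rw [hs.2] at e2
        exact hodd e2
      rw [h3, zero_pow two_ne_zero]
      exact sq_nonneg _
  have h4 : ∀ ω, ∑ w, D w ω ^ 2 ≤ (∑ b ∈ range (n + 1), ∑ u, F b u ω ^ 2) *
      √(schattenFour (scaleMatrix g i j H ω)) := by
    intro ω
    calc ∑ w, D w ω ^ 2
        ≤ ∑ w : Fin (n + 1), ∑ b ∈ range (n + 1),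
          (∑ u, F b u ω * scaleMatrix g i j H ω u w) ^ 2 := by
          refine sum_le_sum fun w _ => (h2 w ω).trans ?_
          refine single_le_sum (f := fun b => (∑ u, F b u ω * scaleMatrix g i j H ω u w) ^ 2)
            (fun b _ => sq_nonneg _) (mem_range.2 ?_)
          have := Nat.div_le_self (w : ℕ) (2 ^ κ)
          have := w.2
          omega
      _ = ∑ b ∈ range (n + 1), ∑ w, (∑ u, F b u ω * scaleMatrix g i j H ω u w) ^ 2 := sum_comm
      _ ≤ ∑ b ∈ range (n + 1), (∑ u, F b u ω ^ 2) * √(schattenFour (scaleMatrix g i j H ω)) :=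
          sum_le_sum fun b _ => sum_sq_mulVec_le _ _
      _ = _ := (sum_mul _ _ _).symm
  refine MomentBound.of_abs_le (MomentBound.mul hp (p := p) (f := fun ω =>
    ∑ b ∈ range (n + 1), ∑ u, F b u ω ^ 2) ?_ (g := fun ω =>
    √(schattenFour (scaleMatrix g i j H ω))) ?_) (fun ω => ?_)
  · have h5 : ∀ b ∈ range (n + 1), MomentBound (2 * p) (fun ω => ∑ u, F b u ω ^ 2)
        (∑ u, (8 * (p : ℝ)) ^ d * #{r ∈ H | r j = u ∧ (r i : ℕ) / 2 ^ κ = b}) := by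
      intro b _
      refine MomentBound.sum (by omega) univ fun u _ => ?_
      have := momentBound_sq_sum hf (p := 2 * p) (by omega)
        {r ∈ H | r j = u ∧ (r i : ℕ) / 2 ^ κ = b}
      refine this.mono (le_of_eq ?_)
      push_cast
      ring
    refine (MomentBound.sum (by omega) _ h5).mono (le_of_eq ?_)
    simp only [← mul_sum, ← Nat.cast_sum]
    congr 2
    have h6 : ∀ b, ∑ u, #{r ∈ H | r j = u ∧ (r i : ℕ) / 2 ^ κ = b} =
        #{r ∈ H | (r i : ℕ) / 2 ^ κ = b} := by
      intro b
      rw [card_eq_sum_card_fiberwise (f := fun r => r j) (t := univ) (fun _ _ => by simp)]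
      refine sum_congr rfl fun u _ => ?_
      rw [filter_filter]
      exact congrArg card (filter_congr fun r _ => and_comm)
    rw [sum_congr rfl fun b _ => h6 b]
    refine (card_eq_sum_card_fiberwise (f := fun r : ScaleVec d n => (r i : ℕ) / 2 ^ κ)
      (t := range (n + 1)) fun r _ => ?_).symm
    have := Nat.div_le_self (r i : ℕ) (2 ^ κ)
    have := (r i).2
    simp only [coe_range, Set.mem_Iio]
    omega
  · have h5 := momentBound_sqrt_schattenFour hg hp hij hil hjl (univ \ {i, j, l}) H
      (Subset.refl _) (fun r _ s _ m hm h1 h2 h3 => absurd (mem_sdiff.2 ⟨mem_univ m, by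
        simp [h1, h2, h3]⟩) hm)
    have h6 : #(univ \ {i, j, l} : Finset (Fin d)) = d - 3 := by
      rw [card_sdiff_of_subset (subset_univ _), card_univ, Fintype.card_fin,
        card_eq_three.2 ⟨i, j, l, hij, hil, hjl, rfl⟩]
    rwa [h6] at h5
  · have h7 : 0 ≤ ∑ w, D w ω ^ 2 := sum_nonneg fun _ _ => sq_nonneg _
    rw [abs_of_nonneg h7]
    exact (h4 ω).trans (le_abs_self _)

/-- Beck's gain. The trivial bound is `n^{d-1}`; one coincidence lowers the exponent
to `d - 5/4`, up to the number of dyadic levels. -/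
theorem momentBound_coincidenceSum (hf : IsRFamily f) (hg : IsRFamily g) {p : ℕ}
    (hp : p ≠ 0) {i j l : Fin d} (hij : i ≠ j) (hil : i ≠ l) (hjl : j ≠ l) {L : ℕ}
    (hL : n < 2 ^ L) {y : ℝ} (hy : 0 ≤ y) (hyn : y ^ 8 = n + 1) :
    MomentBound (2 * p) (coincidenceSum i j f g)
      (2 * L * (6 * (9 * p) ^ (d + 1) * y ^ (8 * d - 10))) := by
  have hd : 3 ≤ d := by
    have h6 : #({i, j, l} : Finset (Fin d)) ≤ Fintype.card (Fin d) := card_le_univ _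
    rwa [card_eq_three.2 ⟨i, j, l, hij, hil, hjl, rfl⟩, Fintype.card_fin] at h6
  obtain ⟨e, rfl⟩ : ∃ e, d = e + 3 := ⟨d - 3, by omega⟩
  have hp1 : (1 : ℝ) ≤ p := by exact_mod_cast Nat.one_le_iff_ne_zero.2 hp
  set B := 6 * (9 * (p : ℝ)) ^ (e + 3 + 1) * y ^ (8 * (e + 3) - 10) with hB
  have hB0 : 0 ≤ B := by positivity
  have hlevel : ∀ {f g : ScaleVec (e + 3) n → BitCube (e + 3) n → ℝ}, IsRFamily f → IsRFamily g →
      ∀ κ, MomentBound (2 * p) (coincidenceLevel i j κ f g) B := by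
    intro f g hf hg κ
    rw [← momentBound_sq_iff p hB0]
    refine (momentBound_sq_coincidenceLevel hf hg hp hij hil hjl κ).mono ?_
    have hcard : (#(hyperbolic (e + 3) n) : ℝ) ≤ y ^ (8 * (e + 2)) := by
      rw [pow_mul, hyn]
      have := card_hyperbolic_le (n := n) hij
      exact_mod_cast this
    have hsqrt : √(5 * p * ((n : ℝ) + 1) ^ 3) ≤ 3 * p * y ^ 12 := by
      refine Real.sqrt_le_iff.2 ⟨by positivity, ?_⟩
      rw [← hyn, mul_pow, ← pow_mul, ← pow_mul]
      have : 5 * (p : ℝ) ≤ (3 * p) ^ 2 := by nlinarith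
      exact mul_le_mul_of_nonneg_right this (by positivity)
    have h8 : (8 * (p : ℝ)) ^ (e + 3) ≤ (9 * p) ^ (e + 3) := by gcongr; norm_num
    rw [← hyn, show e + 3 - 3 = e by omega]
    rw [← hyn] at hsqrt
    calc 28 * (p : ℝ) ^ 2 * ((8 * p) ^ (e + 3) * #(hyperbolic (e + 3) n) *
          ((9 * p * y ^ 8) ^ e * √(5 * p * (y ^ 8) ^ 3)))
        ≤ 28 * (p : ℝ) ^ 2 * ((9 * p) ^ (e + 3) * y ^ (8 * (e + 2)) *
          ((9 * p * y ^ 8) ^ e * (3 * p * y ^ 12))) := by gcongr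
      _ = (9 * (p : ℝ)) ^ (2 * e + 3) * y ^ (16 * e + 28) * (84 * p ^ 3) := by ring
      _ ≤ (9 * (p : ℝ)) ^ (2 * e + 3) * y ^ (16 * e + 28) * (36 * (9 * p) ^ 5) := by
          have : (p : ℝ) ^ 3 ≤ p ^ 5 := pow_le_pow_right₀ hp1 (by norm_num)
          refine mul_le_mul_of_nonneg_left ?_ (by positivity)
          rw [mul_pow]
          nlinarith [pow_nonneg (zero_le_one.trans hp1) 5]
      _ = B ^ 2 := by
          rw [hB, show 8 * (e + 3) - 10 = 8 * e + 14 by omega]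
          ring
  have hsum := MomentBound.sum (by omega : 2 * p ≠ 0) (range L) fun κ _ =>
    (hlevel hf hg κ).add (by omega) (hlevel hg hf κ)
  simp only [sum_const, card_range, nsmul_eq_mul] at hsum
  have h9 : coincidenceSum i j f g = fun ω => ∑ κ ∈ range L,
      (coincidenceLevel i j κ f g ω + coincidenceLevel i j κ g f ω) :=
    funext fun ω => coincidenceSum_eq_sum_levels i j f g hL ω
  rw [h9]
  exact hsum.mono (le_of_eq (by ring))

end Coincidence

/-! ### Encoding equalities by random signs -/

/-- The sign `±1` of a bit; also the value of a Haar function on the half with that digit. -/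
def bitSign (b : Bool) : ℝ := if b then 1 else -1

theorem bitSign_not (b : Bool) : bitSign (!b) = -bitSign b := by cases b <;> simp [bitSign]

theorem abs_bitSign (b : Bool) : |bitSign b| = 1 := by cases b <;> simp [bitSign]

theorem bitSign_mul_self (b : Bool) : bitSign b * bitSign b = 1 := by cases b <;> simp [bitSign]

section Signs

variable {κ : Type*} [Fintype κ] [DecidableEq κ]

/-- Averages over a product space of products of functions of one variable each. -/
theorem expect_pi_prod {ι : Type*} [Fintype ι] [DecidableEq ι] {X : ι → Type*}
    [∀ i, Fintype (X i)] (F : ∀ i, X i → ℝ) :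
    𝔼 x : ∀ i, X i, ∏ i, F i (x i) = ∏ i, 𝔼 x, F i x := by
  simp only [Fintype.expect_eq_sum_div_card, prod_div_distrib]
  congr 1
  · rw [prod_univ_sum, Fintype.piFinset_univ]
  · rw [Fintype.card_pi]; push_cast; rfl

theorem expect_signs_eq_zero (a : κ) (F : (κ → Bool) → ℝ)
    (h : ∀ ε, F (Function.update ε a (!ε a)) = -F ε) : 𝔼 ε, F ε = 0 := by
  have hinv : Function.Involutive fun ε : κ → Bool => Function.update ε a (!ε a) := by
    intro ε; simp
  have : 𝔼 ε, F (Function.update ε a (!ε a)) = 𝔼 ε, F ε :=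
    Fintype.expect_equiv hinv.toPerm _ _ fun _ => rfl
  simp only [h, expect_neg_distrib] at this
  linarith

theorem expect_bitSign (a : κ) : 𝔼 ε : κ → Bool, bitSign (ε a) = 0 :=
  expect_signs_eq_zero a _ fun ε => by simp [bitSign_not]

theorem expect_bitSign_mul (a b : κ) :
    𝔼 ε : κ → Bool, bitSign (ε a) * bitSign (ε b) = if a = b then 1 else 0 := by
  split_ifs with h
  · subst h
    simp only [bitSign_mul_self]
    exact expect_const_univ 1
  · exact expect_signs_eq_zero a _ fun ε => by simp [bitSign_not, Ne.symm h]

theorem expect_one_add_mul_one_sub (a b : κ) :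
    𝔼 ε : κ → Bool, (1 + bitSign (ε a)) * (1 - bitSign (ε b)) = if a ≠ b then 1 else 0 := by
  have h1 : ∀ ε : κ → Bool, (1 + bitSign (ε a)) * (1 - bitSign (ε b)) =
      (1 + bitSign (ε a)) - (bitSign (ε b) + bitSign (ε a) * bitSign (ε b)) := fun ε => by ring
  simp only [h1]
  rw [expect_sub_distrib, expect_add_distrib, expect_add_distrib, expect_bitSign, expect_bitSign,
    expect_bitSign_mul, expect_const_univ]
  split_ifs <;> simp_all

/-- Conditions `r m ≠ s m` for `m ∈ K₁` and `r m = s m` for `m ∈ K₂` are averages of products of a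
bounded function of `r` and a bounded function of `s`. -/
theorem exists_sign_encoding {ι : Type} [Fintype ι] [DecidableEq ι] {κ : Type} [Fintype κ]
    [DecidableEq κ] (K₁ K₂ : Finset ι) :
    ∃ (Z : Type) (_ : Fintype Z) (_ : Nonempty Z) (A B : Z → (ι → κ) → ℝ),
      (∀ z r, |A z r| ≤ 2 ^ Fintype.card ι) ∧ (∀ z r, |B z r| ≤ 2 ^ Fintype.card ι) ∧
      ∀ r s : ι → κ, (if (∀ m ∈ K₁, r m ≠ s m) ∧ (∀ m ∈ K₂, r m = s m) then (1 : ℝ) else 0) =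
        𝔼 z, A z r * B z s := by
  classical
  let Z := ι → (κ → Bool) × (κ → Bool)
  let a : Z → (ι → κ) → ι → ℝ := fun z r m =>
    (if m ∈ K₁ then 1 + bitSign ((z m).1 (r m)) else 1) *
      (if m ∈ K₂ then bitSign ((z m).2 (r m)) else 1)
  let b : Z → (ι → κ) → ι → ℝ := fun z s m =>
    (if m ∈ K₁ then 1 - bitSign ((z m).1 (s m)) else 1) *
      (if m ∈ K₂ then bitSign ((z m).2 (s m)) else 1)
  have hle : ∀ x : Bool, |1 + bitSign x| ≤ 2 ∧ |1 - bitSign x| ≤ 2 := by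
    intro x; cases x <;> norm_num [bitSign]
  have hbound : ∀ {c : ι → ℝ}, (∀ m, |c m| ≤ 2) → |∏ m, c m| ≤ 2 ^ Fintype.card ι := by
    intro c hc
    rw [abs_prod]
    refine (prod_le_prod (fun _ _ => abs_nonneg _) fun m _ => hc m).trans (by simp)
  refine ⟨Z, inferInstance, inferInstance, fun z r => ∏ m, a z r m, fun z s => ∏ m, b z s m,
    fun z r => hbound fun m => ?_, fun z s => hbound fun m => ?_, fun r s => ?_⟩
  · simp only [a, abs_mul]
    have h1 := (hle ((z m).1 (r m))).1
    split_ifs <;> simp only [abs_bitSign, abs_one, mul_one] <;> first | exact h1 | norm_num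
  · simp only [b, abs_mul]
    have h1 := (hle ((z m).1 (s m))).2
    split_ifs <;> simp only [abs_bitSign, abs_one, mul_one] <;> first | exact h1 | norm_num
  · obtain ⟨G, hG⟩ : ∃ G : ι → (κ → Bool) × (κ → Bool) → ℝ, ∀ m w, G m w =
        (if m ∈ K₁ then (1 + bitSign (w.1 (r m))) * (1 - bitSign (w.1 (s m))) else 1) *
        (if m ∈ K₂ then bitSign (w.2 (r m)) * bitSign (w.2 (s m)) else 1) := ⟨_, fun _ _ => rfl⟩
    have h1 : ∀ z : Z, (∏ m, a z r m) * ∏ m, b z s m = ∏ m, G m (z m) := by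
      intro z
      rw [← prod_mul_distrib]
      refine prod_congr rfl fun m _ => ?_
      rw [hG]
      simp only [a, b]
      split_ifs <;> ring
    rw [expect_congr rfl fun z _ => h1 z, expect_pi_prod]
    have h2 : ∀ m : ι, 𝔼 w, G m w =
        (if (m ∈ K₁ → r m ≠ s m) ∧ (m ∈ K₂ → r m = s m) then 1 else 0) := by
      intro m
      simp only [hG]
      rw [← univ_product_univ, expect_product]
      simp only [← mul_expect, ← expect_mul]
      have e1 : 𝔼 x : κ → Bool, (if m ∈ K₁ then
          (1 + bitSign (x (r m))) * (1 - bitSign (x (s m))) else (1 : ℝ)) =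
          if m ∈ K₁ → r m ≠ s m then 1 else 0 := by
        by_cases h : m ∈ K₁
        · simp only [h, if_true, true_imp_iff]; exact expect_one_add_mul_one_sub _ _
        · simp only [h, if_false, false_imp_iff, if_true]; exact expect_const_univ 1
      have e2 : 𝔼 x : κ → Bool, (if m ∈ K₂ then
          bitSign (x (r m)) * bitSign (x (s m)) else (1 : ℝ)) =
          if m ∈ K₂ → r m = s m then 1 else 0 := by
        by_cases h : m ∈ K₂
        · simp only [h, if_true, true_imp_iff]; exact expect_bitSign_mul _ _
        · simp only [h, if_false, false_imp_iff, if_true]; exact expect_const_univ 1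
      rw [e1, e2]
      split_ifs <;> simp_all
    simp only [h2]
    rw [prod_ite_zero]
    simp only [prod_const_one]
    refine if_congr ?_ rfl rfl
    simp only [mem_univ, true_imp_iff]
    exact ⟨fun h m => ⟨h.1 m, h.2 m⟩, fun h => ⟨fun m => (h m).1, fun m => (h m).2⟩⟩

end Signs

/-- The indicator of an existential statement, sorted by the least witness. -/
theorem ite_exists_eq_sum {d : ℕ} (P : Fin d → Prop) [DecidablePred P] :
    (if ∃ m, P m then (1 : ℝ) else 0) =
      ∑ j, if P j ∧ ∀ m ∈ univ.filter (· < j), ¬ P m then 1 else 0 := by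
  split_ifs with h
  · obtain ⟨j, hj, hmin⟩ : ∃ j, P j ∧ ∀ m < j, ¬ P m := by
      refine ⟨Fin.find P h, Fin.find_spec h, fun m hm => Fin.find_min h hm⟩
    rw [sum_eq_single j]
    · rw [if_pos ⟨hj, fun m hm => hmin m (mem_filter.1 hm).2⟩]
    · intro b _ hb
      rw [if_neg]
      rintro ⟨hb1, hb2⟩
      rcases lt_or_gt_of_ne hb with hlt | hgt
      · exact hmin b hlt hb1
      · exact hb2 j (by simp [hgt]) hj
    · simp
  · push Not at h
    exact (sum_eq_zero fun j _ => if_neg fun hj => h j hj.1).symm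

/-! ### The factors of the Riesz product -/

/-- The data of a Riesz product: the `r`-functions `f`, a partition of the scales of the coordinate
`o` into `q` blocks by `β`, and the size `ρ` of the linear part. -/
structure RieszData (d n q : ℕ) where
  f : ScaleVec d n → BitCube d n → ℝ
  o : Fin d
  β : Fin (n + 1) → Fin q
  ρ : ℝ

/-- A choice of at most two scale vectors for one factor of the Riesz product. -/
abbrev FactorState (d n : ℕ) : Type := Option (ScaleVec d n) × Option (ScaleVec d n)

namespace RieszData

noncomputable section

variable {d n q : ℕ} (D : RieszData d n q)

/-- The scale vectors that enter the factor `t` of the Riesz product. -/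
def block (t : Fin q) : Finset (ScaleVec d n) := {r ∈ hyperbolic d n | D.β (r D.o) = t}

/-- The coefficient of a state in the expansion of the factor `1 + ρ F + ρ² / 2 (F² - #block)`,
where `F` is the sum over the block; only pairs that differ in every coordinate are kept. -/
def weight (t : Fin q) : FactorState d n → ℝ
  | (none, none) => 1
  | (none, some _) => 0
  | (some r, none) => if r ∈ D.block t then D.ρ else 0
  | (some r, some s) =>
    if r ∈ D.block t ∧ s ∈ D.block t ∧ ∀ m, r m ≠ s m then D.ρ ^ 2 / 2 else 0

/-- The `r`-function of an optional scale vector, the constant `1` if there is none. -/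
def optFun : Option (ScaleVec d n) → BitCube d n → ℝ
  | none => fun _ => 1
  | some r => D.f r

/-- The factor `t` of the Riesz product with weights `z₀`, `z₁` on the two scale vectors of the
states. -/
def vertexSum (t : Fin q) (z₀ z₁ : Option (ScaleVec d n) → ℝ) (ω : BitCube d n) : ℝ :=
  ∑ st, D.weight t st * (z₀ st.1 * z₁ st.2) * (D.optFun st.1 ω * D.optFun st.2 ω)

/-- The sum over one block. -/
def blockSum (t : Fin q) (ω : BitCube d n) : ℝ := ∑ r ∈ D.block t, D.f r ω

/-- The sum over the pairs of one block that differ in every coordinate. -/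
def pairSum (t : Fin q) (y y' : ScaleVec d n → ℝ) (ω : BitCube d n) : ℝ :=
  ∑ r ∈ D.block t, ∑ s ∈ D.block t, (if ∀ m, r m ≠ s m then 1 else 0) *
    ((y r * D.f r ω) * (y' s * D.f s ω))

/-- The factor of the positive Riesz product. -/
def posFactor (t : Fin q) (ω : BitCube d n) : ℝ :=
  1 + D.ρ * D.blockSum t ω + D.ρ ^ 2 / 2 * (D.blockSum t ω ^ 2 - #(D.block t))

/-- The contribution to `posFactor` of the distinct pairs of one block that coincide in some
coordinate. -/
def defect (t : Fin q) (ω : BitCube d n) : ℝ :=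
  D.ρ ^ 2 / 2 * (D.blockSum t ω ^ 2 - #(D.block t) - D.pairSum t 1 1 ω)

/-- The moment bounds, of order `P`, that drive the estimates of the Riesz product: `Λ` for the
linear parts and `θ` for the sums over coincidences. -/
structure Bounds (P : ℕ) (Λ θ : ℝ) : Prop where
  family : IsRFamily D.f
  one_le : 1 ≤ Λ
  theta_nonneg : 0 ≤ θ
  linear : ∀ y : ScaleVec d n → ℝ, (∀ r, |y r| ≤ 1) → ∀ t,
    MomentBound P (fun ω => D.ρ * ∑ r ∈ D.block t, y r * D.f r ω) Λ
  coincidence : ∀ y y' : ScaleVec d n → ℝ, (∀ r, |y r| ≤ 1) → (∀ r, |y' r| ≤ 1) →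
    ∀ i j, i ≠ j → MomentBound P (fun ω => D.ρ ^ 2 *
      coincidenceSum i j (fun r ω => y r * D.f r ω) (fun r ω => y' r * D.f r ω) ω) θ

theorem mem_block {t : Fin q} {r : ScaleVec d n} :
    r ∈ D.block t ↔ r ∈ hyperbolic d n ∧ D.β (r D.o) = t := by
  simp [block]

theorem sum_weight_mul (t : Fin q) (F : FactorState d n → ℝ) :
    ∑ st, D.weight t st * F st = F (none, none) +
      (∑ r ∈ D.block t, D.ρ * F (some r, none)) +
      ∑ r ∈ D.block t, ∑ s ∈ D.block t,
        (if ∀ m, r m ≠ s m then D.ρ ^ 2 / 2 else 0) * F (some r, some s) := by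
  rw [Fintype.sum_prod_type, Fintype.sum_option, Fintype.sum_option]
  simp only [Fintype.sum_option, sum_add_distrib]
  have e1 : ∑ r, D.weight t (some r, none) * F (some r, none) =
      ∑ r ∈ D.block t, D.ρ * F (some r, none) := by
    rw [← sum_filter_add_sum_filter_not univ (· ∈ D.block t)]
    rw [filter_mem_eq_inter, univ_inter]
    have : ∑ r ∈ univ.filter (· ∉ D.block t), D.weight t (some r, none) * F (some r, none) = 0 :=
      sum_eq_zero fun r hr => by simp [weight, (mem_filter.1 hr).2]
    rw [this, add_zero]
    exact sum_congr rfl fun r hr => by simp [weight, hr]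
  have e2 : ∑ r, ∑ s, D.weight t (some r, some s) * F (some r, some s) =
      ∑ r ∈ D.block t, ∑ s ∈ D.block t,
        (if ∀ m, r m ≠ s m then D.ρ ^ 2 / 2 else 0) * F (some r, some s) := by
    symm
    rw [← sum_subset (subset_univ (D.block t))]
    · refine sum_congr rfl fun r hr => ?_
      rw [← sum_subset (subset_univ (D.block t))]
      · refine sum_congr rfl fun s hs => ?_
        simp [weight, hr, hs]
      · intro s _ hs
        simp [weight, hs]
    · intro r _ hr
      exact sum_eq_zero fun s _ => by simp [weight, hr]
  rw [e1, e2]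
  simp only [weight, zero_mul, sum_const_zero, add_zero, one_mul]
  ring

theorem vertexSum_eq (t : Fin q) (z₀ z₁ : Option (ScaleVec d n) → ℝ) (ω : BitCube d n) :
    D.vertexSum t z₀ z₁ ω = z₀ none * z₁ none +
      z₁ none * (D.ρ * ∑ r ∈ D.block t, z₀ (some r) * D.f r ω) +
      D.ρ ^ 2 / 2 * D.pairSum t (fun r => z₀ (some r)) (fun r => z₁ (some r)) ω := by
  unfold vertexSum
  simp only [mul_assoc (D.weight t _)]
  rw [D.sum_weight_mul t]
  simp only [optFun, mul_one, pairSum, mul_sum]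
  congr 1
  · congr 1
    exact sum_congr rfl fun r _ => by ring
  · refine sum_congr rfl fun r _ => sum_congr rfl fun s _ => ?_
    split_ifs <;> ring

theorem sum_weight_eq (t : Fin q) (ω : BitCube d n) :
    ∑ st, D.weight t st * (D.optFun st.1 ω * D.optFun st.2 ω) =
      D.posFactor t ω - D.defect t ω := by
  have := D.vertexSum_eq t 1 1 ω
  simp only [vertexSum, Pi.one_apply, one_mul, mul_one] at this
  rw [this]
  unfold posFactor defect blockSum
  have e : D.pairSum t (fun _ => 1) (fun _ => 1) ω = D.pairSum t 1 1 ω := rfl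
  rw [e]
  ring

theorem posFactor_nonneg (t : Fin q) (h : D.ρ ^ 2 * #(D.block t) ≤ 1) (ω : BitCube d n) :
    0 ≤ D.posFactor t ω := by
  unfold posFactor
  nlinarith [sq_nonneg (1 + D.ρ * D.blockSum t ω)]

theorem posFactor_le (t : Fin q) (ω : BitCube d n) :
    D.posFactor t ω ≤ (1 + |D.ρ * D.blockSum t ω|) ^ 2 := by
  unfold posFactor
  have h1 := le_abs_self (D.ρ * D.blockSum t ω)
  have h2 : (D.ρ * D.blockSum t ω) ^ 2 = |D.ρ * D.blockSum t ω| ^ 2 := (sq_abs _).symm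
  have h3 : 0 ≤ D.ρ ^ 2 * (#(D.block t) : ℝ) := by positivity
  have h4 := abs_nonneg (D.ρ * D.blockSum t ω)
  nlinarith

variable {D} {P p : ℕ} {Λ θ : ℝ}

theorem abs_div_le_one {x c : ℝ} (h : |x| ≤ c) (hc : 0 < c) : |x / c| ≤ 1 := by
  rw [abs_div, abs_of_pos hc, div_le_one hc]
  exact h

theorem Bounds.exponent_le (hB : D.Bounds P Λ θ) (h : p ≤ P) : D.Bounds p Λ θ where
  family := hB.family
  one_le := hB.one_le
  theta_nonneg := hB.theta_nonneg
  linear y hy t := (hB.linear y hy t).exponent_le h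
  coincidence y y' hy hy' i j hij := (hB.coincidence y y' hy hy' i j hij).exponent_le h

/-- The sum over the pairs that differ in every coordinate as an average of products of linear
sums. -/
theorem exists_pairSum_eq (D : RieszData d n q) :
    ∃ (Z : Type) (_ : Fintype Z) (_ : Nonempty Z) (A B : Z → ScaleVec d n → ℝ),
      (∀ z r, |A z r| ≤ 1) ∧ (∀ z r, |B z r| ≤ 1) ∧
      ∀ t y y' ω, D.ρ ^ 2 / 2 * D.pairSum t y y' ω = 𝔼 z, 4 ^ d / 2 *
        ((D.ρ * ∑ r ∈ D.block t, (A z r * y r) * D.f r ω) *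
          (D.ρ * ∑ s ∈ D.block t, (B z s * y' s) * D.f s ω)) := by
  obtain ⟨Z, h1, h2, A, B, hA, hB, h⟩ :=
    exists_sign_encoding (κ := Fin (n + 1)) (univ : Finset (Fin d)) ∅
  rw [Fintype.card_fin] at hA hB
  refine ⟨Z, h1, h2, fun z r => A z r / 2 ^ d, fun z r => B z r / 2 ^ d,
    fun z r => abs_div_le_one (hA z r) (by positivity),
    fun z r => abs_div_le_one (hB z r) (by positivity), fun t y y' ω => ?_⟩
  have h3 : ∀ r s : ScaleVec d n, (if ∀ m, r m ≠ s m then (1 : ℝ) else 0) =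
      𝔼 z, 4 ^ d * (A z r / 2 ^ d * (B z s / 2 ^ d)) := by
    intro r s
    have h3 := h r s
    simp only [mem_univ, true_imp_iff, notMem_empty, false_imp_iff, implies_true, and_true] at h3
    rw [h3]
    refine expect_congr rfl fun z _ => ?_
    rw [show (4 : ℝ) = 2 * 2 by norm_num, mul_pow]
    field_simp
  have h4 : ∀ z, 4 ^ d / 2 *
      ((D.ρ * ∑ r ∈ D.block t, (A z r / 2 ^ d * y r) * D.f r ω) *
        (D.ρ * ∑ s ∈ D.block t, (B z s / 2 ^ d * y' s) * D.f s ω)) =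
      ∑ r ∈ D.block t, ∑ s ∈ D.block t, 4 ^ d * (A z r / 2 ^ d * (B z s / 2 ^ d)) *
        (D.ρ ^ 2 / 2 * ((y r * D.f r ω) * (y' s * D.f s ω))) := by
    intro z
    rw [mul_mul_mul_comm, sum_mul_sum, mul_sum, mul_sum]
    refine sum_congr rfl fun r _ => ?_
    rw [mul_sum, mul_sum]
    exact sum_congr rfl fun s _ => by ring
  simp only [h4]
  rw [expect_sum_comm, pairSum, mul_sum]
  refine sum_congr rfl fun r _ => ?_
  rw [expect_sum_comm, mul_sum]
  refine sum_congr rfl fun s _ => ?_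
  rw [← expect_mul, ← h3]
  ring

theorem Bounds.momentBound_pairSum (hB : D.Bounds (2 * p) Λ θ) (hp : p ≠ 0) (t : Fin q)
    {y y' : ScaleVec d n → ℝ} (hy : ∀ r, |y r| ≤ 1) (hy' : ∀ r, |y' r| ≤ 1) :
    MomentBound p (fun ω => D.ρ ^ 2 / 2 * D.pairSum t y y' ω) (4 ^ d * Λ ^ 2) := by
  obtain ⟨Z, _, _, A, B, hA, hA', h⟩ := D.exists_pairSum_eq
  simp only [h]
  refine momentBound_expect hp fun z => ?_
  have h3 := ((hB.linear (fun r => A z r * y r) (fun r => by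
      rw [abs_mul]; exact mul_le_one₀ (hA z r) (abs_nonneg _) (hy r)) t).mul hp
    (hB.linear (fun r => B z r * y' r) (fun r => by
      rw [abs_mul]; exact mul_le_one₀ (hA' z r) (abs_nonneg _) (hy' r)) t)).const_mul (4 ^ d / 2)
  refine h3.mono ?_
  rw [abs_of_nonneg (by positivity), ← pow_two]
  have : (0 : ℝ) ≤ 4 ^ d * Λ ^ 2 := by positivity
  linarith

theorem Bounds.momentBound_vertexSum (hB : D.Bounds (2 * p) Λ θ) (hp : p ≠ 0) (t : Fin q)
    {z₀ z₁ : Option (ScaleVec d n) → ℝ} (h₀ : ∀ r, |z₀ r| ≤ 1) (h₁ : ∀ r, |z₁ r| ≤ 1) :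
    MomentBound p (D.vertexSum t z₀ z₁) (4 ^ (d + 1) * Λ ^ 2) := by
  have hΛ := hB.one_le
  have e : D.vertexSum t z₀ z₁ = fun ω => (z₀ none * z₁ none +
      z₁ none * (D.ρ * ∑ r ∈ D.block t, z₀ (some r) * D.f r ω)) +
      D.ρ ^ 2 / 2 * D.pairSum t (fun r => z₀ (some r)) (fun r => z₁ (some r)) ω :=
    funext fun ω => D.vertexSum_eq t z₀ z₁ ω
  have i1 : MomentBound p (fun _ : BitCube d n => z₀ none * z₁ none) 1 :=
    momentBound_of_le p fun _ => by
      rw [abs_mul]; exact mul_le_one₀ (h₀ _) (abs_nonneg _) (h₁ _)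
  have i2 := ((hB.exponent_le (by omega : p ≤ 2 * p)).linear (fun r => z₀ (some r))
    (fun r => h₀ _) t).const_mul (z₁ none)
  have i3 := hB.momentBound_pairSum hp t (fun r => h₀ (some r)) (fun r => h₁ (some r))
  rw [e]
  refine ((i1.add hp i2).add hp i3).mono ?_
  have h4 : (1 : ℝ) ≤ 4 ^ d := one_le_pow₀ (by norm_num)
  have h5 : |z₁ none| * Λ ≤ Λ := mul_le_of_le_one_left (by linarith) (h₁ _)
  have h6 : Λ ≤ Λ ^ 2 := by nlinarith
  have h7 : Λ ^ 2 ≤ 4 ^ d * Λ ^ 2 := le_mul_of_one_le_left (sq_nonneg _) h4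
  rw [pow_succ (4 : ℝ) d]
  linarith

/-- Restriction of weights to the scale vectors with scale `u` in the coordinate `j`. -/
def restrict (j : Fin d) (u : Fin (n + 1)) (z : Option (ScaleVec d n) → ℝ)
    (o : Option (ScaleVec d n)) : ℝ := if o.map (fun r => r j) = some u then z o else 0

/-- The factor `t`, restricted to the states whose scale vector in the slot `e` has scale `u` in the
coordinate `j`. -/
def slotSum (D : RieszData d n q) (t : Fin q) (e : Bool) (j : Fin d) (u : Fin (n + 1))
    (z₀ z₁ : Option (ScaleVec d n) → ℝ) : BitCube d n → ℝ :=
  bif e then D.vertexSum t z₀ (restrict j u z₁) else D.vertexSum t (restrict j u z₀) z₁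

/-- A restricted factor is linear in the `r`-functions of the restricted slot, with coefficients
under control. -/
theorem Bounds.exists_slotSum_eq (hB : D.Bounds p Λ θ) (t : Fin q) (e : Bool)
    (j : Fin d) {z₀ z₁ : Option (ScaleVec d n) → ℝ} (h₀ : ∀ r, |z₀ r| ≤ 1)
    (h₁ : ∀ r, |z₁ r| ≤ 1) :
    ∃ (X : Type) (_ : Fintype X) (_ : Nonempty X) (y : Bool → X → ScaleVec d n → ℝ)
      (R : Bool → X → BitCube d n → ℝ), (∀ b x r, |y b x r| ≤ 1) ∧
      (∀ b x, MomentBound p (R b x) (4 ^ d * Λ)) ∧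
      ∀ u ω, D.slotSum t e j u z₀ z₁ ω = 𝔼 x, ∑ b,
        D.ρ * (∑ r ∈ D.block t with r j = u, y b x r * D.f r ω) * R b x ω := by
  obtain ⟨Z, i1, i2, A, B, hA, hA', hpair⟩ := D.exists_pairSum_eq
  have hΛ := hB.one_le
  have h4 : (1 : ℝ) ≤ 4 ^ d := one_le_pow₀ (by norm_num)
  have h4Λ : Λ ≤ 4 ^ d * Λ := le_mul_of_one_le_left (by linarith) h4
  have hprod : ∀ {x y : ℝ}, |x| ≤ 1 → |y| ≤ 1 → |x * y| ≤ 1 := fun {x y} hx hy => by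
    rw [abs_mul]; exact mul_le_one₀ hx (abs_nonneg _) hy
  have hres : ∀ (z : Option (ScaleVec d n) → ℝ) (a : ScaleVec d n → ℝ) (u : Fin (n + 1)) ω,
      ∑ r ∈ D.block t, a r * restrict j u z (some r) * D.f r ω =
        ∑ r ∈ D.block t with r j = u, a r * z (some r) * D.f r ω := by
    intro z a u ω
    rw [sum_filter]
    refine sum_congr rfl fun r _ => ?_
    simp only [restrict, Option.map_some, Option.some.injEq]
    split_ifs <;> simp
  cases e with
  | false =>
    refine ⟨Z, i1, i2, fun b z r => bif b then A z r * z₀ (some r) else z₀ (some r),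
      fun b z ω => bif b then 4 ^ d / 2 * (D.ρ * ∑ s ∈ D.block t, (B z s * z₁ (some s)) * D.f s ω)
        else z₁ none, fun b z r => ?_, fun b z => ?_, fun u ω => ?_⟩
    · cases b
      · exact h₀ _
      · exact hprod (hA z r) (h₀ _)
    · cases b
      · exact momentBound_of_le p fun _ => (h₁ none).trans (by linarith)
      · refine ((hB.linear (fun s => B z s * z₁ (some s))
          (fun s => hprod (hA' z s) (h₁ _)) t).const_mul (4 ^ d / 2)).mono ?_
        rw [abs_of_nonneg (by positivity)]
        have : (0 : ℝ) ≤ 4 ^ d * Λ := by positivity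
        linarith
    · simp only [slotSum, cond_false, Fintype.sum_bool, cond_true]
      rw [D.vertexSum_eq, hpair, expect_add_distrib, expect_const_univ]
      have e1 := hres z₀ 1 u ω
      simp only [Pi.one_apply, one_mul] at e1
      rw [e1]
      have e2 : restrict j u z₀ none = 0 := by simp [restrict]
      rw [e2, zero_mul, zero_add, add_comm]
      congr 1
      · refine expect_congr rfl fun z _ => ?_
        rw [hres z₀ (A z) u ω]
        ring
      · ring
  | true =>
    refine ⟨Z, i1, i2, fun b z r => bif b then B z r * z₁ (some r) else 0,
      fun b z ω => bif b then 4 ^ d / 2 * (D.ρ * ∑ s ∈ D.block t, (A z s * z₀ (some s)) * D.f s ω)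
        else 0, fun b z r => ?_, fun b z => ?_, fun u ω => ?_⟩
    · cases b
      · simp
      · exact hprod (hA' z r) (h₁ _)
    · cases b
      · exact momentBound_of_le p fun _ => by simp; positivity
      · refine ((hB.linear (fun s => A z s * z₀ (some s))
          (fun s => hprod (hA z s) (h₀ _)) t).const_mul (4 ^ d / 2)).mono ?_
        rw [abs_of_nonneg (by positivity)]
        have : (0 : ℝ) ≤ 4 ^ d * Λ := by positivity
        linarith
    · simp only [slotSum, cond_false, Fintype.sum_bool, cond_true, mul_zero, add_zero]
      rw [D.vertexSum_eq, hpair]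
      have e2 : restrict j u z₁ none = 0 := by simp [restrict]
      rw [e2, zero_mul, mul_zero, zero_add, zero_add]
      refine expect_congr rfl fun z _ => ?_
      rw [hres z₁ (B z) u ω]
      ring

/-- Two factors linked by a coincidence in one coordinate. -/
theorem Bounds.momentBound_linked (hB : D.Bounds (3 * p) Λ θ) (hp : p ≠ 0) {a b : Fin q}
    (hab : a ≠ b) (ea eb : Bool) {j : Fin d} (hj : j ≠ D.o)
    {z₀ z₁ z₀' z₁' : Option (ScaleVec d n) → ℝ} (h₀ : ∀ r, |z₀ r| ≤ 1) (h₁ : ∀ r, |z₁ r| ≤ 1)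
    (h₀' : ∀ r, |z₀' r| ≤ 1) (h₁' : ∀ r, |z₁' r| ≤ 1) :
    MomentBound p (fun ω => ∑ u, D.slotSum a ea j u z₀ z₁ ω * D.slotSum b eb j u z₀' z₁' ω)
      (4 * 16 ^ d * θ * Λ ^ 2) := by
  obtain ⟨X, _, _, y, R, hy, hR, hX⟩ := hB.exists_slotSum_eq a ea j h₀ h₁
  obtain ⟨X', _, _, y', R', hy', hR', hX'⟩ := hB.exists_slotSum_eq b eb j h₀' h₁'
  -- weights supported on the blocks
  let Y : Bool → X → ScaleVec d n → ℝ := fun c x r => if r ∈ D.block a then y c x r else 0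
  let Y' : Bool → X' → ScaleVec d n → ℝ := fun c x r => if r ∈ D.block b then y' c x r else 0
  have hY : ∀ c x r, |Y c x r| ≤ 1 := fun c x r => by
    simp only [Y]; split_ifs
    · exact hy c x r
    · simp
  have hY' : ∀ c x r, |Y' c x r| ≤ 1 := fun c x r => by
    simp only [Y']; split_ifs
    · exact hy' c x r
    · simp
  have hcoin : ∀ c x c' x' ω, ∑ u, (D.ρ * ∑ r ∈ D.block a with r j = u, y c x r * D.f r ω) *
      (D.ρ * ∑ s ∈ D.block b with s j = u, y' c' x' s * D.f s ω) =
      D.ρ ^ 2 * coincidenceSum D.o j (fun r ω => Y c x r * D.f r ω)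
        (fun s ω => Y' c' x' s * D.f s ω) ω := by
    intro c x c' x' ω
    have e0 : ∀ u, (D.ρ * ∑ r ∈ D.block a with r j = u, y c x r * D.f r ω) *
        (D.ρ * ∑ s ∈ D.block b with s j = u, y' c' x' s * D.f s ω) =
        ∑ r ∈ D.block a with r j = u, D.ρ ^ 2 * ((y c x r * D.f r ω) *
          ∑ s ∈ D.block b with s j = r j, y' c' x' s * D.f s ω) := by
      intro u
      rw [mul_mul_mul_comm, ← pow_two, sum_mul, mul_sum]
      refine sum_congr rfl fun r hr => ?_
      rw [(mem_filter.1 hr).2]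
    rw [sum_congr rfl fun u _ => e0 u, sum_fiberwise, coincidenceSum, mul_sum]
    have hsub : ∀ t, D.block t ⊆ hyperbolic d n := fun t => filter_subset _ _
    refine sum_subset_zero_on_sdiff (hsub a) (fun r hr => ?_) fun r hr => ?_
    · rw [mem_sdiff] at hr
      simp [Y, hr.2]
    · congr 1
      rw [mul_sum, sum_filter]
      refine sum_subset_zero_on_sdiff (hsub b) (fun s hs => ?_) fun s hs => ?_
      · rw [mem_sdiff] at hs
        simp [Y', hs.2]
      · have hne : r D.o ≠ s D.o := by
          intro he
          rw [D.mem_block] at hr hs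
          exact hab (by rw [← hr.2, ← hs.2, he])
        simp only [Y, Y', hr, hs, if_true, hne, ne_eq, not_false_eq_true, and_true,
          eq_comm (a := s j)]
        split_ifs <;> simp
  have hmain : (fun ω => ∑ u, D.slotSum a ea j u z₀ z₁ ω * D.slotSum b eb j u z₀' z₁' ω) =
      fun ω => 𝔼 x, 𝔼 x', ∑ c, ∑ c', (D.ρ ^ 2 *
        coincidenceSum D.o j (fun r ω => Y c x r * D.f r ω) (fun s ω => Y' c' x' s * D.f s ω) ω) *
          (R c x ω * R' c' x' ω) := by
    funext ω
    have e1 : ∀ u, D.slotSum a ea j u z₀ z₁ ω * D.slotSum b eb j u z₀' z₁' ω =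
        𝔼 x, 𝔼 x', ∑ c, ∑ c', ((D.ρ * ∑ r ∈ D.block a with r j = u, y c x r * D.f r ω) *
          (D.ρ * ∑ s ∈ D.block b with s j = u, y' c' x' s * D.f s ω)) *
            (R c x ω * R' c' x' ω) := by
      intro u
      rw [hX, hX', expect_mul_expect]
      refine expect_congr rfl fun x _ => expect_congr rfl fun x' _ => ?_
      rw [sum_mul_sum]
      exact sum_congr rfl fun c _ => sum_congr rfl fun c' _ => by ring
    rw [sum_congr rfl fun u _ => e1 u, ← expect_sum_comm]
    refine expect_congr rfl fun x _ => ?_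
    rw [← expect_sum_comm]
    refine expect_congr rfl fun x' _ => ?_
    rw [sum_comm]
    refine sum_congr rfl fun c _ => ?_
    rw [sum_comm]
    refine sum_congr rfl fun c' _ => ?_
    rw [← sum_mul, hcoin]
  rw [hmain]
  refine momentBound_expect hp fun x => momentBound_expect hp fun x' => ?_
  have hterm : ∀ c c', MomentBound p (fun ω => (D.ρ ^ 2 *
        coincidenceSum D.o j (fun r ω => Y c x r * D.f r ω) (fun s ω => Y' c' x' s * D.f s ω) ω) *
          (R c x ω * R' c' x' ω)) (θ * (4 ^ d * Λ * (4 ^ d * Λ))) := by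
    intro c c'
    have := MomentBound.prod (v := 3) (univ : Finset (Fin 3)) (F := ![fun ω => D.ρ ^ 2 *
        coincidenceSum D.o j (fun r ω => Y c x r * D.f r ω) (fun s ω => Y' c' x' s * D.f s ω) ω,
        R c x, R' c' x']) (A := ![θ, 4 ^ d * Λ, 4 ^ d * Λ]) hp (by simp) (by
          intro i _
          rw [mul_comm p 3]
          fin_cases i
          · exact hB.coincidence _ _ (hY c x) (hY' c' x') _ _ hj.symm
          · exact hR c x
          · exact hR' c' x')
    simpa [Fin.prod_univ_three, mul_assoc] using this
  have hsum := MomentBound.sum hp univ fun c _ => MomentBound.sum hp univ fun c' _ => hterm c c'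
  refine hsum.mono (le_of_eq ?_)
  simp only [sum_const, card_univ, Fintype.card_bool, nsmul_eq_mul]
  rw [show (16 : ℝ) = 4 * 4 by norm_num, mul_pow]
  push_cast
  ring

/-- The defect is small, by Beck's gain for each of the ways two vectors may coincide. -/
theorem Bounds.momentBound_defect (hB : D.Bounds p Λ θ) (hp : p ≠ 0)
    (hsq : ∀ r ω, D.f r ω ^ 2 = 1) (t : Fin q) :
    MomentBound p (D.defect t) (d ^ 2 * 4 ^ d * θ) := by
  have hkey : ∀ r s : ScaleVec d n,
      (if r = s then 0 else 1) - (if ∀ m, r m ≠ s m then (1 : ℝ) else 0)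
      = ∑ j, ∑ i, (if r j = s j ∧ r i ≠ s i then 1 else 0) *
        (if (∀ m ∈ univ.filter (· < j), r m ≠ s m) ∧ (∀ m ∈ univ.filter (· < i), r m = s m)
          then 1 else 0) := by
    intro r s
    have e1 := ite_exists_eq_sum fun m => r m = s m
    have e2 := ite_exists_eq_sum fun m => r m ≠ s m
    have e3 : ∑ j, ∑ i, (if r j = s j ∧ r i ≠ s i then (1 : ℝ) else 0) *
        (if (∀ m ∈ univ.filter (· < j), r m ≠ s m) ∧ (∀ m ∈ univ.filter (· < i), r m = s m)
          then 1 else 0) =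
        (if ∃ m, r m = s m then 1 else 0) * (if ∃ m, r m ≠ s m then 1 else 0) := by
      rw [e1, e2, sum_mul_sum]
      refine sum_congr rfl fun j _ => sum_congr rfl fun i _ => ?_
      simp only [ite_zero_mul_ite_zero, mul_one, not_not, ne_eq]
      exact if_congr (by tauto) rfl rfl
    rw [e3]
    by_cases h1 : r = s
    · subst h1
      by_cases h2 : ∃ m : Fin d, True
      · obtain ⟨m, -⟩ := h2
        have : ¬ ∀ m, r m ≠ r m := fun h => h m rfl
        simp
        exact ⟨m⟩
      · exfalso
        exact h2 ⟨D.o, trivial⟩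
    · have h2 : ∃ m, r m ≠ s m := Function.ne_iff.1 h1
      rw [if_neg h1, if_pos h2, mul_one]
      by_cases h3 : ∃ m, r m = s m
      · rw [if_pos h3, if_neg (fun h => by obtain ⟨m, hm⟩ := h3; exact h m hm), sub_zero]
      · rw [if_neg h3, if_pos (fun m hm => h3 ⟨m, hm⟩), sub_self]
  have hexp : ∀ ω, D.defect t ω = ∑ j, ∑ i, ∑ r ∈ D.block t, ∑ s ∈ D.block t, D.ρ ^ 2 / 2 *
      ((if r j = s j ∧ r i ≠ s i then 1 else 0) *
        (if (∀ m ∈ univ.filter (· < j), r m ≠ s m) ∧ (∀ m ∈ univ.filter (· < i), r m = s m)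
          then 1 else 0) * (D.f r ω * D.f s ω)) := by
    intro ω
    have e1 : D.blockSum t ω ^ 2 - #(D.block t) - D.pairSum t 1 1 ω =
        ∑ r ∈ D.block t, ∑ s ∈ D.block t, ((if r = s then 0 else 1) -
          (if ∀ m, r m ≠ s m then (1 : ℝ) else 0)) * (D.f r ω * D.f s ω) := by
      have e2 : (#(D.block t) : ℝ) = ∑ r ∈ D.block t, ∑ s ∈ D.block t,
          (if r = s then 1 else 0) * (D.f r ω * D.f s ω) := by
        rw [card_eq_sum_ones, Nat.cast_sum]
        refine sum_congr rfl fun r hr => ?_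
        simp only [ite_mul, one_mul, zero_mul, sum_ite_eq, hr, if_true]
        rw [← pow_two, hsq, Nat.cast_one]
      rw [e2, blockSum, pow_two, sum_mul_sum, pairSum, ← sum_sub_distrib, ← sum_sub_distrib]
      refine sum_congr rfl fun r _ => ?_
      rw [← sum_sub_distrib, ← sum_sub_distrib]
      refine sum_congr rfl fun s _ => ?_
      simp only [Pi.one_apply, one_mul]
      split_ifs <;> ring
    rw [defect, e1]
    simp only [hkey, sum_mul, mul_sum]
    rw [sum_congr rfl fun r _ => sum_comm, sum_comm]
    refine sum_congr rfl fun j _ => ?_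
    rw [sum_congr rfl fun r _ => sum_comm, sum_comm]
  have hfun : D.defect t = fun ω => ∑ j, ∑ i, ∑ r ∈ D.block t, ∑ s ∈ D.block t, D.ρ ^ 2 / 2 *
      ((if r j = s j ∧ r i ≠ s i then 1 else 0) *
        (if (∀ m ∈ univ.filter (· < j), r m ≠ s m) ∧ (∀ m ∈ univ.filter (· < i), r m = s m)
          then 1 else 0) * (D.f r ω * D.f s ω)) := funext hexp
  have hθ0 := hB.theta_nonneg
  have hnn : 0 ≤ 4 ^ d * θ := by positivity
  have hterm : ∀ j i : Fin d, MomentBound p (fun ω => ∑ r ∈ D.block t, ∑ s ∈ D.block t,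
      D.ρ ^ 2 / 2 * ((if r j = s j ∧ r i ≠ s i then 1 else 0) *
        (if (∀ m ∈ univ.filter (· < j), r m ≠ s m) ∧ (∀ m ∈ univ.filter (· < i), r m = s m)
          then 1 else 0) * (D.f r ω * D.f s ω))) (if i = j then 0 else 4 ^ d * θ) := by
    intro j i
    split_ifs with hij
    · subst hij
      refine momentBound_of_le p fun ω => ?_
      rw [sum_eq_zero fun r _ => sum_eq_zero fun s _ => ?_, abs_zero]
      rw [if_neg (fun h => h.2 h.1)]
      ring
    · obtain ⟨Z, _, _, A, B, hA, hA', h⟩ := exists_sign_encoding (κ := Fin (n + 1))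
        (univ.filter (· < j)) (univ.filter (· < i))
      rw [Fintype.card_fin] at hA hA'
      let Y : Z → ScaleVec d n → ℝ := fun z r => if r ∈ D.block t then A z r / 2 ^ d else 0
      let Y' : Z → ScaleVec d n → ℝ := fun z r => if r ∈ D.block t then B z r / 2 ^ d else 0
      have hY : ∀ z r, |Y z r| ≤ 1 := fun z r => by
        simp only [Y]; split_ifs
        · exact abs_div_le_one (hA z r) (by positivity)
        · simp
      have hY' : ∀ z r, |Y' z r| ≤ 1 := fun z r => by
        simp only [Y']; split_ifs
        · exact abs_div_le_one (hA' z r) (by positivity)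
        · simp
      have e : (fun ω => ∑ r ∈ D.block t, ∑ s ∈ D.block t,
          D.ρ ^ 2 / 2 * ((if r j = s j ∧ r i ≠ s i then 1 else 0) *
          (if (∀ m ∈ univ.filter (· < j), r m ≠ s m) ∧ (∀ m ∈ univ.filter (· < i), r m = s m)
          then 1 else 0) * (D.f r ω * D.f s ω))) = fun ω => 𝔼 z, 4 ^ d / 2 * (D.ρ ^ 2 *
            coincidenceSum i j (fun r ω => Y z r * D.f r ω) (fun s ω => Y' z s * D.f s ω) ω) := by
        funext ω
        simp only [coincidenceSum, mul_sum]
        rw [expect_sum_comm]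
        have hsub : D.block t ⊆ hyperbolic d n := filter_subset _ _
        refine sum_subset_zero_on_sdiff hsub (fun r hr => ?_) fun r hr => ?_
        · rw [mem_sdiff] at hr
          simp [Y, hr.2]
        · rw [expect_sum_comm]
          refine sum_subset_zero_on_sdiff hsub (fun s hs => ?_) fun s hs => ?_
          · rw [mem_sdiff] at hs
            simp [Y', hs.2]
          · rw [show (if (∀ m ∈ univ.filter (· < j), r m ≠ s m) ∧
                (∀ m ∈ univ.filter (· < i), r m = s m) then (1 : ℝ) else 0) = _ by
                convert h r s, mul_expect, expect_mul, mul_expect]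
            refine expect_congr rfl fun z _ => ?_
            simp only [Y, Y', hr, hs, if_true]
            rw [show (4 : ℝ) = 2 * 2 by norm_num, mul_pow]
            field_simp
      rw [e]
      refine momentBound_expect hp fun z => ?_
      refine ((hB.coincidence _ _ (hY z) (hY' z) i j hij).const_mul (4 ^ d / 2)).mono ?_
      rw [abs_of_nonneg (by positivity)]
      linarith
  rw [hfun]
  refine (MomentBound.sum hp univ fun j _ => MomentBound.sum hp univ fun i _ => hterm j i).mono ?_
  have hle : ∀ j i : Fin d, (if i = j then 0 else 4 ^ d * θ) ≤ 4 ^ d * θ := by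
    intro j i
    split_ifs
    · exact hnn
    · exact le_rfl
  refine (sum_le_sum fun j _ => sum_le_sum fun i _ => hle j i).trans (le_of_eq ?_)
  simp only [sum_const, card_univ, Fintype.card_fin, nsmul_eq_mul]
  ring

end

end RieszData

/-! ### The positive Riesz product and the absorption of small factors -/

namespace RieszData

noncomputable section

variable {d n q : ℕ} {D : RieszData d n q}

/-- The scale vector in the slot `a` of a choice of states. -/
def slot (c : Fin q → FactorState d n) (a : Fin q × Bool) : Option (ScaleVec d n) :=
  bif a.2 then (c a.1).2 else (c a.1).1

theorem mem_block_of_slot {c : Fin q → FactorState d n} {t : Fin q}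
    (h : D.weight t (c t) ≠ 0) {e : Bool} {r : ScaleVec d n} (hr : slot c (t, e) = some r) :
    r ∈ D.block t := by
  by_contra hn
  apply h
  rcases hc : c t with ⟨x, y⟩
  cases e <;> simp only [slot, hc, cond_true, cond_false] at hr <;> subst hr
  · cases y <;> simp [weight, hn]
  · cases x <;> simp [weight, hn]

theorem exists_slot_false {c : Fin q → FactorState d n} {t : Fin q}
    (h : D.weight t (c t) ≠ 0) {s : ScaleVec d n} (hs : slot c (t, true) = some s) :
    ∃ r, slot c (t, false) = some r ∧ ∀ m, r m ≠ s m := by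
  rcases hc : c t with ⟨x, y⟩
  simp only [slot, hc, cond_true, cond_false] at hs ⊢
  subst hs
  rw [hc] at h
  cases x with
  | none => simp [weight] at h
  | some r =>
    refine ⟨r, rfl, ?_⟩
    by_contra hn
    exact h (if_neg fun h' => hn h'.2.2)

theorem slot_coord_injective {c : Fin q → FactorState d n} (h : ∀ t, D.weight t (c t) ≠ 0)
    {a b : Fin q × Bool} {r s : ScaleVec d n} (ha : slot c a = some r) (hb : slot c b = some s)
    (hrs : r D.o = s D.o) : a = b := by
  obtain ⟨t, e⟩ := a
  obtain ⟨t', e'⟩ := b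
  have h1 := (D.mem_block.1 (mem_block_of_slot (h t) ha)).2
  have h2 := (D.mem_block.1 (mem_block_of_slot (h t') hb)).2
  have ht : t = t' := by rw [← h1, ← h2, hrs]
  subst ht
  have key : ∀ {r s : ScaleVec d n}, slot c (t, false) = some r → slot c (t, true) = some s →
      r D.o ≠ s D.o := by
    intro r s hr hs
    obtain ⟨r', hr', hne⟩ := exists_slot_false (h t) hs
    rw [hr] at hr'
    cases hr'
    exact hne D.o
  cases e <;> cases e'
  · rfl
  · exact absurd hrs (key ha hb)
  · exact absurd hrs.symm (key hb ha)
  · rfl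

/-- A product of `r`-functions whose scales in one coordinate are distinct has the largest of them
as its scale in that coordinate. -/
theorem exists_isScaleAt_prod (hf : IsRFamily D.f) {ι : Type*} [Fintype ι] [DecidableEq ι]
    {σ : ι → Option (ScaleVec d n)} (m : Fin d)
    (hinj : ∀ a b r s, σ a = some r → σ b = some s → r m = s m → a = b)
    (hex : ∃ a r, σ a = some r) :
    ∃ a r, σ a = some r ∧ (∀ b s, σ b = some s → s m ≤ r m) ∧
      IsScaleAt m (r m) (fun ω => ∏ a, D.optFun (σ a) ω) := by
  obtain ⟨a₀, r₀, h₀⟩ := hex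
  obtain ⟨a, ha, hmax⟩ := exists_max_image (univ.filter fun a => (σ a).isSome)
    (fun a => (σ a).elim 0 (fun r => r m)) ⟨a₀, by simp [h₀]⟩
  obtain ⟨r, hr⟩ := Option.isSome_iff_exists.1 (mem_filter.1 ha).2
  have hle : ∀ b s, σ b = some s → s m ≤ r m := by
    intro b s hb
    simpa [hr, hb] using hmax b (by simp [hb])
  refine ⟨a, r, hr, hle, ?_⟩
  have e : (fun ω => ∏ a, D.optFun (σ a) ω) =
      fun ω => D.f r ω * ∏ b ∈ univ.erase a, D.optFun (σ b) ω := by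
    funext ω
    rw [← mul_prod_erase univ _ (mem_univ a), hr]
    rfl
  rw [e]
  refine (hf.scale r m).mul_of_invariant fun k hk ω => prod_congr rfl fun b hb => ?_
  rcases hs : σ b with _ | s
  · rfl
  · have hlt : s m < r m := lt_of_le_of_ne (hle b s hs) fun he =>
      (mem_erase.1 hb).1 (hinj b a s r hs hr he)
    exact (hf.scale s m).2 k (hlt.trans_le hk) ω

theorem prod_optFun_slot (c : Fin q → FactorState d n) (ω : BitCube d n) :
    ∏ t, D.optFun (c t).1 ω * D.optFun (c t).2 ω = ∏ a, D.optFun (slot c a) ω := by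
  rw [Fintype.prod_prod_type]
  refine prod_congr rfl fun t _ => ?_
  rw [Fintype.prod_bool, mul_comm]
  rfl

/-- The signed Riesz product has mean one: in every other term of its expansion the scales in the
coordinate `D.o` are distinct, so that a flip of the largest one changes the sign. -/
theorem expect_prod_factor (hf : IsRFamily D.f) (U : Finset (Fin q)) :
    𝔼 ω, ∏ t ∈ U, (D.posFactor t ω - D.defect t ω) = 1 := by
  let w : Fin q → FactorState d n → ℝ := fun t st =>
    if t ∈ U ∨ st = (none, none) then D.weight t st else 0
  have hw : ∀ ω, ∏ t ∈ U, (D.posFactor t ω - D.defect t ω) =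
      ∑ c : Fin q → FactorState d n, (∏ t, w t (c t)) * ∏ a, D.optFun (slot c a) ω := by
    intro ω
    have h1 : ∏ t ∈ U, (D.posFactor t ω - D.defect t ω) =
        ∏ t, ∑ st, w t st * (D.optFun st.1 ω * D.optFun st.2 ω) := by
      rw [← Fintype.prod_ite_mem]
      refine prod_congr rfl fun t _ => ?_
      split_ifs with ht
      · rw [← D.sum_weight_eq]
        exact sum_congr rfl fun st _ => by simp [w, ht]
      · rw [sum_eq_single (none, none)]
        · simp [w, weight, optFun]
        · intro st _ hst
          simp [w, ht, hst]
        · simp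
    rw [h1, prod_univ_sum, Fintype.piFinset_univ]
    refine sum_congr rfl fun c _ => ?_
    rw [prod_mul_distrib, prod_optFun_slot]
  simp only [hw]
  rw [expect_sum_comm, sum_eq_single (fun _ => (none, none))]
  · have h0 : ∀ a : Fin q × Bool, slot (fun _ => (none, none)) a =
        (none : Option (ScaleVec d n)) := by
      rintro ⟨t, e⟩; cases e <;> rfl
    simp only [h0, optFun, w, weight, or_true, if_true, prod_const_one, mul_one]
    exact expect_const_univ 1
  · intro c _ hc
    rw [← mul_expect]
    by_cases hz : ∏ t, w t (c t) = 0
    · rw [hz, zero_mul]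
    have hne : ∀ t, D.weight t (c t) ≠ 0 := by
      intro t h0
      refine hz (prod_eq_zero (mem_univ t) ?_)
      simp only [w, h0, ite_self]
    have hex : ∃ a r, slot c a = some r := by
      by_contra hno
      push Not at hno
      apply hc
      funext t
      have h1 : slot c (t, false) = none := Option.eq_none_iff_forall_ne_some.2 (hno _)
      have h2 : slot c (t, true) = none := Option.eq_none_iff_forall_ne_some.2 (hno _)
      exact Prod.ext h1 h2
    obtain ⟨a, r, -, -, hs⟩ := exists_isScaleAt_prod hf D.o
      (fun a b r s ha hb hrs => slot_coord_injective hne ha hb hrs) hex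
    rw [expect_eq_zero_of_flipBit D.o (r D.o) hs.1, mul_zero]
  · simp

/-- The smallness conditions under which the Riesz product is close to a probability density. The
order `p` controls the size of the product, `Λ` the linear parts and `θ` the coincidences. -/
structure Admissible (D : RieszData d n q) (p : ℕ) (Λ θ : ℝ) : Prop where
  bounds : D.Bounds (12 * p * q) Λ θ
  order_ne_zero : p ≠ 0
  sq_eq_one : ∀ r ω, D.f r ω ^ 2 = 1
  block_le : ∀ t, D.ρ ^ 2 * #(D.block t) ≤ 1
  exp_le : (1 + Λ) ^ (2 * q) ≤ Real.exp p
  defect_le : q * (d ^ 2 * 4 ^ d * θ) ≤ 1 / 20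

variable {p : ℕ} {Λ θ : ℝ}

theorem Admissible.posFactor_nonneg (h : D.Admissible p Λ θ) (t : Fin q) (ω : BitCube d n) :
    0 ≤ D.posFactor t ω := D.posFactor_nonneg t (h.block_le t) ω

theorem Admissible.prod_posFactor_nonneg (h : D.Admissible p Λ θ) (U : Finset (Fin q))
    (ω : BitCube d n) : 0 ≤ ∏ t ∈ U, D.posFactor t ω :=
  prod_nonneg fun t _ => h.posFactor_nonneg t ω

theorem Admissible.expect_prod_posFactor_sq_le (h : D.Admissible p Λ θ) (U : Finset (Fin q)) :
    𝔼 ω, (∏ t ∈ U, D.posFactor t ω) ^ 2 ≤ Real.exp p ^ 2 := by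
  have hΛ := h.bounds.one_le
  have h1 : ∀ t, MomentBound (4 * q) (fun ω => 1 + |D.ρ * D.blockSum t ω|) (1 + Λ) := by
    intro t
    have hq : q ≠ 0 := fun hq => by subst hq; exact t.elim0
    have hb := (h.bounds.linear (fun _ => 1) (by simp) t).exponent_le
      (show 4 * q ≤ 12 * p * q from Nat.mul_le_mul_right _ (by have := h.order_ne_zero; omega))
    simp only [one_mul] at hb
    refine (momentBound_of_le (a := 1) (4 * q) (fun _ => by simp)).add (by omega)
      (hb.of_abs_le fun ω => ?_)
    rw [abs_abs]; rfl
  have h2 := MomentBound.prod (p := 4) (v := q) U (by norm_num)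
    (by simpa using card_le_univ U) fun t _ => h1 t
  rw [prod_const] at h2
  calc 𝔼 ω, (∏ t ∈ U, D.posFactor t ω) ^ 2
      ≤ 𝔼 ω, |∏ t ∈ U, (1 + |D.ρ * D.blockSum t ω|)| ^ 4 := by
        refine expect_le_expect fun ω _ => ?_
        have h3 : ∏ t ∈ U, D.posFactor t ω ≤ ∏ t ∈ U, (1 + |D.ρ * D.blockSum t ω|) ^ 2 :=
          prod_le_prod (fun t _ => h.posFactor_nonneg t ω) fun t _ => D.posFactor_le t ω
        rw [prod_pow] at h3
        rw [Even.pow_abs (by decide), show 4 = 2 * 2 by norm_num, pow_mul]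
        exact pow_le_pow_left₀ (h.prod_posFactor_nonneg U ω) h3 2
    _ ≤ ((1 + Λ) ^ #U) ^ 4 := h2.2
    _ ≤ ((1 + Λ) ^ q) ^ 4 := by
        refine pow_le_pow_left₀ (by positivity) (pow_le_pow_right₀ (by linarith) ?_) 4
        simpa using card_le_univ U
    _ = ((1 + Λ) ^ (2 * q)) ^ 2 := by rw [← pow_mul, ← pow_mul]; congr 1; ring
    _ ≤ Real.exp p ^ 2 := pow_le_pow_left₀ (by positivity) h.exp_le 2

/-- A small factor times products of defects is absorbed by the positive Riesz product. -/
theorem Admissible.expect_abs_mul_prod_defect_le (h : D.Admissible p Λ θ)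
    {S : BitCube d n → ℝ} {s : ℝ} (hS : MomentBound (4 * p) S s) (T W : Finset (Fin q)) :
    𝔼 ω, |S ω| * (∏ t ∈ T, |D.defect t ω|) * ∏ t ∈ W, D.posFactor t ω ≤
      Real.exp 1 * (s * (d ^ 2 * 4 ^ d * θ) ^ #T) * (𝔼 ω, ∏ t ∈ W, D.posFactor t ω + 1) := by
  have hp := h.order_ne_zero
  have h1 : MomentBound (2 * (2 * p)) (fun ω => ∏ t ∈ T, D.defect t ω)
      (∏ _t ∈ T, (d ^ 2 * 4 ^ d * θ)) := by
    refine MomentBound.prod (v := q) T (by omega) (by simpa using card_le_univ T) fun t _ => ?_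
    have hq : q ≠ 0 := fun hq => by subst hq; exact t.elim0
    refine (h.bounds.exponent_le ?_).momentBound_defect
      (Nat.mul_ne_zero (by omega) hq) h.sq_eq_one t
    exact Nat.mul_le_mul_right _ (by omega)
  rw [prod_const] at h1
  rw [show 4 * p = 2 * (2 * p) by ring] at hS
  have h2 := (MomentBound.mul (by omega) hS h1).expect_abs_mul_le hp
    (h.prod_posFactor_nonneg W) (h.expect_prod_posFactor_sq_le W)
  simpa only [abs_mul, abs_prod] using h2

theorem sum_powerset_pow_card_le {γ : ℝ} (h0 : 0 ≤ γ) (h : q * γ ≤ 1 / 20) (U : Finset (Fin q)) :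
    ∑ T ∈ U.powerset, γ ^ #T ≤ 11 / 10 := by
  have h1 : ∑ T ∈ U.powerset, γ ^ #T = (γ + 1) ^ #U := by
    have := prod_add (fun _ : Fin q => γ) (fun _ => 1) U
    simp only [prod_const, one_pow, mul_one] at this
    exact this.symm
  rw [h1]
  have hU : #U ≤ q := by simpa using card_le_univ U
  have h2 : (γ + 1) ^ #U ≤ Real.exp (1 / 20) := by
    calc (γ + 1) ^ #U ≤ (Real.exp γ) ^ #U :=
          pow_le_pow_left₀ (by linarith) (Real.add_one_le_exp γ) _
      _ = Real.exp (#U * γ) := (Real.exp_nat_mul _ _).symm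
      _ ≤ Real.exp (1 / 20) := by
          refine Real.exp_le_exp.2 (le_trans (mul_le_mul_of_nonneg_right ?_ h0) h)
          exact_mod_cast hU
  refine h2.trans ?_
  have h3 := Real.exp_bound' (x := 1 / 20) (by norm_num) (by norm_num) (n := 2) (by norm_num)
  norm_num [sum_range_succ] at h3
  linarith

theorem Admissible.defect_const_nonneg (h : D.Admissible p Λ θ) :
    0 ≤ (d : ℝ) ^ 2 * 4 ^ d * θ := mul_nonneg (by positivity) h.bounds.theta_nonneg

theorem abs_prod_factor_le (h : D.Admissible p Λ θ) (U : Finset (Fin q)) (ω : BitCube d n) :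
    |∏ t ∈ U, (D.posFactor t ω - D.defect t ω)| ≤
      ∑ T ∈ U.powerset, (∏ t ∈ T, |D.defect t ω|) * ∏ t ∈ U \ T, D.posFactor t ω := by
  rw [abs_prod, ← prod_add]
  refine prod_le_prod (fun _ _ => abs_nonneg _) fun t _ => ?_
  rw [add_comm]
  refine (abs_sub _ _).trans ?_
  rw [abs_of_nonneg (h.posFactor_nonneg t ω)]

/-- The positive Riesz product has mean at most two. It differs from the signed one by terms with a
defect, which shorter products absorb. -/
theorem Admissible.expect_prod_posFactor_le (h : D.Admissible p Λ θ) (U : Finset (Fin q)) :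
    𝔼 ω, ∏ t ∈ U, D.posFactor t ω ≤ 2 := by
  set γ : ℝ := d ^ 2 * 4 ^ d * θ with hγ
  have hγ0 : 0 ≤ γ := h.defect_const_nonneg
  induction U using Finset.strongInduction with
  | H U ih =>
    have h1 : ∀ ω, ∏ t ∈ U, D.posFactor t ω ≤ ∏ t ∈ U, (D.posFactor t ω - D.defect t ω) +
        ∑ T ∈ U.powerset.erase ∅,
          |1| * (∏ t ∈ T, |D.defect t ω|) * ∏ t ∈ U \ T, D.posFactor t ω := by
      intro ω
      have e1 : ∏ t ∈ U, (D.posFactor t ω - D.defect t ω) =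
          ∑ T ∈ U.powerset, (∏ t ∈ T, -D.defect t ω) * ∏ t ∈ U \ T, D.posFactor t ω := by
        rw [← prod_add]
        exact prod_congr rfl fun t _ => by ring
      rw [e1, ← add_sum_erase _ _ (empty_mem_powerset U), prod_empty, one_mul, sdiff_empty,
        add_assoc, ← sum_add_distrib]
      refine le_add_of_nonneg_right (sum_nonneg fun T _ => ?_)
      rw [abs_one, one_mul, ← add_mul]
      refine mul_nonneg ?_ (h.prod_posFactor_nonneg _ ω)
      have := neg_abs_le (∏ t ∈ T, -D.defect t ω)
      rw [abs_prod] at this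
      simp only [abs_neg] at this
      linarith
    have h2 : ∀ T ∈ U.powerset.erase ∅, 𝔼 ω, |1| * (∏ t ∈ T, |D.defect t ω|) *
        ∏ t ∈ U \ T, D.posFactor t ω ≤ Real.exp 1 * 3 * γ ^ #T := by
      intro T hT
      rw [mem_erase, mem_powerset] at hT
      have h3 := h.expect_abs_mul_prod_defect_le (S := fun _ => 1) (s := 1)
        (momentBound_of_le _ (by simp)) T (U \ T)
      have h4 := ih (U \ T) (sdiff_ssubset hT.2 (nonempty_iff_ne_empty.2 hT.1))
      refine h3.trans ?_
      rw [one_mul, mul_right_comm]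
      refine mul_le_mul_of_nonneg_right (mul_le_mul_of_nonneg_left (by linarith)
        (Real.exp_pos 1).le) (by positivity)
    have h5 := sum_powerset_pow_card_le hγ0 h.defect_le U
    rw [← add_sum_erase _ _ (empty_mem_powerset U), card_empty, pow_zero] at h5
    calc 𝔼 ω, ∏ t ∈ U, D.posFactor t ω
        ≤ 𝔼 ω, (∏ t ∈ U, (D.posFactor t ω - D.defect t ω) + ∑ T ∈ U.powerset.erase ∅,
          |1| * (∏ t ∈ T, |D.defect t ω|) * ∏ t ∈ U \ T, D.posFactor t ω) :=
          expect_le_expect fun ω _ => h1 ω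
      _ = 1 + ∑ T ∈ U.powerset.erase ∅, 𝔼 ω, |1| * (∏ t ∈ T, |D.defect t ω|) *
            ∏ t ∈ U \ T, D.posFactor t ω := by
          rw [expect_add_distrib, expect_prod_factor h.bounds.family, expect_sum_comm]
      _ ≤ 1 + ∑ T ∈ U.powerset.erase ∅, Real.exp 1 * 3 * γ ^ #T :=
          add_le_add le_rfl (sum_le_sum h2)
      _ ≤ 2 := by
          rw [← mul_sum]
          have := Real.exp_one_lt_d9
          have := Real.exp_pos 1
          nlinarith

/-- The signed Riesz product over `U` is bounded in `L¹`, even against an auxiliary factor with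
controlled moments. -/
theorem Admissible.expect_abs_mul_abs_prod_factor_le (h : D.Admissible p Λ θ)
    {S : BitCube d n → ℝ} {s : ℝ} (hS : MomentBound (4 * p) S s) (U : Finset (Fin q)) :
    𝔼 ω, |S ω| * |∏ t ∈ U, (D.posFactor t ω - D.defect t ω)| ≤ 10 * s := by
  set γ : ℝ := d ^ 2 * 4 ^ d * θ with hγ
  have hγ0 : 0 ≤ γ := h.defect_const_nonneg
  have hs := hS.1
  have h5 := sum_powerset_pow_card_le hγ0 h.defect_le U
  calc 𝔼 ω, |S ω| * |∏ t ∈ U, (D.posFactor t ω - D.defect t ω)|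
      ≤ 𝔼 ω, ∑ T ∈ U.powerset, |S ω| * (∏ t ∈ T, |D.defect t ω|) *
          ∏ t ∈ U \ T, D.posFactor t ω := by
        refine expect_le_expect fun ω _ => ?_
        simp only [mul_assoc]
        rw [← mul_sum]
        exact mul_le_mul_of_nonneg_left (abs_prod_factor_le h U ω) (abs_nonneg _)
    _ = ∑ T ∈ U.powerset, 𝔼 ω, |S ω| * (∏ t ∈ T, |D.defect t ω|) *
          ∏ t ∈ U \ T, D.posFactor t ω := expect_sum_comm _ _ _
    _ ≤ ∑ T ∈ U.powerset, Real.exp 1 * 3 * s * γ ^ #T := by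
        refine sum_le_sum fun T _ => (h.expect_abs_mul_prod_defect_le hS T (U \ T)).trans ?_
        have h4 := h.expect_prod_posFactor_le (U \ T)
        have h6 : 0 ≤ Real.exp 1 * (s * γ ^ #T) := by positivity
        nlinarith
    _ ≤ 10 * s := by
        rw [← mul_sum]
        have := Real.exp_one_lt_d9
        have := Real.exp_pos 1
        nlinarith [mul_le_mul_of_nonneg_left h5 (by positivity : 0 ≤ Real.exp 1 * 3 * s)]

end

end RieszData

/-! ### Matchings and sums over matched choices -/

/-- A symmetric and transitive relation between labelled vertices that relates every vertex of `V`
to some other vertex contains a matching that covers a fixed proportion of `V`. -/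
theorem exists_matching {τ ι : Type*} [Fintype τ] [DecidableEq τ] [Fintype ι]
    (R : τ × ι → τ × ι → Prop) (hsymm : ∀ x y, R x y → R y x)
    (htrans : ∀ x y z, R x y → R y z → R x z) (V : Finset τ)
    (hV : ∀ t ∈ V, ∃ t' ∈ V, t' ≠ t ∧ ∃ l l', R (t, l) (t', l')) :
    ∃ (k : ℕ) (a b : Fin k → τ) (la lb : Fin k → ι), Function.Injective (Sum.elim a b) ∧
      (∀ i, a i ∈ V) ∧ (∀ i, b i ∈ V) ∧ (∀ i, R (a i, la i) (b i, lb i)) ∧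
      #V ≤ (2 + 2 * Fintype.card ι) * k := by
  classical
  let P : ℕ → Prop := fun k => ∃ (a b : Fin k → τ) (la lb : Fin k → ι),
    Function.Injective (Sum.elim a b) ∧ (∀ i, a i ∈ V) ∧ (∀ i, b i ∈ V) ∧
      ∀ i, R (a i, la i) (b i, lb i)
  have hP0 : P 0 := ⟨Fin.elim0, Fin.elim0, Fin.elim0, Fin.elim0,
    fun x => x.elim (fun i => i.elim0) fun i => i.elim0, fun i => i.elim0, fun i => i.elim0,
    fun i => i.elim0⟩
  rcases V.eq_empty_or_nonempty with hVe | ⟨t₀, h₀⟩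
  · obtain ⟨a, b, la, lb, h⟩ := hP0
    exact ⟨0, a, b, la, lb, h.1, h.2.1, h.2.2.1, h.2.2.2, by simp [hVe]⟩
  obtain ⟨x₀⟩ : Nonempty (τ × ι) := by
    obtain ⟨t', -, -, l, -⟩ := hV t₀ h₀
    exact ⟨(t₀, l)⟩
  have hbd : ∀ k, P k → k ≤ Fintype.card τ := by
    rintro k ⟨a, b, -, -, hinj, -⟩
    have := Fintype.card_le_of_injective _ hinj
    rw [Fintype.card_sum, Fintype.card_fin] at this
    omega
  obtain ⟨k, hk, hmax⟩ : ∃ k, P k ∧ ¬ P (k + 1) := by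
    refine ⟨Nat.findGreatest P (Fintype.card τ), Nat.findGreatest_spec (Nat.zero_le _) hP0, ?_⟩
    intro h
    have := Nat.le_findGreatest (hbd _ h) h
    omega
  obtain ⟨a, b, la, lb, hinj, ha, hb, hR⟩ := hk
  -- two further vertices cannot be related
  have hext : ∀ t ∈ V, ∀ t' ∈ V, t ∉ Set.range (Sum.elim a b) → t' ∉ Set.range (Sum.elim a b) →
      t ≠ t' → ∀ l l', ¬ R (t, l) (t', l') := by
    intro t ht t' ht' h1 h2 hne l l' hR'
    rw [Set.Sum.elim_range, Set.mem_union, not_or] at h1 h2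
    refine hmax ⟨Fin.cons t a, Fin.cons t' b, Fin.cons l la, Fin.cons l' lb, ?_, ?_, ?_, ?_⟩
    · refine Function.Injective.sumElim ?_ ?_ ?_
      · exact Fin.cons_injective_iff.2 ⟨h1.1, hinj.comp Sum.inl_injective⟩
      · exact Fin.cons_injective_iff.2 ⟨h2.2, hinj.comp Sum.inr_injective⟩
      · intro i j
        refine Fin.cases ?_ (fun i => ?_) i <;> refine Fin.cases ?_ (fun j => ?_) j
        · simpa using hne
        · simpa using fun h => h1.2 ⟨j, h.symm⟩
        · simpa using fun h => h2.1 ⟨i, h⟩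
        · simpa using fun h => by
            have := @hinj (Sum.inl i) (Sum.inr j) h
            cases this
    · exact fun i => Fin.cases ht ha i
    · exact fun i => Fin.cases ht' hb i
    · exact fun i => Fin.cases hR' hR i
  refine ⟨k, a, b, la, lb, hinj, ha, hb, hR, ?_⟩
  let M : Finset τ := univ.image (Sum.elim a b)
  have hM : ∀ t, t ∈ M ↔ t ∈ Set.range (Sum.elim a b) := fun t => by simp [M]
  have hMc : #M = 2 * k := by
    rw [card_image_of_injective _ hinj, card_univ, Fintype.card_sum, Fintype.card_fin]; ring
  have hsel : ∀ t : τ, ∃ x : τ × ι, t ∈ V \ M → x.1 ∈ M ∧ ∃ l, R (t, l) x := by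
    intro t
    by_cases ht : t ∈ V \ M
    · rw [mem_sdiff] at ht
      obtain ⟨t', ht', hne, l, l', hr⟩ := hV t ht.1
      refine ⟨(t', l'), fun _ => ⟨?_, l, hr⟩⟩
      by_contra hn
      exact hext t ht.1 t' ht' (fun h => ht.2 ((hM t).2 h)) (fun h => hn ((hM t').2 h)) hne.symm
        l l' hr
    · exact ⟨x₀, fun h => absurd h ht⟩
  choose x hx using hsel
  have hU : #(V \ M) ≤ #(M ×ˢ (univ : Finset ι)) := by
    refine card_le_card_of_injOn x (fun t ht => ?_) fun t ht t' ht' he => ?_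
    · simpa using (hx t ht).1
    · by_contra hne
      obtain ⟨-, l, h1⟩ := hx t ht
      obtain ⟨-, l', h2⟩ := hx t' ht'
      rw [← he] at h2
      have ht := mem_sdiff.1 ht
      have ht' := mem_sdiff.1 ht'
      exact hext t ht.1 t' ht'.1 (fun h => ht.2 ((hM t).2 h)) (fun h => ht'.2 ((hM t').2 h)) hne
        l l' (htrans _ _ _ h1 (hsymm _ _ h2))
  rw [card_product, hMc, card_univ] at hU
  have h3 : #V ≤ #(V \ M) + #M := by
    rw [card_sdiff_add_card]; exact card_le_card subset_union_left
  rw [hMc] at h3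
  nlinarith

/-- A sum over independent choices at the vertices `τ`, with the choices at `a i` and `b i` matched
by a common label, is a product over the pairs and the remaining vertices. -/
theorem sum_prod_mul_prod_matched {τ σ κ : Type*} [Fintype τ] [DecidableEq τ] [Fintype σ]
    [Fintype κ] [DecidableEq κ] (g : τ → σ → ℝ) {k : ℕ} {a b : Fin k → τ}
    (hinj : Function.Injective (Sum.elim a b)) (x y : Fin k → σ → Option κ) :
    ∑ c : τ → σ, (∏ t, g t (c t)) *
        ∏ i, (if x i (c (a i)) = y i (c (b i)) ∧ x i (c (a i)) ≠ none then (1 : ℝ) else 0) =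
      (∏ i, ∑ u, (∑ s, g (a i) s * if x i s = some u then 1 else 0) *
        ∑ s, g (b i) s * if y i s = some u then 1 else 0) *
        ∏ t ∈ univ \ univ.image (Sum.elim a b), ∑ s, g t s := by
  classical
  have h1 : ∀ i (c : τ → σ),
      (if x i (c (a i)) = y i (c (b i)) ∧ x i (c (a i)) ≠ none then (1 : ℝ) else 0) =
      ∑ u, (if x i (c (a i)) = some u then 1 else 0) * if y i (c (b i)) = some u then 1 else 0 := by
    intro i c
    rcases hx : x i (c (a i)) with _ | v
    · simp
    · simp only [Option.some.injEq, ne_eq, reduceCtorEq, not_false_eq_true, and_true,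
        ite_mul, one_mul, zero_mul, sum_ite_eq, mem_univ, if_true]
      exact if_congr eq_comm rfl rfl
  -- the factor at the vertex `t` for a fixed choice of labels
  let G : (Fin k → κ) → τ → σ → ℝ := fun u t s => g t s *
    ∏ z : Fin k ⊕ Fin k, if Sum.elim a b z = t then
      (Sum.elim (fun i => if x i s = some (u i) then 1 else 0)
        (fun i => if y i s = some (u i) then (1 : ℝ) else 0) z) else 1
  have h2 : ∀ (u : Fin k → κ) (c : τ → σ), (∏ t, g t (c t)) *
      ∏ i, ((if x i (c (a i)) = some (u i) then 1 else 0) *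
        if y i (c (b i)) = some (u i) then (1 : ℝ) else 0) = ∏ t, G u t (c t) := by
    intro u c
    simp only [G]
    symm
    rw [prod_mul_distrib, prod_comm]
    congr 1
    simp only [prod_ite_eq, mem_univ, if_true]
    rw [Fintype.prod_sum_type, ← prod_mul_distrib]
    rfl
  have h3 : ∀ u : Fin k → κ, ∑ c : τ → σ, ∏ t, G u t (c t) = ∏ t, ∑ s, G u t s := by
    intro u
    rw [prod_univ_sum, Fintype.piFinset_univ]
  have h4 : ∀ (u : Fin k → κ) t, t ∉ univ.image (Sum.elim a b) → ∀ s, G u t s = g t s := by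
    intro u t ht s
    simp only [G]
    rw [prod_eq_one, mul_one]
    intro z _
    rw [if_neg]
    rintro rfl
    exact ht (mem_image_of_mem _ (mem_univ z))
  have h5 : ∀ (u : Fin k → κ) z s, G u (Sum.elim a b z) s = g (Sum.elim a b z) s *
      (Sum.elim (fun i => if x i s = some (u i) then 1 else 0)
        (fun i => if y i s = some (u i) then (1 : ℝ) else 0) z) := by
    intro u z s
    simp only [G]
    rw [prod_eq_single z]
    · simp
    · intro z' _ hz'
      rw [if_neg fun h => hz' (hinj h)]
    · simp
  calc ∑ c : τ → σ, (∏ t, g t (c t)) *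
        ∏ i, (if x i (c (a i)) = y i (c (b i)) ∧ x i (c (a i)) ≠ none then (1 : ℝ) else 0)
      = ∑ c : τ → σ, ∑ u : Fin k → κ, ∏ t, G u t (c t) := by
        refine sum_congr rfl fun c _ => ?_
        rw [prod_congr rfl fun i _ => h1 i c, prod_univ_sum, Fintype.piFinset_univ, mul_sum]
        exact sum_congr rfl fun u _ => h2 u c
    _ = ∑ u : Fin k → κ, ∏ t, ∑ s, G u t s := by
        rw [sum_comm]
        exact sum_congr rfl fun u _ => h3 u
    _ = ∑ u : Fin k → κ, (∏ i, (∑ s, g (a i) s * if x i s = some (u i) then 1 else 0) *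
          ∑ s, g (b i) s * if y i s = some (u i) then 1 else 0) *
          ∏ t ∈ univ \ univ.image (Sum.elim a b), ∑ s, g t s := by
        refine sum_congr rfl fun u _ => ?_
        rw [← prod_sdiff (subset_univ (univ.image (Sum.elim a b))), mul_comm]
        congr 1
        · rw [prod_image fun z _ z' _ h => hinj h, Fintype.prod_sum_type, prod_mul_distrib]
          congr 1
          · exact prod_congr rfl fun i _ => sum_congr rfl fun s _ => h5 u (Sum.inl i) s
          · exact prod_congr rfl fun i _ => sum_congr rfl fun s _ => h5 u (Sum.inr i) s
        · exact prod_congr rfl fun t ht => sum_congr rfl fun s _ => h4 u t (mem_sdiff.1 ht).2 s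
    _ = _ := by
        rw [← sum_mul, prod_univ_sum, Fintype.piFinset_univ]

/-- The sign of an optional index, zero if there is none. -/
noncomputable def optSign {κ : Type*} (ε : κ → Bool) : Option κ → ℝ
  | none => 0
  | some u => bitSign (ε u)

theorem abs_optSign_le {κ : Type*} (ε : κ → Bool) (o : Option κ) : |optSign ε o| ≤ 1 := by
  cases o
  · simp [optSign]
  · simp [optSign, abs_bitSign]

theorem expect_optSign_mul {κ : Type*} [Fintype κ] [DecidableEq κ] (o o' : Option κ) :
    𝔼 ε : κ → Bool, optSign ε o * optSign ε o' = if o = o' ∧ o ≠ none then 1 else 0 := by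
  rcases o with _ | u
  · simp [optSign]
  rcases o' with _ | v
  · simp [optSign]
  simp only [optSign, expect_bitSign_mul, Option.some.injEq, ne_eq, reduceCtorEq, not_false_eq_true,
    and_true]

/-! ### The test function and its `L¹` norm -/

namespace RieszData

noncomputable section

variable {d n q : ℕ} (D : RieszData d n q)

/-- The scale in the coordinate `j` of the scale vector in the slot `a`. -/
def slotScale (c : Fin q → FactorState d n) (a : Fin q × Bool) (j : Fin d) :
    Option (Fin (n + 1)) :=
  (slot c a).map fun r => r j

/-- A slot together with a coordinate other than the distinguished one. -/
abbrev FilterIndex : Type := (Fin q × Bool) × {j : Fin d // j ≠ D.o}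

variable {D}

/-- The slots `i.1` and `b` are occupied by scale vectors that agree in the coordinate `i.2`. -/
def Coincide (c : Fin q → FactorState d n) (i : D.FilterIndex) (b : Fin q × Bool) : Prop :=
  slotScale c i.1 i.2 = slotScale c b i.2 ∧ slotScale c i.1 i.2 ≠ none

instance (c : Fin q → FactorState d n) (i : D.FilterIndex) (b : Fin q × Bool) :
    Decidable (Coincide c i b) := inferInstanceAs (Decidable (_ ∧ _))

variable (D)

/-- A factor that vanishes on the choices with a coincidence between different factors of the Riesz
product, and is one on the choices without coincidence. It takes other values only where the weights
vanish. -/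
def coincidenceFilter (c : Fin q → FactorState d n) : ℝ :=
  ∏ i : D.FilterIndex, (1 - ∑ b, if b.1 < i.1.1 ∧ Coincide c i b then 1 else 0)

/-- The Riesz product, restricted by the filter to the choices without coincidences. -/
def testFun (ω : BitCube d n) : ℝ :=
  ∑ c : Fin q → FactorState d n, (∏ t, D.weight t (c t)) * D.coincidenceFilter c *
    ∏ a, D.optFun (slot c a) ω

variable {D}

/-- The sign of the term of the expanded filter that selects the coincidences `φ`. -/
def filterCoeff (φ : D.FilterIndex → Option (Fin q × Bool)) : ℝ :=
  ∏ i, (φ i).elim 1 fun b => if b.1 < i.1.1 then -1 else 0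

/-- The indicator that all coincidences selected by `φ` take place. -/
def filterInd (φ : D.FilterIndex → Option (Fin q × Bool)) (c : Fin q → FactorState d n) : ℝ :=
  ∏ i, (φ i).elim 1 fun b => if Coincide c i b then 1 else 0

/-- The part of the Riesz product on which all coincidences selected by `φ` take place. -/
def coincidentPart (φ : D.FilterIndex → Option (Fin q × Bool)) (ω : BitCube d n) : ℝ :=
  ∑ c : Fin q → FactorState d n, (∏ t, D.weight t (c t)) * filterInd φ c *
    ∏ a, D.optFun (slot c a) ω

theorem coincidenceFilter_eq (c : Fin q → FactorState d n) :
    D.coincidenceFilter c =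
      ∑ φ : D.FilterIndex → Option (Fin q × Bool), filterCoeff φ * filterInd φ c := by
  have h : ∀ i : D.FilterIndex, 1 - (∑ b, if b.1 < i.1.1 ∧ Coincide c i b then (1 : ℝ) else 0) =
      ∑ o : Option (Fin q × Bool), (o.elim 1 fun b => if b.1 < i.1.1 then -1 else 0) *
        o.elim 1 fun b => if Coincide c i b then 1 else 0 := by
    intro i
    rw [Fintype.sum_option, sub_eq_add_neg, ← sum_neg_distrib]
    simp only [Option.elim_none, Option.elim_some, mul_one]
    congr 1
    refine sum_congr rfl fun b _ => ?_
    rw [ite_and]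
    split_ifs <;> simp
  unfold coincidenceFilter
  rw [prod_congr rfl fun i _ => h i, prod_univ_sum, Fintype.piFinset_univ]
  refine sum_congr rfl fun φ _ => ?_
  rw [prod_mul_distrib]
  rfl

theorem testFun_eq (ω : BitCube d n) :
    D.testFun ω = ∑ φ : D.FilterIndex → Option (Fin q × Bool),
      filterCoeff φ * coincidentPart φ ω := by
  unfold testFun coincidentPart
  simp only [coincidenceFilter_eq, mul_sum, sum_mul]
  rw [sum_comm]
  exact sum_congr rfl fun φ _ => sum_congr rfl fun c _ => by ring

theorem abs_filterCoeff_le (φ : D.FilterIndex → Option (Fin q × Bool)) : |filterCoeff φ| ≤ 1 := by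
  unfold filterCoeff
  rw [abs_prod]
  refine prod_le_one (fun _ _ => abs_nonneg _) fun i _ => ?_
  rcases φ i with _ | b
  · simp
  · simp only [Option.elim_some]
    split_ifs <;> simp

theorem filterInd_ne_zero {φ : D.FilterIndex → Option (Fin q × Bool)}
    {c : Fin q → FactorState d n} (h : filterInd φ c ≠ 0) {i : D.FilterIndex} {b : Fin q × Bool}
    (hb : φ i = some b) : Coincide c i b := by
  by_contra hn
  exact h (prod_eq_zero (mem_univ i) (by simp [hb, hn]))

/-- The signs attached to the slot `a` when the coincidences selected by `φ` are encoded by random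
signs `ε`. -/
def slotSign (φ : D.FilterIndex → Option (Fin q × Bool)) (ε : D.FilterIndex → Fin (n + 1) → Bool)
    (a : Fin q × Bool) (o : Option (ScaleVec d n)) : ℝ :=
  ∏ i, (if (φ i).isSome ∧ i.1 = a then optSign (ε i) (o.map fun r => r i.2) else 1) *
    if φ i = some a then optSign (ε i) (o.map fun r => r i.2) else 1

theorem abs_slotSign_le (φ : D.FilterIndex → Option (Fin q × Bool))
    (ε : D.FilterIndex → Fin (n + 1) → Bool) (a : Fin q × Bool) (o : Option (ScaleVec d n)) :
    |slotSign φ ε a o| ≤ 1 := by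
  unfold slotSign
  rw [abs_prod]
  refine prod_le_one (fun _ _ => abs_nonneg _) fun i _ => ?_
  rw [abs_mul]
  refine mul_le_one₀ ?_ (abs_nonneg _) ?_
  · split_ifs
    · exact abs_optSign_le _ _
    · simp
  · split_ifs
    · exact abs_optSign_le _ _
    · simp

theorem filterInd_eq_expect (φ : D.FilterIndex → Option (Fin q × Bool))
    (c : Fin q → FactorState d n) :
    filterInd φ c = 𝔼 ε : D.FilterIndex → Fin (n + 1) → Bool, ∏ a, slotSign φ ε a (slot c a) := by
  have h1 : ∀ ε : D.FilterIndex → Fin (n + 1) → Bool, ∏ a, slotSign φ ε a (slot c a) =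
      ∏ i, (φ i).elim 1 fun b =>
        optSign (ε i) (slotScale c i.1 i.2) * optSign (ε i) (slotScale c b i.2) := by
    intro ε
    unfold slotSign
    rw [prod_comm]
    refine prod_congr rfl fun i _ => ?_
    rw [prod_mul_distrib]
    rcases φ i with _ | b
    · simp
    · simp only [Option.isSome_some, true_and, Option.some.injEq, prod_ite_eq, mem_univ, if_true,
        Option.elim_some]
      rfl
  simp only [h1]
  rw [expect_pi_prod (fun i (w : Fin (n + 1) → Bool) => (φ i).elim 1 fun b =>
        optSign w (slotScale c i.1 i.2) * optSign w (slotScale c b i.2))]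
  unfold filterInd
  refine prod_congr rfl fun i _ => ?_
  rcases φ i with _ | b
  · simp only [Option.elim_none]
    exact (expect_const_univ 1).symm
  · simp only [Option.elim_some]
    rw [expect_optSign_mul]
    exact if_congr Iff.rfl rfl rfl

/-- The factors that take part in the coincidences selected by `φ`. -/
def touched (φ : D.FilterIndex → Option (Fin q × Bool)) : Finset (Fin q) :=
  univ.filter fun t => ∃ i b, φ i = some b ∧ (i.1.1 = t ∨ b.1 = t)

theorem slotSign_of_notMem_touched {φ : D.FilterIndex → Option (Fin q × Bool)}
    (ε : D.FilterIndex → Fin (n + 1) → Bool) {t : Fin q} (ht : t ∉ touched φ) (e : Bool)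
    (o : Option (ScaleVec d n)) : slotSign φ ε (t, e) o = 1 := by
  simp only [touched, mem_filter, mem_univ, true_and, not_exists, not_and, not_or] at ht
  refine prod_eq_one fun i _ => ?_
  rw [if_neg, if_neg, one_mul]
  · intro h
    exact (ht i _ h).2 rfl
  · rintro ⟨h, he⟩
    obtain ⟨b, hb⟩ := Option.isSome_iff_exists.1 h
    exact (ht i b hb).1 (by rw [he])

/-- The coincidences selected by `φ` contain a matching of a fixed proportion of the factors that
take part in them. -/
theorem exists_matching_touched (φ : D.FilterIndex → Option (Fin q × Bool))
    (hφ : ∀ i b, φ i = some b → b.1 < i.1.1) :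
    ∃ (k : ℕ) (a b : Fin k → Fin q) (la lb : Fin k → Bool) (j : Fin k → {j : Fin d // j ≠ D.o}),
      Function.Injective (Sum.elim a b) ∧ (∀ i, a i ∈ touched φ) ∧ (∀ i, b i ∈ touched φ) ∧
      (∀ i c, filterInd φ c ≠ 0 → slotScale c (a i, la i) (j i) = slotScale c (b i, lb i) (j i) ∧
        slotScale c (a i, la i) (j i) ≠ none) ∧
      #(touched φ) ≤ 4 * d * k := by
  obtain ⟨k, a, b, la, lb, h1, h2, h3, h4, h5⟩ := exists_matching
    (τ := Fin q) (ι := Bool × {j : Fin d // j ≠ D.o})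
    (fun x y => x.2.2 = y.2.2 ∧ ∀ c, filterInd φ c ≠ 0 →
      slotScale c (x.1, x.2.1) x.2.2 = slotScale c (y.1, y.2.1) y.2.2 ∧
        slotScale c (x.1, x.2.1) x.2.2 ≠ none)
    (fun x y h => ⟨h.1.symm, fun c hc => ⟨(h.2 c hc).1.symm, (h.2 c hc).1 ▸ (h.2 c hc).2⟩⟩)
    (fun x y z h h' => ⟨h.1.trans h'.1, fun c hc =>
      ⟨(h.2 c hc).1.trans (h'.2 c hc).1, (h.2 c hc).2⟩⟩) (touched φ) (by
      intro t ht
      have ht' := ht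
      simp only [touched, mem_filter, mem_univ, true_and] at ht'
      obtain ⟨i, b, hb, h⟩ := ht'
      have hne := hφ i b hb
      have hi : i.1.1 ∈ touched φ := by
        simp only [touched, mem_filter, mem_univ, true_and]
        exact ⟨i, b, hb, Or.inl rfl⟩
      have hbt : b.1 ∈ touched φ := by
        simp only [touched, mem_filter, mem_univ, true_and]
        exact ⟨i, b, hb, Or.inr rfl⟩
      rcases h with rfl | rfl
      · exact ⟨b.1, hbt, hne.ne, (i.1.2, i.2), (b.2, i.2), rfl,
          fun c hc => filterInd_ne_zero hc hb⟩
      · refine ⟨i.1.1, hi, hne.ne', (b.2, i.2), (i.1.2, i.2), rfl, fun c hc => ?_⟩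
        have := filterInd_ne_zero hc hb
        exact ⟨this.1.symm, this.1 ▸ this.2⟩)
  refine ⟨k, a, b, fun i => (la i).1, fun i => (lb i).1, fun i => (la i).2, h1, h2, h3,
    fun i c hc => ?_, h5.trans (Nat.mul_le_mul_right _ ?_)⟩
  · have := (h4 i).2 c hc
    rw [← (h4 i).1] at this
    exact this
  · have : Fintype.card {j : Fin d // j ≠ D.o} < Fintype.card (Fin d) :=
      Fintype.card_subtype_lt (x := D.o) (by simp)
    rw [Fintype.card_fin] at this
    rw [Fintype.card_prod, Fintype.card_bool]
    omega

/-- A pattern of coincidences is not much larger than the set of the factors involved. -/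
theorem card_isSome_le (φ : D.FilterIndex → Option (Fin q × Bool)) :
    #(univ.filter fun i => (φ i).isSome) ≤ #(touched φ) * (2 * d) := by
  have h : #(univ.filter fun i => (φ i).isSome) ≤
      #(touched φ ×ˢ (univ : Finset (Bool × {j : Fin d // j ≠ D.o}))) := by
    refine card_le_card_of_injOn (fun i => (i.1.1, i.1.2, i.2)) (fun i hi => ?_) ?_
    · obtain ⟨b, hb⟩ := Option.isSome_iff_exists.1 (mem_filter.1 hi).2
      simp only [touched, coe_product, coe_univ, Set.mem_prod, Set.mem_univ, and_true, mem_coe,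
        mem_filter, mem_univ, true_and]
      exact ⟨i, b, hb, Or.inl rfl⟩
    · rintro ⟨⟨t, e⟩, j⟩ _ ⟨⟨t', e'⟩, j'⟩ _ h
      simp only [Prod.mk.injEq] at h
      obtain ⟨rfl, rfl, rfl⟩ := h
      rfl
  refine h.trans ?_
  rw [card_product, card_univ, Fintype.card_prod, Fintype.card_bool]
  have := Fintype.card_subtype_le (fun j : Fin d => j ≠ D.o)
  rw [Fintype.card_fin] at this
  exact Nat.mul_le_mul_left _ (Nat.mul_le_mul_left _ this)

/-- The part of the Riesz product with prescribed coincidences, written with the linked pairs of a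
matching, the remaining touched factors and the untouched factors. -/
theorem coincidentPart_eq {φ : D.FilterIndex → Option (Fin q × Bool)} {k : ℕ}
    {a b : Fin k → Fin q} {la lb : Fin k → Bool} {j : Fin k → {j : Fin d // j ≠ D.o}}
    (hinj : Function.Injective (Sum.elim a b)) (ha : ∀ i, a i ∈ touched φ)
    (hb : ∀ i, b i ∈ touched φ)
    (hab : ∀ i c, filterInd φ c ≠ 0 →
      slotScale c (a i, la i) (j i) = slotScale c (b i, lb i) (j i) ∧
        slotScale c (a i, la i) (j i) ≠ none) (ω : BitCube d n) :
    coincidentPart φ ω = 𝔼 ε : D.FilterIndex → Fin (n + 1) → Bool,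
      ((∏ i, ∑ u, D.slotSum (a i) (la i) (j i) u
          (slotSign φ ε (a i, false)) (slotSign φ ε (a i, true)) ω *
        D.slotSum (b i) (lb i) (j i) u
          (slotSign φ ε (b i, false)) (slotSign φ ε (b i, true)) ω) *
        ∏ t ∈ touched φ \ univ.image (Sum.elim a b),
          D.vertexSum t (slotSign φ ε (t, false)) (slotSign φ ε (t, true)) ω) *
      ∏ t ∈ univ \ touched φ, (D.posFactor t ω - D.defect t ω) := by
  let x : Fin k → FactorState d n → Option (Fin (n + 1)) := fun i st =>
    (bif la i then st.2 else st.1).map fun r => r (j i)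
  let y : Fin k → FactorState d n → Option (Fin (n + 1)) := fun i st =>
    (bif lb i then st.2 else st.1).map fun r => r (j i)
  let g : (D.FilterIndex → Fin (n + 1) → Bool) → Fin q → FactorState d n → ℝ := fun ε t st =>
    D.weight t st * (slotSign φ ε (t, false) st.1 * slotSign φ ε (t, true) st.2) *
      (D.optFun st.1 ω * D.optFun st.2 ω)
  have h1 : ∀ c : Fin q → FactorState d n, (∏ t, D.weight t (c t)) * filterInd φ c *
      (∏ a, D.optFun (slot c a) ω) = 𝔼 ε, (∏ t, g ε t (c t)) *
        ∏ i, (if x i (c (a i)) = y i (c (b i)) ∧ x i (c (a i)) ≠ none then (1 : ℝ) else 0) := by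
    intro c
    have e1 : filterInd φ c = filterInd φ c *
        ∏ i, (if x i (c (a i)) = y i (c (b i)) ∧ x i (c (a i)) ≠ none then (1 : ℝ) else 0) := by
      by_cases h0 : filterInd φ c = 0
      · rw [h0, zero_mul]
      · rw [prod_eq_one, mul_one]
        exact fun i _ => if_pos (hab i c h0)
    rw [e1, filterInd_eq_expect, expect_mul, mul_expect, expect_mul]
    refine expect_congr rfl fun ε _ => ?_
    have e2 : ∏ t, g ε t (c t) = (∏ t, D.weight t (c t)) * (∏ a, slotSign φ ε a (slot c a)) *
        ∏ a, D.optFun (slot c a) ω := by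
      simp only [g]
      rw [prod_mul_distrib, prod_mul_distrib, prod_optFun_slot,
        Fintype.prod_prod_type (fun a => slotSign φ ε a (slot c a))]
      congr 2
      refine prod_congr rfl fun t _ => ?_
      rw [Fintype.prod_bool, mul_comm]
      rfl
    rw [e2]
    ring
  unfold coincidentPart
  rw [sum_congr rfl fun c _ => h1 c, ← expect_sum_comm]
  refine expect_congr rfl fun ε _ => ?_
  rw [sum_prod_mul_prod_matched (g ε) hinj x y, mul_assoc]
  have hslot : ∀ (t : Fin q) (e : Bool) (j : Fin d) (u : Fin (n + 1)),
      ∑ st, g ε t st * (if (bif e then st.2 else st.1).map (fun r => r j) = some u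
        then (1 : ℝ) else 0) =
      D.slotSum t e j u (slotSign φ ε (t, false)) (slotSign φ ε (t, true)) ω := by
    intro t e j u
    cases e <;> simp only [slotSum, cond_true, cond_false, vertexSum, g, restrict] <;>
      refine sum_congr rfl fun st _ => ?_ <;> split_ifs <;> ring
  congr 1
  · refine prod_congr rfl fun i _ => sum_congr rfl fun u _ => ?_
    rw [← hslot (a i), ← hslot (b i)]
  · have hM : univ.image (Sum.elim a b) ⊆ touched φ := by
      intro t ht
      obtain ⟨z, -, rfl⟩ := mem_image.1 ht
      rcases z with i | i
      · exact ha i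
      · exact hb i
    have hU : (univ \ univ.image (Sum.elim a b) : Finset (Fin q)) =
        (touched φ \ univ.image (Sum.elim a b)) ∪ (univ \ touched φ) := by
      ext t
      simp only [mem_sdiff, mem_univ, true_and, mem_union]
      have := @hM t
      tauto
    rw [hU, prod_union (disjoint_left.2 fun t h h' => (mem_sdiff.1 h').2 (mem_sdiff.1 h).1)]
    congr 1
    refine prod_congr rfl fun t ht => ?_
    rw [← D.sum_weight_eq]
    refine sum_congr rfl fun st _ => ?_
    simp only [g, slotSign_of_notMem_touched ε (mem_sdiff.1 ht).2, mul_one]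

variable {p : ℕ} {Λ θ : ℝ}

theorem Admissible.expect_abs_coincidentPart_le (h : D.Admissible p Λ θ)
    {φ : D.FilterIndex → Option (Fin q × Bool)} (hφ : ∀ i b, φ i = some b → b.1 < i.1.1)
    {β : ℝ} (hβ0 : 0 ≤ β) (hβ1 : β ≤ 1)
    (hlink : 4 * 16 ^ d * θ * Λ ^ 2 * (4 ^ (d + 1) * Λ ^ 2) ^ (4 * d) ≤ β ^ (8 * d ^ 2)) :
    𝔼 ω, |coincidentPart φ ω| ≤ 10 * β ^ #(univ.filter fun i => (φ i).isSome) := by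
  have hp := h.order_ne_zero
  have hΛ := h.bounds.one_le
  have hθ := h.bounds.theta_nonneg
  obtain ⟨k, a, b, la, lb, j, hinj, ha, hb, hab, hV⟩ := exists_matching_touched φ hφ
  set M := univ.image (Sum.elim a b) with hMdef
  have hM : M ⊆ touched φ := by
    intro t ht
    obtain ⟨z, -, rfl⟩ := mem_image.1 ht
    rcases z with i | i
    · exact ha i
    · exact hb i
  have hMc : #M = 2 * k := by
    rw [card_image_of_injective _ hinj, card_univ, Fintype.card_sum, Fintype.card_fin]; ring
  have hcard : #(touched φ \ M) + #M = #(touched φ) := card_sdiff_add_card_eq_card hM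
  have hVq : #(touched φ) ≤ q := by simpa using card_le_univ (touched φ)
  let S : (D.FilterIndex → Fin (n + 1) → Bool) → BitCube d n → ℝ := fun ε ω =>
    (∏ i, ∑ u, D.slotSum (a i) (la i) (j i) u
        (slotSign φ ε (a i, false)) (slotSign φ ε (a i, true)) ω *
      D.slotSum (b i) (lb i) (j i) u
        (slotSign φ ε (b i, false)) (slotSign φ ε (b i, true)) ω) *
      ∏ t ∈ touched φ \ M, D.vertexSum t (slotSign φ ε (t, false)) (slotSign φ ε (t, true)) ω
  set θ' : ℝ := 4 * 16 ^ d * θ * Λ ^ 2 with hθ'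
  set x : ℝ := 4 ^ (d + 1) * Λ ^ 2 with hx
  have hθ'0 : 0 ≤ θ' := by positivity
  have hx1 : 1 ≤ x := by
    have h1 : (1 : ℝ) ≤ 4 ^ (d + 1) := one_le_pow₀ (by norm_num)
    have h2 : (1 : ℝ) ≤ Λ ^ 2 := one_le_pow₀ hΛ
    exact one_le_mul_of_one_le_of_one_le h1 h2
  have hS : ∀ ε, MomentBound (4 * p) (S ε) (θ' ^ k * x ^ #(touched φ \ M)) := by
    intro ε
    have key := MomentBound.prod (p := 4 * p) (v := q)
      ((univ : Finset (Fin k)).disjSum (touched φ \ M))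
      (F := Sum.elim (fun i ω => ∑ u, D.slotSum (a i) (la i) (j i) u
        (slotSign φ ε (a i, false)) (slotSign φ ε (a i, true)) ω *
          D.slotSum (b i) (lb i) (j i) u
        (slotSign φ ε (b i, false)) (slotSign φ ε (b i, true)) ω)
        (fun t => D.vertexSum t (slotSign φ ε (t, false)) (slotSign φ ε (t, true))))
      (A := Sum.elim (fun _ => θ') (fun _ => x)) (by omega)
      (by rw [card_disjSum, card_univ, Fintype.card_fin]; omega) (by
        intro z hz
        have hq : q ≠ 0 := by
          rintro rfl
          rcases z with i | t
          · exact (a i).elim0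
          · exact t.elim0
        have hpq : 4 * p * q ≠ 0 := Nat.mul_ne_zero (by omega) hq
        rcases z with i | t
        · refine Bounds.momentBound_linked (h.bounds.exponent_le (le_of_eq (by ring))) hpq ?_ _ _
            (j i).2 (abs_slotSign_le φ ε _) (abs_slotSign_le φ ε _) (abs_slotSign_le φ ε _)
            (abs_slotSign_le φ ε _)
          intro he
          have := @hinj (Sum.inl i) (Sum.inr i) he
          cases this
        · refine Bounds.momentBound_vertexSum (h.bounds.exponent_le ?_) hpq t
            (abs_slotSign_le φ ε _) (abs_slotSign_le φ ε _)
          calc 2 * (4 * p * q) = 8 * p * q := by ring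
            _ ≤ 12 * p * q := Nat.mul_le_mul_right _ (by omega))
    simpa [prod_disjSum] using key
  have hs : θ' ^ k * x ^ #(touched φ \ M) ≤ β ^ #(univ.filter fun i => (φ i).isSome) := by
    have h1 : #(univ.filter fun i => (φ i).isSome) ≤ 8 * d ^ 2 * k := by
      calc _ ≤ #(touched φ) * (2 * d) := card_isSome_le φ
        _ ≤ 4 * d * k * (2 * d) := Nat.mul_le_mul_right _ hV
        _ = 8 * d ^ 2 * k := by ring
    calc θ' ^ k * x ^ #(touched φ \ M) ≤ θ' ^ k * x ^ (4 * d * k) := by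
          refine mul_le_mul_of_nonneg_left (pow_le_pow_right₀ hx1 ?_) (by positivity)
          omega
      _ = (θ' * x ^ (4 * d)) ^ k := by rw [mul_pow θ', ← pow_mul]
      _ ≤ (β ^ (8 * d ^ 2)) ^ k := pow_le_pow_left₀ (by positivity) hlink k
      _ = β ^ (8 * d ^ 2 * k) := (pow_mul _ _ _).symm
      _ ≤ _ := pow_le_pow_of_le_one hβ0 hβ1 h1
  have hT : ∀ ω, coincidentPart φ ω = 𝔼 ε, S ε ω *
      ∏ t ∈ univ \ touched φ, (D.posFactor t ω - D.defect t ω) :=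
    coincidentPart_eq hinj ha hb hab
  calc 𝔼 ω, |coincidentPart φ ω|
      ≤ 𝔼 ω, 𝔼 ε, |S ε ω| * |∏ t ∈ univ \ touched φ, (D.posFactor t ω - D.defect t ω)| := by
        refine expect_le_expect fun ω _ => ?_
        rw [hT]
        refine (abs_expect_le _ _).trans (le_of_eq (expect_congr rfl fun ε _ => abs_mul _ _))
    _ = 𝔼 ε, 𝔼 ω, |S ε ω| * |∏ t ∈ univ \ touched φ, (D.posFactor t ω - D.defect t ω)| :=
        expect_comm _ _ _
    _ ≤ 𝔼 _ε : D.FilterIndex → Fin (n + 1) → Bool, 10 * (θ' ^ k * x ^ #(touched φ \ M)) :=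
        expect_le_expect fun ε _ => h.expect_abs_mul_abs_prod_factor_le (hS ε) _
    _ = 10 * (θ' ^ k * x ^ #(touched φ \ M)) := expect_const_univ _
    _ ≤ _ := by linarith

/-- The test function is bounded in `L¹` by an absolute constant. -/
theorem Admissible.expect_abs_testFun_le (h : D.Admissible p Λ θ) (hd : d ≠ 0) (hq : q ≠ 0)
    (hlink : 4 * 16 ^ d * θ * Λ ^ 2 * (4 ^ (d + 1) * Λ ^ 2) ^ (4 * d) ≤
      (1 / (4 * d * q ^ 2)) ^ (8 * d ^ 2)) :
    𝔼 ω, |D.testFun ω| ≤ 28 := by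
  have hd1 : (1 : ℝ) ≤ d := by exact_mod_cast Nat.one_le_iff_ne_zero.2 hd
  have hq1 : (1 : ℝ) ≤ q := by exact_mod_cast Nat.one_le_iff_ne_zero.2 hq
  set β : ℝ := 1 / (4 * d * q ^ 2) with hβ
  have hβ0 : 0 ≤ β := by positivity
  have hβ1 : β ≤ 1 := by
    rw [hβ, div_le_one (by positivity)]
    nlinarith [one_le_pow₀ hq1 (n := 2)]
  have hφ : ∀ φ : D.FilterIndex → Option (Fin q × Bool), 𝔼 ω, |filterCoeff φ * coincidentPart φ ω|
      ≤ 10 * β ^ #(univ.filter fun i => (φ i).isSome) := by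
    intro φ
    by_cases hb : ∀ i b, φ i = some b → b.1 < i.1.1
    · refine le_trans (expect_le_expect fun ω _ => ?_)
        (h.expect_abs_coincidentPart_le hb hβ0 hβ1 hlink)
      rw [abs_mul]
      exact mul_le_of_le_one_left (abs_nonneg _) (abs_filterCoeff_le φ)
    · push Not at hb
      obtain ⟨i, b, hi, hle⟩ := hb
      have h0 : filterCoeff φ = 0 :=
        prod_eq_zero (mem_univ i) (by simp [hi, not_lt.2 hle])
      simp only [h0, zero_mul, abs_zero, expect_const_zero]
      positivity
  have hsum : ∑ φ : D.FilterIndex → Option (Fin q × Bool),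
      β ^ #(univ.filter fun i => (φ i).isSome) ≤ Real.exp 1 := by
    have e1 : ∀ φ : D.FilterIndex → Option (Fin q × Bool),
        β ^ #(univ.filter fun i => (φ i).isSome) = ∏ i, if (φ i).isSome then β else 1 := by
      intro φ
      rw [prod_ite, prod_const, prod_const_one, mul_one]
    have e2 : ∑ o : Option (Fin q × Bool), (if o.isSome then β else 1) = 1 + 2 * q * β := by
      rw [Fintype.sum_option]
      simp only [Option.isSome_none, Option.isSome_some, if_true, Bool.false_eq_true, if_false,
        sum_const, card_univ, Fintype.card_prod, Fintype.card_fin, Fintype.card_bool, nsmul_eq_mul]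
      push_cast
      ring
    rw [sum_congr rfl fun φ _ => e1 φ]
    have e3 : ∑ φ : D.FilterIndex → Option (Fin q × Bool), ∏ i, (if (φ i).isSome then β else 1) =
        (1 + 2 * q * β) ^ Fintype.card D.FilterIndex := by
      rw [← e2, ← card_univ, ← prod_const, prod_univ_sum, Fintype.piFinset_univ]
    rw [e3]
    have hc : Fintype.card D.FilterIndex ≤ q * 2 * d := by
      rw [Fintype.card_prod, Fintype.card_prod, Fintype.card_bool, Fintype.card_fin]
      have := Fintype.card_subtype_le (fun j : Fin d => j ≠ D.o)
      rw [Fintype.card_fin] at this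
      exact Nat.mul_le_mul_left _ this
    have hx : 1 ≤ 1 + 2 * q * β := by
      have : 0 ≤ 2 * q * β := by positivity
      linarith
    calc (1 + 2 * q * β) ^ Fintype.card D.FilterIndex ≤ (1 + 2 * q * β) ^ (q * 2 * d) :=
          pow_le_pow_right₀ hx hc
      _ ≤ (Real.exp (2 * q * β)) ^ (q * 2 * d) := by
          refine pow_le_pow_left₀ (by linarith) ?_ _
          rw [add_comm]
          exact Real.add_one_le_exp _
      _ = Real.exp 1 := by
          rw [← Real.exp_nat_mul]
          congr 1
          rw [hβ]
          push_cast
          field_simp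
          norm_num
  calc 𝔼 ω, |D.testFun ω|
      ≤ 𝔼 ω, ∑ φ : D.FilterIndex → Option (Fin q × Bool),
          |filterCoeff φ * coincidentPart φ ω| := by
        refine expect_le_expect fun ω _ => ?_
        rw [testFun_eq]
        exact abs_sum_le_sum_abs _ _
    _ = ∑ φ : D.FilterIndex → Option (Fin q × Bool), 𝔼 ω,
          |filterCoeff φ * coincidentPart φ ω| := expect_sum_comm _ _ _
    _ ≤ ∑ φ : D.FilterIndex → Option (Fin q × Bool),
          10 * β ^ #(univ.filter fun i => (φ i).isSome) := sum_le_sum fun φ _ => hφ φ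
    _ ≤ 10 * Real.exp 1 := by
        rw [← mul_sum]
        exact mul_le_mul_of_nonneg_left hsum (by norm_num)
    _ ≤ 28 := by
        have := Real.exp_one_lt_d9
        linarith

end

end RieszData

/-! ### The test function against Haar functions of large rectangles -/

namespace RieszData

noncomputable section

variable {d n q : ℕ} {D : RieszData d n q}

theorem slotScale_eq_some {c : Fin q → FactorState d n} {a : Fin q × Bool} {r : ScaleVec d n}
    (h : slot c a = some r) (j : Fin d) : slotScale c a j = some (r j) := by
  rw [slotScale, h, Option.map_some]

/-- Two slots of the same factor do not coincide. -/
theorem eq_of_slotScale_eq {c : Fin q → FactorState d n} {t : Fin q} (h : D.weight t (c t) ≠ 0)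
    {e e' : Bool} {j : Fin d} (h1 : slotScale c (t, e) j = slotScale c (t, e') j)
    (h2 : slotScale c (t, e) j ≠ none) : e = e' := by
  have key : ∀ {e e' : Bool}, e = true → e' = false →
      slotScale c (t, e) j = slotScale c (t, e') j → slotScale c (t, e) j ≠ none → False := by
    rintro _ _ rfl rfl h1 h2
    rcases hs : slot c (t, true) with _ | s
    · exact h2 (by rw [slotScale, hs, Option.map_none])
    · obtain ⟨r, hr, hne⟩ := exists_slot_false h hs
      rw [slotScale_eq_some hs, slotScale_eq_some hr, Option.some.injEq] at h1
      exact hne j h1.symm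
  cases e <;> cases e'
  · rfl
  · exact (key rfl rfl h1.symm (h1 ▸ h2)).elim
  · exact (key rfl rfl h1 h2).elim
  · rfl

/-- On the choices that survive the filter, the scale vectors differ in every coordinate. The first
factor with an earlier coincidence has exactly one such coincidence, so its filter factor is
`1 - 1`. -/
theorem ne_of_coincidenceFilter_ne_zero {c : Fin q → FactorState d n}
    (hw : ∀ t, D.weight t (c t) ≠ 0) (hc : D.coincidenceFilter c ≠ 0) {a b : Fin q × Bool}
    {r s : ScaleVec d n} (ha : slot c a = some r) (hb : slot c b = some s) (hab : a ≠ b)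
    (m : Fin d) : r m ≠ s m := by
  intro hm
  by_cases hmo : m = D.o
  · subst hmo
    exact hab (slot_coord_injective hw ha hb hm)
  let P : Fin q → Prop := fun t => ∃ e b', b'.1 < t ∧ Coincide (D := D) c ((t, e), ⟨m, hmo⟩) b'
  have hP : ∃ t, P t := by
    have hne : a.1 ≠ b.1 := by
      intro h1
      obtain ⟨t, e⟩ := a
      obtain ⟨t', e'⟩ := b
      simp only at h1
      subst h1
      refine hab (Prod.ext rfl (eq_of_slotScale_eq (j := m) (hw t) ?_ ?_))
      · rw [slotScale_eq_some ha, slotScale_eq_some hb, hm]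
      · rw [slotScale_eq_some ha]; simp
    rcases lt_or_gt_of_ne hne with h | h
    · refine ⟨b.1, b.2, a, h, ?_, ?_⟩
      · simp only [Prod.mk.eta]
        rw [slotScale_eq_some ha, slotScale_eq_some hb, hm]
      · simp only [Prod.mk.eta]
        rw [slotScale_eq_some hb]; simp
    · refine ⟨a.1, a.2, b, h, ?_, ?_⟩
      · simp only [Prod.mk.eta]
        rw [slotScale_eq_some ha, slotScale_eq_some hb, hm]
      · simp only [Prod.mk.eta]
        rw [slotScale_eq_some ha]; simp
  obtain ⟨t, ⟨e, b', hb't, hco⟩, hmin⟩ := WellFounded.has_min (wellFounded_lt (α := Fin q))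
    {t | P t} hP
  refine hc (prod_eq_zero (mem_univ (((t, e), ⟨m, hmo⟩) : D.FilterIndex)) ?_)
  rw [sum_eq_single b', if_pos ⟨hb't, hco⟩, sub_self]
  · intro b'' _ hne
    rw [if_neg]
    rintro ⟨h1, h2⟩
    have h3 : slotScale c b' m = slotScale c b'' m := hco.1.symm.trans h2.1
    have h4 : slotScale c b' m ≠ none := by
      have := hco.2
      rwa [hco.1] at this
    rcases lt_trichotomy b'.1 b''.1 with hlt | heq | hlt
    · exact hmin b''.1 ⟨b''.2, b', hlt, h3.symm, h3 ▸ h4⟩ h1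
    · obtain ⟨t₁, e₁⟩ := b'
      obtain ⟨t₂, e₂⟩ := b''
      simp only at heq
      subst heq
      exact hne (Prod.ext rfl (eq_of_slotScale_eq (hw _) h3 h4).symm)
    · exact hmin b'.1 ⟨b'.2, b'', hlt, h3, h4⟩ hb't
  · simp

/-- Against a function with scales `k`, where `2 ^ {-∑ k} ≥ 2 ^ {-n}`, only the linear part of the
test function counts. A product of two or more of its terms has largest scales that add up to more
than `n`. -/
theorem expect_testFun_mul_of_isScaleAt (hf : IsRFamily D.f) {h : BitCube d n → ℝ}
    {k : ScaleVec d n} (hk : ∑ m, (k m : ℕ) ≤ n) (hh : ∀ m, IsScaleAt m (k m) h) :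
    𝔼 ω, D.testFun ω * h ω = D.ρ * ∑ r ∈ hyperbolic d n, 𝔼 ω, D.f r ω * h ω := by
  let single : ScaleVec d n → Fin q → FactorState d n := fun r =>
    Function.update (fun _ => (none, none)) (D.β (r D.o)) (some r, none)
  have hslot : ∀ r a, slot (single r) a = if a = (D.β (r D.o), false) then some r else none := by
    rintro r ⟨t, e⟩
    by_cases ht : t = D.β (r D.o)
    · subst ht
      cases e <;> simp [slot, single]
    · have : (t, e) ≠ (D.β (r D.o), false) := fun h => ht (congrArg Prod.fst h)
      rw [if_neg this]
      cases e <;> simp [slot, single, ht]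
  unfold testFun
  simp only [sum_mul]
  rw [expect_sum_comm, mul_sum]
  symm
  refine sum_of_injOn single ?_ (fun _ _ => mem_coe.2 (mem_univ _)) ?_ ?_
  · intro r _ r' _ he
    have h1 := hslot r (D.β (r D.o), false)
    rw [he, hslot] at h1
    simp only [if_true] at h1
    split_ifs at h1 with h2
    exact (Option.some.inj h1).symm
  · intro c _ hc
    simp only [mul_assoc]
    rw [← mul_expect, ← mul_expect]
    by_contra hne
    rw [← mul_assoc] at hne
    have hE := right_ne_zero_of_mul hne
    have hF := right_ne_zero_of_mul (left_ne_zero_of_mul hne)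
    have hw : ∀ t, D.weight t (c t) ≠ 0 := fun t h0 =>
      left_ne_zero_of_mul (left_ne_zero_of_mul hne) (prod_eq_zero (mem_univ t) h0)
    by_cases hex : ∃ a r, slot c a = some r
    · have hle : ∀ m b s, slot c b = some s → s m ≤ k m := by
        intro m
        obtain ⟨a, r, har, hmax, hs⟩ := exists_isScaleAt_prod hf m (fun a b r s ha hb hrs => by
          by_contra hab
          exact ne_of_coincidenceFilter_ne_zero hw hF ha hb hab m hrs) hex
        have hrk : r m = k m := by
          by_contra hrk
          rcases lt_or_gt_of_ne hrk with hlt | hlt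
          · refine hE ?_
            have := (hh m).mul_of_invariant (G := fun ω => ∏ a, D.optFun (slot c a) ω)
              fun k' hk' => hs.2 k' (hlt.trans_le hk')
            have h0 := expect_eq_zero_of_flipBit m (k m)
              (f := fun ω => h ω * ∏ a, D.optFun (slot c a) ω) this.1
            rw [← h0]
            exact expect_congr rfl fun ω _ => mul_comm _ _
          · exact hE (expect_eq_zero_of_flipBit m (r m)
              (hs.mul_of_invariant fun k' hk' => (hh m).2 k' (hlt.trans_le hk')).1)
        exact fun b s hb => (hmax b s hb).trans_eq hrk
      have heq : ∀ b s, slot c b = some s → s = k := by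
        intro b s hb
        have h1 := (D.mem_block.1 (mem_block_of_slot (hw b.1) (e := b.2) hb)).1
        rw [mem_hyperbolic] at h1
        have h2 := (sum_eq_sum_iff_of_le (s := univ) fun m _ =>
          (Fin.le_def.1 (hle m b s hb))).1 (le_antisymm
            (sum_le_sum fun m _ => Fin.le_def.1 (hle m b s hb)) (hk.trans_eq h1.symm))
        exact funext fun m => Fin.ext (h2 m (mem_univ m))
      have huniq : ∀ a b r s, slot c a = some r → slot c b = some s → a = b := by
        intro a b r s ha hb
        by_contra hab
        have := ne_of_coincidenceFilter_ne_zero hw hF ha hb hab D.o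
        rw [heq a r ha, heq b s hb] at this
        exact this rfl
      obtain ⟨⟨t, e⟩, r, har⟩ := hex
      have hrk := heq _ r har
      subst hrk
      have hb := D.mem_block.1 (mem_block_of_slot (hw t) har)
      have he : e = false := by
        cases e
        · rfl
        · obtain ⟨r', hr', -⟩ := exists_slot_false (hw t) har
          have := huniq _ _ _ _ har hr'
          cases this
      subst he
      have hcs : c = single r := by
        have h1 : ∀ a, slot c a = slot (single r) a := by
          intro a
          rw [hslot, hb.2]
          split_ifs with ha
          · rw [ha, har]
          · exact Option.eq_none_iff_forall_ne_some.2 fun s hs => ha (huniq _ _ _ _ hs har)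
        funext t'
        exact Prod.ext (h1 (t', false)) (h1 (t', true))
      exact hc ⟨r, mem_coe.2 hb.1, hcs.symm⟩
    · push Not at hex
      refine hE ?_
      have h1 : ∀ a, slot c a = none := fun a => Option.eq_none_iff_forall_ne_some.2 (hex a)
      simp only [h1, optFun, prod_const_one, one_mul]
      exact expect_eq_zero_of_flipBit D.o (k D.o) (hh D.o).1
  · intro r hr
    have hw : ∏ t, D.weight t (single r t) = D.ρ := by
      rw [prod_eq_single (D.β (r D.o))]
      · have hb : r ∈ D.block (D.β (r D.o)) := D.mem_block.2 ⟨mem_coe.1 hr, rfl⟩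
        simp [single, weight, hb]
      · intro t _ ht
        simp [single, ht, weight]
      · simp
    have hF : D.coincidenceFilter (single r) = 1 := by
      refine prod_eq_one fun i _ => ?_
      rw [sum_eq_zero, sub_zero]
      intro b _
      rw [if_neg]
      rintro ⟨h1, h2, h3⟩
      have hp : ∀ a j, slotScale (single r) a j ≠ none → a = (D.β (r D.o), false) := by
        intro a j ha
        by_contra hne
        rw [slotScale, hslot, if_neg hne] at ha
        exact ha rfl
      have e1 := hp _ _ h3
      have e2 := hp b i.2 (h2 ▸ h3)
      rw [e1, e2] at h1
      exact lt_irrefl _ h1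
    have hO : ∀ ω, ∏ a, D.optFun (slot (single r) a) ω = D.f r ω := by
      intro ω
      rw [prod_eq_single (D.β (r D.o), false)]
      · rw [hslot, if_pos rfl]; rfl
      · intro a _ ha
        rw [hslot, if_neg ha]; rfl
      · simp
    rw [hw, hF, mul_expect]
    refine expect_congr rfl fun ω _ => ?_
    rw [hO]
    ring

/-- Duality with the test function: the `r`-functions are bounded against any combination of Haar
functions of rectangles of volume at least `2 ^ {-n}`. -/
theorem Admissible.expect_sum_mul_le {p : ℕ} {Λ θ : ℝ} (h : D.Admissible p Λ θ) (hd : d ≠ 0)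
    (hq : q ≠ 0) (hlink : 4 * 16 ^ d * θ * Λ ^ 2 * (4 ^ (d + 1) * Λ ^ 2) ^ (4 * d) ≤
      (1 / (4 * d * q ^ 2)) ^ (8 * d ^ 2)) {ι : Type*} (s : Finset ι) {g : ι → BitCube d n → ℝ}
    {k : ι → ScaleVec d n} (hk : ∀ i ∈ s, ∑ m, (k i m : ℕ) ≤ n)
    (hg : ∀ i ∈ s, ∀ m, IsScaleAt m (k i m) (g i)) {K : ℝ} (hK : ∀ ω, |∑ i ∈ s, g i ω| ≤ K) :
    D.ρ * 𝔼 ω, (∑ r ∈ hyperbolic d n, D.f r ω) * ∑ i ∈ s, g i ω ≤ 28 * K := by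
  have h1 : D.ρ * 𝔼 ω, (∑ r ∈ hyperbolic d n, D.f r ω) * ∑ i ∈ s, g i ω =
      𝔼 ω, D.testFun ω * ∑ i ∈ s, g i ω := by
    simp only [mul_sum (s := s)]
    rw [expect_sum_comm, expect_sum_comm, mul_sum]
    refine sum_congr rfl fun i hi => ?_
    rw [expect_testFun_mul_of_isScaleAt h.bounds.family (hk i hi) (hg i hi)]
    congr 1
    simp only [sum_mul]
    rw [expect_sum_comm]
  have hK0 : 0 ≤ K := (abs_nonneg _).trans (hK fun _ _ => false)
  rw [h1]
  calc 𝔼 ω, D.testFun ω * ∑ i ∈ s, g i ω ≤ 𝔼 ω, |D.testFun ω| * K := by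
        refine expect_le_expect fun ω _ => ?_
        refine (le_abs_self _).trans ?_
        rw [abs_mul]
        exact mul_le_mul_of_nonneg_left (hK ω) (abs_nonneg _)
    _ = (𝔼 ω, |D.testFun ω|) * K := (expect_mul _ _ _).symm
    _ ≤ 28 * K := mul_le_mul_of_nonneg_right (h.expect_abs_testFun_le hd hq hlink) hK0

end

end RieszData

/-! ### The choice of the parameters -/

theorem card_filter_mod_le {n q : ℕ} (hqn : q ≤ n + 1) (t : ℕ) :
    (#(univ.filter fun k : Fin (n + 1) => (k : ℕ) % q = t) : ℝ) * q ≤ 2 * (n + 1) := by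
  have h1 : #(univ.filter fun k : Fin (n + 1) => (k : ℕ) % q = t) ≤ #(range (n / q + 1)) := by
    refine card_le_card_of_injOn (fun k => (k : ℕ) / q) (fun k _ => ?_) fun k hk k' hk' he => ?_
    · simp only [coe_range, Set.mem_Iio]
      exact Nat.lt_succ_of_le (Nat.div_le_div_right (Nat.le_of_lt_succ k.2))
    · have e1 := (mem_filter.1 hk).2
      have e2 := (mem_filter.1 hk').2
      apply Fin.ext
      rw [← Nat.div_add_mod (k : ℕ) q, ← Nat.div_add_mod (k' : ℕ) q, e1, e2]
      simp only at he
      rw [he]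
  rw [card_range] at h1
  have h2 : (n / q + 1) * q ≤ 2 * (n + 1) := by
    have := Nat.div_mul_le_self n q
    rw [add_mul]
    omega
  have h3 : #(univ.filter fun k : Fin (n + 1) => (k : ℕ) % q = t) * q ≤ 2 * (n + 1) :=
    (Nat.mul_le_mul_right q h1).trans h2
  exact_mod_cast h3

/-- The size of the linear parts is subexponential in `q`. -/
theorem one_add_pow_le_exp {d q : ℕ}
    (h : 2 * 48 ^ d * (2 ^ (3 * d + 1) * ((3 * d + 1).factorial : ℝ)) ≤ q) (hq : 1 ≤ q) :
    1 + (48 * (q : ℝ) ^ 3) ^ d ≤ Real.exp (q / 2) := by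
  have hq1 : (1 : ℝ) ≤ q := by exact_mod_cast hq
  have hf : (0 : ℝ) < (3 * d + 1).factorial := by exact_mod_cast Nat.factorial_pos _
  have h1 := Real.pow_div_factorial_le_exp ((q : ℝ) / 2) (by positivity) (3 * d + 1)
  refine le_trans ?_ h1
  have h2 : 1 + (48 * (q : ℝ) ^ 3) ^ d ≤ 2 * 48 ^ d * q ^ (3 * d) := by
    have : (1 : ℝ) ≤ (48 * (q : ℝ) ^ 3) ^ d :=
      one_le_pow₀ (by nlinarith [one_le_pow₀ hq1 (n := 3)])
    have e : (48 * (q : ℝ) ^ 3) ^ d = 48 ^ d * q ^ (3 * d) := by rw [mul_pow, ← pow_mul]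
    rw [e] at this ⊢
    linarith
  refine h2.trans ?_
  rw [div_pow, div_div, le_div_iff₀ (by positivity)]
  calc 2 * 48 ^ d * (q : ℝ) ^ (3 * d) * (2 ^ (3 * d + 1) * ((3 * d + 1).factorial : ℝ))
      = (2 * 48 ^ d * (2 ^ (3 * d + 1) * ((3 * d + 1).factorial : ℝ))) * q ^ (3 * d) := by ring
    _ ≤ q * q ^ (3 * d) := mul_le_mul_of_nonneg_right h (by positivity)
    _ = q ^ (3 * d + 1) := by ring

/-- The gain of a linked pair beats the number of coincidence patterns: the powers of `Q` on the two
sides add up to less than `100 d²`. -/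
theorem linked_le {d : ℕ} (hd : 3 ≤ d) {Q y : ℝ} (hQ : 1 ≤ Q) (hy : Q ^ (100 * d ^ 2) ≤ y)
    (hc : 4 * 16 ^ d * 96 * 108 ^ (d + 1) * (48 ^ d) ^ 2 *
      (4 ^ (d + 1) * (48 ^ d) ^ 2) ^ (4 * d) * (4 * d) ^ (8 * d ^ 2) ≤ Q) :
    4 * 16 ^ d * (96 * Q * (108 * Q ^ 3) ^ (d + 1) / y) * ((48 * Q ^ 3) ^ d) ^ 2 *
      (4 ^ (d + 1) * ((48 * Q ^ 3) ^ d) ^ 2) ^ (4 * d) ≤ (1 / (4 * d * Q ^ 2)) ^ (8 * d ^ 2) := by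
  have hd0 : (0 : ℝ) < d := by exact_mod_cast (by omega : 0 < d)
  have hy0 : 0 < y := lt_of_lt_of_le (by positivity) hy
  rw [div_pow, one_pow, le_div_iff₀ (by positivity), mul_div_assoc', div_mul_eq_mul_div,
    div_mul_eq_mul_div, div_mul_eq_mul_div, div_le_one hy0]
  set c : ℝ := 4 * 16 ^ d * 96 * 108 ^ (d + 1) * (48 ^ d) ^ 2 *
      (4 ^ (d + 1) * (48 ^ d) ^ 2) ^ (4 * d) * (4 * d) ^ (8 * d ^ 2) with hcdef
  have e1 : (108 * Q ^ 3) ^ (d + 1) = 108 ^ (d + 1) * Q ^ (3 * (d + 1)) := by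
    rw [mul_pow, ← pow_mul]
  have e2 : ((48 * Q ^ 3) ^ d) ^ 2 = (48 ^ d) ^ 2 * Q ^ (6 * d) := by
    rw [mul_pow, mul_pow, ← pow_mul Q, ← pow_mul Q]
    congr 2
    ring
  have e3 : (4 * (d : ℝ) * Q ^ 2) ^ (8 * d ^ 2) = (4 * d) ^ (8 * d ^ 2) * Q ^ (16 * d ^ 2) := by
    rw [mul_pow, ← pow_mul]
    congr 2
    ring
  have e4 : (4 ^ (d + 1) * ((48 ^ d) ^ 2 * Q ^ (6 * d))) ^ (4 * d) =
      (4 ^ (d + 1) * (48 ^ d) ^ 2) ^ (4 * d) * Q ^ (24 * d ^ 2) := by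
    rw [← mul_assoc, mul_pow _ (Q ^ (6 * d)), ← pow_mul Q]
    congr 2
    ring
  rw [e1, e2, e3, e4]
  have e5 : 4 * 16 ^ d * (96 * Q * (108 ^ (d + 1) * Q ^ (3 * (d + 1)))) *
      ((48 ^ d) ^ 2 * Q ^ (6 * d)) * ((4 ^ (d + 1) * (48 ^ d) ^ 2) ^ (4 * d) * Q ^ (24 * d ^ 2)) *
      ((4 * (d : ℝ)) ^ (8 * d ^ 2) * Q ^ (16 * d ^ 2)) =
      c * Q ^ (1 + 3 * (d + 1) + 6 * d + 24 * d ^ 2 + 16 * d ^ 2) := by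
    rw [hcdef, pow_add Q, pow_add Q, pow_add Q, pow_add Q, pow_one]
    generalize Q ^ (3 * (d + 1)) = a1
    generalize Q ^ (6 * d) = a2
    generalize Q ^ (24 * d ^ 2) = a3
    generalize Q ^ (16 * d ^ 2) = a4
    generalize ((4 : ℝ) ^ (d + 1) * (48 ^ d) ^ 2) ^ (4 * d) = a5
    generalize (4 * (d : ℝ)) ^ (8 * d ^ 2) = a6
    ring
  rw [e5]
  calc c * Q ^ (1 + 3 * (d + 1) + 6 * d + 24 * d ^ 2 + 16 * d ^ 2)
      ≤ Q * Q ^ (1 + 3 * (d + 1) + 6 * d + 24 * d ^ 2 + 16 * d ^ 2) :=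
        mul_le_mul_of_nonneg_right hc (by positivity)
    _ = Q ^ (1 + 3 * (d + 1) + 6 * d + 24 * d ^ 2 + 16 * d ^ 2 + 1) := by ring
    _ ≤ Q ^ (100 * d ^ 2) := pow_le_pow_right₀ hQ (by nlinarith)
    _ ≤ y := hy

/-- The defects of `Q` factors add up to a small constant. -/
theorem defect_const_le {d : ℕ} (hd : 3 ≤ d) {Q y : ℝ} (hQ : 1 ≤ Q) (hy : Q ^ (100 * d ^ 2) ≤ y)
    (hc : 20 * (d ^ 2 * 4 ^ d * 96 * 108 ^ (d + 1)) ≤ Q) :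
    Q * (d ^ 2 * 4 ^ d * (96 * Q * (108 * Q ^ 3) ^ (d + 1) / y)) ≤ 1 / 20 := by
  have hy0 : 0 < y := lt_of_lt_of_le (by positivity) hy
  rw [mul_div_assoc', mul_div_assoc', div_le_div_iff₀ hy0 (by norm_num), one_mul, mul_pow,
    ← pow_mul]
  calc Q * (d ^ 2 * 4 ^ d * (96 * Q * (108 ^ (d + 1) * Q ^ (3 * (d + 1))))) * 20
      = 20 * (d ^ 2 * 4 ^ d * 96 * 108 ^ (d + 1)) * (Q ^ 2 * Q ^ (3 * (d + 1))) := by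
        generalize Q ^ (3 * (d + 1)) = a1
        ring
    _ ≤ Q * (Q ^ 2 * Q ^ (3 * (d + 1))) := mul_le_mul_of_nonneg_right hc (by positivity)
    _ = Q ^ (3 + 3 * (d + 1)) := by rw [pow_add]; ring
    _ ≤ Q ^ (100 * d ^ 2) := pow_le_pow_right₀ hQ (by nlinarith)
    _ ≤ y := hy

namespace RieszData

/-- Once `q` is large in terms of `d`, and `n` is a large power of `q`, the Riesz product with `q`
factors is admissible for every family of signed `r`-functions. -/
theorem exists_admissible (d : ℕ) (hd : 3 ≤ d) :
    ∃ q₀ : ℕ, ∀ q ≥ q₀, ∀ n : ℕ, (q : ℝ) ^ (800 * d ^ 2) ≤ n + 1 →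
      ∀ f : ScaleVec d n → BitCube d n → ℝ, IsRFamily f → (∀ r ω, f r ω ^ 2 = 1) →
      ∃ (D : RieszData d n q) (p : ℕ) (Λ θ : ℝ), D.f = f ∧
        D.ρ = √(q / (2 * (n + 1) ^ (d - 1))) ∧ q ≠ 0 ∧ D.Admissible p Λ θ ∧
        4 * 16 ^ d * θ * Λ ^ 2 * (4 ^ (d + 1) * Λ ^ 2) ^ (4 * d) ≤
          (1 / (4 * d * q ^ 2)) ^ (8 * d ^ 2) := by
  let c₁ : ℝ := 4 * 16 ^ d * 96 * 108 ^ (d + 1) * (48 ^ d) ^ 2 *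
      (4 ^ (d + 1) * (48 ^ d) ^ 2) ^ (4 * d) * (4 * d) ^ (8 * d ^ 2)
  let c₂ : ℝ := 20 * (d ^ 2 * 4 ^ d * 96 * 108 ^ (d + 1))
  let c₃ : ℝ := 2 * 48 ^ d * (2 ^ (3 * d + 1) * ((3 * d + 1).factorial : ℝ))
  refine ⟨⌈c₁⌉₊ + ⌈c₂⌉₊ + ⌈c₃⌉₊ + 1, fun q hq n hn f hf hsq => ?_⟩
  have hle : ∀ {c : ℝ} {k : ℕ}, ⌈c⌉₊ ≤ k → c ≤ k := fun h => Nat.ceil_le.1 h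
  have hc₁ : c₁ ≤ q := hle (by omega)
  have hc₂ : c₂ ≤ q := hle (by omega)
  have hc₃ : c₃ ≤ q := hle (by omega)
  have hq1 : 1 ≤ q := by omega
  have hq0 : q ≠ 0 := by omega
  have hQ : (1 : ℝ) ≤ q := by exact_mod_cast hq1
  have hn0 : (0 : ℝ) < n + 1 := by positivity
  obtain ⟨y, hy0, hyn⟩ : ∃ y : ℝ, 0 < y ∧ y ^ 8 = n + 1 := by
    refine ⟨((n : ℝ) + 1) ^ ((1 : ℝ) / 8), Real.rpow_pos_of_pos hn0 _, ?_⟩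
    rw [← Real.rpow_natCast, ← Real.rpow_mul hn0.le]
    norm_num
  have hyQ : (q : ℝ) ^ (100 * d ^ 2) ≤ y := by
    refine (pow_le_pow_iff_left₀ (by positivity) hy0.le (n := 8) (by norm_num)).1 ?_
    rw [hyn, ← pow_mul, show 100 * d ^ 2 * 8 = 800 * d ^ 2 by ring]
    exact hn
  have hy1 : 1 ≤ y := (one_le_pow₀ hQ).trans hyQ
  have hqn : q ≤ n + 1 := by
    have : (q : ℝ) ≤ q ^ (800 * d ^ 2) := le_self_pow₀ hQ (by positivity)
    exact_mod_cast this.trans hn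
  obtain ⟨L, hL, hLy⟩ : ∃ L : ℕ, n < 2 ^ L ∧ (L : ℝ) ≤ 16 * y := by
    refine ⟨⌈y⌉₊ * 8, ?_, ?_⟩
    · have h1 : (n : ℝ) + 1 ≤ (⌈y⌉₊ : ℝ) ^ 8 := by
        rw [← hyn]
        exact pow_le_pow_left₀ hy0.le (Nat.le_ceil y) 8
      have h2 : n + 1 ≤ ⌈y⌉₊ ^ 8 := by exact_mod_cast h1
      rw [pow_mul]
      exact (Nat.lt_of_succ_le h2).trans_le (Nat.pow_le_pow_left Nat.lt_two_pow_self.le 8)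
    · have := (Nat.ceil_lt_add_one hy0.le).le
      push_cast
      linarith
  let D : RieszData d n q :=
    { f := f
      o := ⟨0, by omega⟩
      β := fun k => ⟨(k : ℕ) % q, Nat.mod_lt _ (by omega)⟩
      ρ := √(q / (2 * (n + 1) ^ (d - 1))) }
  have hρ : D.ρ ^ 2 = q / (2 * (n + 1) ^ (d - 1)) := Real.sq_sqrt (by positivity)
  have hblock : ∀ t, D.ρ ^ 2 * #(D.block t) ≤ 1 := by
    intro t
    have h1 := card_hyperbolic_filter_le (n := n) (o := D.o) (l := (⟨1, by omega⟩ : Fin d))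
      (by simp [D]) (univ.filter fun k : Fin (n + 1) => (k : ℕ) % q = t)
    have h2 : D.block t = {r ∈ hyperbolic d n |
        r D.o ∈ univ.filter fun k : Fin (n + 1) => (k : ℕ) % q = t} := by
      unfold block
      refine filter_congr fun r _ => ?_
      simp [D, Fin.ext_iff]
    rw [← h2] at h1
    have h3 := card_filter_mod_le hqn t
    have h4 : (#(D.block t) : ℝ) ≤
        #(univ.filter fun k : Fin (n + 1) => (k : ℕ) % q = t) * (n + 1) ^ (d - 2) := by
      exact_mod_cast h1
    rw [hρ, div_mul_eq_mul_div, div_le_one (by positivity)]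
    calc (q : ℝ) * #(D.block t)
        ≤ q * (#(univ.filter fun k : Fin (n + 1) => (k : ℕ) % q = t) * (n + 1) ^ (d - 2)) :=
          mul_le_mul_of_nonneg_left h4 (by positivity)
      _ = #(univ.filter fun k : Fin (n + 1) => (k : ℕ) % q = t) * q * (n + 1) ^ (d - 2) := by ring
      _ ≤ 2 * (n + 1) * (n + 1) ^ (d - 2) := mul_le_mul_of_nonneg_right h3 (by positivity)
      _ = 2 * (n + 1) ^ (d - 1) := by
          rw [mul_assoc, ← pow_succ', show d - 2 + 1 = d - 1 by omega]
  set P : ℕ := 12 * q ^ 2 * q with hP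
  have hP0 : P ≠ 0 := by positivity
  have hPr : (P : ℝ) = 12 * q ^ 3 := by rw [hP]; push_cast; ring
  have hx1 : (1 : ℝ) ≤ (48 * (q : ℝ) ^ 3) ^ d :=
    one_le_pow₀ (by nlinarith [one_le_pow₀ hQ (n := 3)])
  -- the order `p = q²` makes `exp p` dominate the second moment of the Riesz product
  refine ⟨D, q ^ 2, (48 * (q : ℝ) ^ 3) ^ d, 96 * q * (108 * (q : ℝ) ^ 3) ^ (d + 1) / y,
    rfl, rfl, hq0,
    { bounds :=
        { family := hf
          one_le := hx1
          theta_nonneg := by positivity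
          linear := fun z hz t => ?_
          coincidence := fun z z' hz hz' i j hij => ?_ }
      order_ne_zero := by positivity
      sq_eq_one := hsq
      block_le := hblock
      exp_le := ?_
      defect_le := defect_const_le hd hQ hyQ hc₂ }, linked_le hd hQ hyQ hc₁⟩
  · have h1 := ((momentBound_sq_sum (hf.mul hz) hP0 (D.block t)).of_sq.exponent_le
      (show P ≤ 2 * P by omega)).const_mul D.ρ
    refine h1.mono ?_
    rw [← Real.sqrt_sq_eq_abs, ← Real.sqrt_mul (sq_nonneg _), Real.sqrt_le_iff]
    refine ⟨by positivity, ?_⟩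
    have e : (4 * (P : ℝ)) ^ d = (48 * (q : ℝ) ^ 3) ^ d := by rw [hPr]; ring_nf
    rw [e]
    set X := (48 * (q : ℝ) ^ 3) ^ d
    have := hblock t
    nlinarith
  · obtain ⟨l, hl⟩ : ∃ l : Fin d, l ∉ ({i, j} : Finset (Fin d)) := by
      by_contra hno
      push Not at hno
      have h1 : #(univ : Finset (Fin d)) ≤ #({i, j} : Finset (Fin d)) :=
        card_le_card fun l _ => hno l
      have h2 := card_le_two (a := i) (b := j)
      rw [card_univ, Fintype.card_fin] at h1
      omega
    simp only [mem_insert, mem_singleton, not_or] at hl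
    have h1 := ((momentBound_coincidenceSum (hf.mul hz) (hf.mul hz') hP0 hij (Ne.symm hl.1)
      (Ne.symm hl.2) hL hy0.le hyn).exponent_le (show P ≤ 2 * P by omega)).const_mul (D.ρ ^ 2)
    refine h1.mono ?_
    rw [abs_of_nonneg (sq_nonneg _), hρ, ← hyn, ← pow_mul, hPr,
      show 8 * (d - 1) = 8 * d - 10 + 2 by omega, pow_add y,
      show (9 : ℝ) * (12 * q ^ 3) = 108 * q ^ 3 by ring]
    set X := (108 * (q : ℝ) ^ 3) ^ (d + 1)
    set Y := y ^ (8 * d - 10)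
    have hY : 0 < Y := by positivity
    have hX : 0 < X := by positivity
    have e : (q : ℝ) / (2 * (Y * y ^ 2)) * (2 * L * (6 * X * Y)) = 6 * q * X * L / y ^ 2 := by
      field_simp
    rw [e, div_le_div_iff₀ (by positivity) hy0]
    calc 6 * q * X * L * y ≤ 6 * q * X * (16 * y) * y := by gcongr
      _ = 96 * q * X * y ^ 2 := by ring
  · calc (1 + (48 * (q : ℝ) ^ 3) ^ d) ^ (2 * q) ≤ (Real.exp (q / 2)) ^ (2 * q) :=
          pow_le_pow_left₀ (by positivity) (one_add_pow_le_exp hc₃ hq1) _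
      _ = Real.exp ((q ^ 2 : ℕ) : ℝ) := by
          rw [← Real.exp_nat_mul]
          congr 1
          push_cast
          ring

end RieszData

/-! ### Haar functions on the dyadic grid -/

section Digits

variable {n : ℕ}

/-- The `k`-th digit, zero beyond the last one. -/
def digit (b : Fin (n + 1) → Bool) (k : ℕ) : Bool := if h : k < n + 1 then b ⟨k, h⟩ else false

theorem digit_val (b : Fin (n + 1) → Bool) (k : Fin (n + 1)) : digit b k = b k := by
  unfold digit
  rw [dif_pos k.2]

/-- The number with the first `k` digits: the position of the dyadic interval of length `2 ^ {-k}`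
that contains the point with digits `b`. -/
def prefixInt (b : Fin (n + 1) → Bool) : ℕ → ℤ
  | 0 => 0
  | k + 1 => 2 * prefixInt b k + if digit b k then 1 else 0

theorem prefixInt_congr {b b' : Fin (n + 1) → Bool} {k : ℕ}
    (h : ∀ i : Fin (n + 1), (i : ℕ) < k → b i = b' i) : prefixInt b k = prefixInt b' k := by
  induction k with
  | zero => rfl
  | succ k ih =>
    have hd : digit b k = digit b' k := by
      unfold digit
      split_ifs with hk
      · exact h ⟨k, hk⟩ (Nat.lt_succ_self k)
      · rfl
    rw [prefixInt, prefixInt, ih fun i hi => h i (hi.trans (Nat.lt_succ_self k)), hd]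

theorem prefixInt_nonneg (b : Fin (n + 1) → Bool) (k : ℕ) : 0 ≤ prefixInt b k := by
  induction k with
  | zero => exact le_rfl
  | succ k ih => rw [prefixInt]; split_ifs <;> omega

theorem prefixInt_lt (b : Fin (n + 1) → Bool) (k : ℕ) : prefixInt b k < 2 ^ k := by
  induction k with
  | zero => simp [prefixInt]
  | succ k ih => rw [prefixInt, pow_succ]; split_ifs <;> omega

/-- The dyadic interval of length `2 ^ {-k}` of the points with the first `k` digits of `b`. -/
def prefixInterval (b : Fin (n + 1) → Bool) (k : ℕ) : DyadicInterval := ⟨-(k : ℤ), prefixInt b k⟩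

theorem DyadicInterval.mem_toSet_iff_of_mem {I J : DyadicInterval} (hs : I.scale = J.scale) {x : ℝ}
    (hx : x ∈ J.toSet) : x ∈ I.toSet ↔ I.pos = J.pos := by
  unfold DyadicInterval.toSet at *
  rw [hs]
  have hpos : (0 : ℝ) < 2 ^ J.scale := zpow_pos two_pos _
  constructor
  · intro hy
    have h1 : (I.pos : ℝ) < J.pos + 1 := lt_of_mul_lt_mul_right (hy.1.trans_lt hx.2) hpos.le
    have h2 : (J.pos : ℝ) < I.pos + 1 := lt_of_mul_lt_mul_right (hx.1.trans_lt hy.2) hpos.le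
    have h3 : I.pos < J.pos + 1 := by exact_mod_cast h1
    have h4 : J.pos < I.pos + 1 := by exact_mod_cast h2
    omega
  · intro h
    rw [h]
    exact hx

theorem prefixInterval_succ_subset (b : Fin (n + 1) → Bool) (k : ℕ) :
    (prefixInterval b (k + 1)).toSet ⊆ (prefixInterval b k).toSet := by
  intro x hx
  simp only [prefixInterval, DyadicInterval.toSet, prefixInt, Set.mem_Ico] at hx ⊢
  have e : (2 : ℝ) ^ (-(k : ℤ)) = 2 * 2 ^ (-((k + 1 : ℕ) : ℤ)) := by
    rw [← zpow_one_add₀ two_ne_zero]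
    congr 1
    push_cast
    ring
  have hpos : (0 : ℝ) < 2 ^ (-((k + 1 : ℕ) : ℤ)) := zpow_pos two_pos _
  rw [e]
  obtain ⟨h1, h2⟩ := hx
  split_ifs at h1 h2 <;> push_cast at h1 h2 hpos ⊢ <;> constructor <;> nlinarith

theorem prefixInterval_antitone (b : Fin (n + 1) → Bool) :
    Antitone fun k => (prefixInterval b k).toSet :=
  antitone_nat_of_succ_le fun k => prefixInterval_succ_subset b k

theorem haar_eq_of_mem_prefixInterval {b : Fin (n + 1) → Bool} {x : ℝ}
    (hx : x ∈ (prefixInterval b (n + 1)).toSet) {I : DyadicInterval} {k : Fin (n + 1)}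
    (hI : I.scale = -((k : ℕ) : ℤ)) :
    I.haar x = if prefixInt b k = I.pos then bitSign (b k) else 0 := by
  have hk : x ∈ (prefixInterval b (k + 1)).toSet :=
    prefixInterval_antitone b (Nat.succ_le_of_lt k.2) hx
  have h1 := DyadicInterval.mem_toSet_iff_of_mem (I := I.left) (by
    simp only [DyadicInterval.left, prefixInterval, hI]; push_cast; ring) hk
  have h2 := DyadicInterval.mem_toSet_iff_of_mem (I := I.right) (by
    simp only [DyadicInterval.right, prefixInterval, hI]; push_cast; ring) hk
  have e : (prefixInterval b (k + 1)).pos = 2 * prefixInt b k + if b k then 1 else 0 := by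
    simp only [prefixInterval, prefixInt, digit_val]
  rw [e, show I.left.pos = 2 * I.pos from rfl] at h1
  rw [e, show I.right.pos = 2 * I.pos + 1 from rfl] at h2
  unfold DyadicInterval.haar
  classical
  rw [Set.indicator_apply, Set.indicator_apply]
  rw [if_congr h1 rfl rfl, if_congr h2 rfl rfl]
  cases b k <;> simp only [bitSign, if_true, Bool.false_eq_true, if_false, Pi.one_apply]
  · have h3 : (2 * I.pos = 2 * prefixInt b k + 0) ↔ prefixInt b k = I.pos := by omega
    have h4 : ¬ (2 * I.pos + 1 = 2 * prefixInt b k + 0) := by omega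
    rw [if_congr h3 rfl rfl, if_neg h4]
    split_ifs <;> simp
  · have h3 : ¬ (2 * I.pos = 2 * prefixInt b k + 1) := by omega
    have h4 : (2 * I.pos + 1 = 2 * prefixInt b k + 1) ↔ prefixInt b k = I.pos := by omega
    rw [if_neg h3, if_congr h4 rfl rfl]
    split_ifs <;> simp

/-- A dyadic interval of length `2 ^ {-k}` has probability `2 ^ {-k}`. -/
theorem expect_prefixInt_eq {k : ℕ} (hk : k ≤ n + 1) {j : ℤ} (h0 : 0 ≤ j) (hj : j < 2 ^ k) :
    𝔼 b : Fin (n + 1) → Bool, (if prefixInt b k = j then (1 : ℝ) else 0) = ((2 : ℝ) ^ k)⁻¹ := by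
  induction k generalizing j with
  | zero =>
    have : j = 0 := by rw [pow_zero] at hj; omega
    subst this
    simp only [prefixInt, if_true, pow_zero, inv_one]
    exact expect_const_univ 1
  | succ k ih =>
    let i : Fin (n + 1) := ⟨k, hk⟩
    have hinv : Function.Involutive fun b : Fin (n + 1) → Bool => Function.update b i (!b i) := by
      intro b; simp
    have hflip : 𝔼 b : Fin (n + 1) → Bool,
        (if prefixInt (Function.update b i (!b i)) (k + 1) = j then (1 : ℝ) else 0) =
        𝔼 b : Fin (n + 1) → Bool, (if prefixInt b (k + 1) = j then (1 : ℝ) else 0) :=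
      Fintype.expect_equiv hinv.toPerm _ _ fun _ => rfl
    have hsum : ∀ b : Fin (n + 1) → Bool, (if prefixInt b (k + 1) = j then (1 : ℝ) else 0) +
        (if prefixInt (Function.update b i (!b i)) (k + 1) = j then (1 : ℝ) else 0) =
        if prefixInt b k = j / 2 then 1 else 0 := by
      intro b
      have e1 : prefixInt (Function.update b i (!b i)) k = prefixInt b k :=
        prefixInt_congr fun l hl => Function.update_of_ne
          (fun h => by rw [h] at hl; exact lt_irrefl _ hl) _ _
      have e2 : digit (Function.update b i (!b i)) k = !b i := by
        rw [show k = ((i : Fin (n + 1)) : ℕ) from rfl, digit_val, Function.update_self]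
      have e3 : digit b k = b i := by
        rw [show k = ((i : Fin (n + 1)) : ℕ) from rfl, digit_val]
      rw [prefixInt, prefixInt, e1, e2, e3]
      cases b i <;> simp only [Bool.not_true, Bool.not_false, if_true, Bool.false_eq_true, if_false]
      all_goals
        by_cases hp : prefixInt b k = j / 2
        · rcases Int.emod_two_eq_zero_or_one j with hm | hm
          · split_ifs <;> first | omega | norm_num
          · split_ifs <;> first | omega | norm_num
        · split_ifs <;> first | omega | norm_num
    have h1 := ih (by omega) (j := j / 2) (by omega) (by rw [pow_succ] at hj; omega)
    rw [← expect_congr rfl fun b _ => hsum b, expect_add_distrib, hflip] at h1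
    rw [pow_succ, mul_inv]
    linarith

end Digits

section Grid

variable {d n : ℕ}

/-- The scales of a rectangle of volume at least `2 ^ {-n}` in the unit cube. -/
def scaleVec (n : ℕ) (R : DyadicRectangle d) : ScaleVec d n :=
  fun t => ⟨min n (-(R t).scale).toNat, by omega⟩

/-- The Haar function of `R` on the cells of the grid. -/
noncomputable def gridHaar (n : ℕ) (R : DyadicRectangle d) (ω : BitCube d n) : ℝ :=
  ∏ m, if prefixInt (ω m) (scaleVec n R m) = (R m).pos then bitSign (ω m (scaleVec n R m)) else 0

theorem mem_rectanglesGE {R : DyadicRectangle d} :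
    R ∈ rectanglesGE d n ↔ R.toSet ⊆ Set.Icc 0 1 ∧ (2 : ℝ) ^ (-(n : ℤ)) ≤ R.vol := by
  simp [rectanglesGE]

theorem DyadicRectangle.side_mem {R : DyadicRectangle d} (hsub : R.toSet ⊆ Set.Icc 0 1) (t : Fin d)
    {x : ℝ} (hx : x ∈ (R t).toSet) : 0 ≤ x ∧ x ≤ 1 := by
  let y : Fin d → ℝ := Function.update (fun s => ((R s).pos : ℝ) * (2 : ℝ) ^ (R s).scale) t x
  have hy : y ∈ R.toSet := by
    intro s _
    by_cases hs : s = t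
    · subst hs
      simpa [y] using hx
    · have : (0 : ℝ) < 2 ^ (R s).scale := zpow_pos two_pos _
      simp only [y, Function.update_of_ne hs]
      exact ⟨le_rfl, by nlinarith⟩
  have h := hsub hy
  have h0 := h.1 t
  have h1 := h.2 t
  simp only [y, Function.update_self] at h0 h1
  exact ⟨h0, h1⟩

theorem DyadicRectangle.scale_nonpos_and_pos_lt {R : DyadicRectangle d}
    (hsub : R.toSet ⊆ Set.Icc 0 1) (t : Fin d) :
    (R t).scale ≤ 0 ∧ 0 ≤ (R t).pos ∧ ((R t).pos + 1 : ℝ) * 2 ^ (R t).scale ≤ 1 := by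
  have hpos : (0 : ℝ) < 2 ^ (R t).scale := zpow_pos two_pos _
  have hleft : 0 ≤ ((R t).pos : ℝ) * 2 ^ (R t).scale :=
    (R.side_mem hsub t ⟨le_rfl, by nlinarith⟩).1
  have hright : (((R t).pos : ℝ) + 1) * 2 ^ (R t).scale ≤ 1 := by
    by_contra hc
    push Not at hc
    have hm : max (((R t).pos : ℝ) * 2 ^ (R t).scale) 1 < (((R t).pos : ℝ) + 1) * 2 ^ (R t).scale :=
      max_lt (by nlinarith) hc
    obtain ⟨x, hx1, hx2⟩ := exists_between hm
    have := (R.side_mem hsub t ⟨(le_max_left _ _).trans hx1.le, hx2⟩).2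
    exact absurd this (not_le.mpr ((le_max_right _ _).trans_lt hx1))
  have hp : (0 : ℝ) ≤ (R t).pos := nonneg_of_mul_nonneg_left hleft hpos
  refine ⟨?_, by exact_mod_cast hp, hright⟩
  refine (zpow_le_zpow_iff_right₀ (one_lt_two : (1 : ℝ) < 2)).1 ?_
  rw [zpow_zero]
  nlinarith

theorem vol_eq_of_scale_nonpos {R : DyadicRectangle d} (h : ∀ t, (R t).scale ≤ 0) :
    R.vol = ((2 : ℝ) ^ ∑ t, (-(R t).scale).toNat)⁻¹ := by
  unfold DyadicRectangle.vol DyadicInterval.length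
  rw [← prod_pow_eq_pow_sum, ← prod_inv_distrib]
  refine prod_congr rfl fun t _ => ?_
  rw [← zpow_natCast, Int.toNat_of_nonneg (by have := h t; omega), zpow_neg, inv_inv]

theorem sum_scale_le {R : DyadicRectangle d} (hR : R ∈ rectanglesGE d n) :
    ∑ t, (-(R t).scale).toNat ≤ n := by
  rw [mem_rectanglesGE] at hR
  have h1 := hR.2
  rw [vol_eq_of_scale_nonpos fun t => (R.scale_nonpos_and_pos_lt hR.1 t).1, zpow_neg, zpow_natCast,
    inv_le_inv₀ (by positivity) (by positivity)] at h1
  exact (pow_le_pow_iff_right₀ (one_lt_two : (1 : ℝ) < 2)).1 h1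

theorem scaleVec_val {R : DyadicRectangle d} (hR : R ∈ rectanglesGE d n) (t : Fin d) :
    (scaleVec n R t : ℕ) = (-(R t).scale).toNat := by
  have h := sum_scale_le hR
  have h1 := single_le_sum (f := fun t => (-(R t).scale).toNat) (fun _ _ => Nat.zero_le _)
    (mem_univ t)
  simp only [scaleVec]
  exact min_eq_right (h1.trans h)

theorem sum_scaleVec_le {R : DyadicRectangle d} (hR : R ∈ rectanglesGE d n) :
    ∑ t, (scaleVec n R t : ℕ) ≤ n := by
  rw [sum_congr rfl fun t _ => scaleVec_val hR t]
  exact sum_scale_le hR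

theorem scale_eq {R : DyadicRectangle d} (hR : R ∈ rectanglesGE d n) (t : Fin d) :
    (R t).scale = -((scaleVec n R t : ℕ) : ℤ) := by
  rw [scaleVec_val hR, Int.toNat_of_nonneg, neg_neg]
  have := (R.scale_nonpos_and_pos_lt (mem_rectanglesGE.1 hR).1 t).1
  omega

theorem pos_lt {R : DyadicRectangle d} (hR : R ∈ rectanglesGE d n) (t : Fin d) :
    (R t).pos < 2 ^ (scaleVec n R t : ℕ) := by
  have h := (R.scale_nonpos_and_pos_lt (mem_rectanglesGE.1 hR).1 t).2.2
  rw [scale_eq hR, zpow_neg, zpow_natCast, ← div_eq_mul_inv, div_le_one (by positivity)] at h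
  have h2 : (R t).pos + 1 ≤ 2 ^ (scaleVec n R t : ℕ) := by exact_mod_cast h
  omega

theorem mem_rectanglesEQ {R : DyadicRectangle d} :
    R ∈ rectanglesEQ d n ↔ R ∈ rectanglesGE d n ∧ scaleVec n R ∈ hyperbolic d n := by
  unfold rectanglesEQ
  rw [mem_filter]
  refine and_congr_right fun hR => ?_
  rw [mem_hyperbolic, vol_eq_of_scale_nonpos
    fun t => (R.scale_nonpos_and_pos_lt (mem_rectanglesGE.1 hR).1 t).1, zpow_neg, zpow_natCast,
    inv_inj, pow_right_inj₀ two_pos (by norm_num),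
    sum_congr rfl fun t _ => (scaleVec_val hR t).symm]

theorem prefixInt_flipBit (m m' : Fin d) (k : Fin (n + 1)) {l : ℕ} (h : m' ≠ m ∨ l ≤ k)
    (ω : BitCube d n) : prefixInt (flipBit m k ω m') l = prefixInt (ω m') l :=
  prefixInt_congr fun i hi => flipBit_apply_ne m k ω (h.imp_right fun hl he => by
    rw [he] at hi; exact absurd hi (not_lt.2 hl))

theorem isScaleAt_prod_bitSign {r : ScaleVec d n} (m : Fin d) {G : BitCube d n → ℝ}
    (hG : ∀ k', r m ≤ k' → ∀ ω, G (flipBit m k' ω) = G ω) :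
    IsScaleAt m (r m) (fun ω => (∏ m', bitSign (ω m' (r m'))) * G ω) := by
  refine IsScaleAt.mul_of_invariant ⟨fun ω => ?_, fun k' hk ω => ?_⟩ hG
  · beta_reduce
    rw [← mul_prod_erase univ _ (mem_univ m), ← mul_prod_erase univ _ (mem_univ m),
      flipBit_apply_same, bitSign_not, neg_mul]
    congr 2
    exact prod_congr rfl fun m' hm' => by
      rw [flipBit_apply_ne _ _ _ (Or.inl (mem_erase.1 hm').1)]
  · refine prod_congr rfl fun m' _ => ?_
    by_cases hm : m' = m
    · subst hm
      rw [flipBit_apply_ne _ _ _ (Or.inr hk.ne)]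
    · rw [flipBit_apply_ne _ _ _ (Or.inl hm)]

theorem gridHaar_eq (R : DyadicRectangle d) (ω : BitCube d n) :
    gridHaar n R ω = (∏ m, bitSign (ω m (scaleVec n R m))) *
      ∏ m, if prefixInt (ω m) (scaleVec n R m) = (R m).pos then 1 else 0 := by
  rw [← prod_mul_distrib]
  exact prod_congr rfl fun m _ => by split_ifs <;> simp

theorem isScaleAt_gridHaar (R : DyadicRectangle d) (m : Fin d) :
    IsScaleAt m (scaleVec n R m) (gridHaar n R) := by
  have e : gridHaar n R = fun ω => (∏ m, bitSign (ω m (scaleVec n R m))) *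
      ∏ m, if prefixInt (ω m) (scaleVec n R m) = (R m).pos then 1 else 0 :=
    funext fun ω => gridHaar_eq R ω
  rw [e]
  refine isScaleAt_prod_bitSign m fun k' hk' ω => prod_congr rfl fun m' _ => ?_
  rw [prefixInt_flipBit m m' k']
  by_cases hm : m' = m
  · subst hm; exact Or.inr hk'
  · exact Or.inl hm

/-- The rectangle with scale vector `r` that contains the cell `ω`. -/
def rectAt (r : ScaleVec d n) (ω : BitCube d n) : DyadicRectangle d :=
  fun m => prefixInterval (ω m) (r m)

/-- The `r`-function with the signs of the coefficients `α`; a vanishing coefficient counts as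
positive, so that the function is `±1` everywhere. -/
noncomputable def signFun (α : DyadicRectangle d → ℝ) (r : ScaleVec d n) (ω : BitCube d n) : ℝ :=
  (∏ m, bitSign (ω m (r m))) * if α (rectAt r ω) < 0 then -1 else 1

theorem signFun_sq (α : DyadicRectangle d → ℝ) (r : ScaleVec d n) (ω : BitCube d n) :
    signFun α r ω ^ 2 = 1 := by
  have h1 : (∏ m, bitSign (ω m (r m))) ^ 2 = 1 := by
    rw [← prod_pow]
    exact prod_eq_one fun m _ => by rw [pow_two, bitSign_mul_self]
  rw [signFun, mul_pow, h1, one_mul]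
  split_ifs <;> norm_num

theorem isRFamily_signFun (α : DyadicRectangle d → ℝ) :
    IsRFamily (signFun α : ScaleVec d n → BitCube d n → ℝ) where
  bound r ω := by
    rw [← sq_le_one_iff_abs_le_one, signFun_sq]
  scale r m := by
    refine isScaleAt_prod_bitSign m fun k' hk' ω => ?_
    have : rectAt r (flipBit m k' ω) = rectAt r ω := by
      funext m'
      unfold rectAt prefixInterval
      rw [prefixInt_flipBit m m' k']
      by_cases hm : m' = m
      · subst hm; exact Or.inr hk'
      · exact Or.inl hm
    rw [this]

theorem expect_signFun_mul_gridHaar (α : DyadicRectangle d → ℝ) (r : ScaleVec d n)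
    {R : DyadicRectangle d} (hR : R ∈ rectanglesGE d n) :
    𝔼 ω, signFun α r ω * gridHaar n R ω =
      if r = scaleVec n R then (if α R < 0 then -1 else 1) * ((2 : ℝ) ^ ∑ m, (r m : ℕ))⁻¹
      else 0 := by
  by_cases hr : r = scaleVec n R
  · rw [if_pos hr]
    subst hr
    have h1 : ∀ ω : BitCube d n, signFun α (scaleVec n R) ω * gridHaar n R ω =
        (if α R < 0 then -1 else 1) *
          ∏ m, if prefixInt (ω m) (scaleVec n R m) = (R m).pos then 1 else 0 := by
      intro ω
      by_cases hω : ∀ m, prefixInt (ω m) (scaleVec n R m) = (R m).pos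
      · have e1 : rectAt (scaleVec n R) ω = R := by
          funext m
          exact DyadicInterval.ext (scale_eq hR m).symm (hω m)
        have e2 := signFun_sq α (scaleVec n R) ω
        rw [gridHaar_eq, prod_eq_one fun m _ => if_pos (hω m)]
        unfold signFun at e2 ⊢
        rw [e1] at e2 ⊢
        split_ifs at e2 ⊢ <;> linarith
      · push Not at hω
        obtain ⟨m, hm⟩ := hω
        have e1 : ∏ m, (if prefixInt (ω m) (scaleVec n R m) = (R m).pos then (1 : ℝ) else 0) = 0 :=
          prod_eq_zero (mem_univ m) (if_neg hm)
        rw [gridHaar_eq, e1]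
        ring
    simp only [h1]
    rw [← mul_expect]
    congr 1
    rw [expect_pi_prod (fun m (b : Fin (n + 1) → Bool) =>
        if prefixInt b (scaleVec n R m) = (R m).pos then (1 : ℝ) else 0), ← prod_pow_eq_pow_sum,
        ← prod_inv_distrib]
    refine prod_congr rfl fun m _ => expect_prefixInt_eq (by omega) ?_ (pos_lt hR m)
    exact (R.scale_nonpos_and_pos_lt (mem_rectanglesGE.1 hR).1 m).2.1
  · rw [if_neg hr]
    obtain ⟨m, hm⟩ := Function.ne_iff.1 hr
    have h1 := (isRFamily_signFun α (n := n)).scale r m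
    have h2 := isScaleAt_gridHaar (n := n) R m
    rcases lt_or_gt_of_ne hm with hlt | hlt
    · have h3 := h2.mul_of_invariant (G := signFun α r) fun k' hk' => h1.2 k' (hlt.trans_le hk')
      have h4 := expect_eq_zero_of_flipBit m _
        (f := fun ω => gridHaar n R ω * signFun α r ω) h3.1
      rw [← h4]
      exact expect_congr rfl fun ω _ => mul_comm _ _
    · have h3 := h1.mul_of_invariant (G := gridHaar n R) fun k' hk' => h2.2 k' (hlt.trans_le hk')
      exact expect_eq_zero_of_flipBit m _ (f := fun ω => signFun α r ω * gridHaar n R ω) h3.1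

/-- The left side of the inequality is the pairing of the Haar sum with the signed
`r`-functions. -/
theorem sum_abs_eq_expect (α : DyadicRectangle d → ℝ) :
    (2 : ℝ) ^ (-(n : ℤ)) * ∑ R ∈ rectanglesEQ d n, |α R| =
      𝔼 ω, (∑ r ∈ hyperbolic d n, signFun α r ω) *
        ∑ R ∈ rectanglesGE d n, α R * gridHaar n R ω := by
  have h1 : ∀ ω : BitCube d n, (∑ r ∈ hyperbolic d n, signFun α r ω) *
      ∑ R ∈ rectanglesGE d n, α R * gridHaar n R ω =
      ∑ R ∈ rectanglesGE d n, ∑ r ∈ hyperbolic d n, α R * (signFun α r ω * gridHaar n R ω) := by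
    intro ω
    rw [sum_mul_sum, sum_comm]
    exact sum_congr rfl fun R _ => sum_congr rfl fun r _ => by ring
  simp only [h1]
  rw [expect_sum_comm, mul_sum]
  have h2 : rectanglesEQ d n = {R ∈ rectanglesGE d n | scaleVec n R ∈ hyperbolic d n} := by
    ext R
    rw [mem_rectanglesEQ, mem_filter]
  rw [h2, sum_filter]
  refine sum_congr rfl fun R hR => ?_
  rw [expect_sum_comm]
  simp only [← mul_expect, expect_signFun_mul_gridHaar α _ hR]
  rw [← mul_sum, sum_ite_eq']
  split_ifs with h3 h4
  · rw [mem_hyperbolic.1 h3, abs_of_neg h4, zpow_neg, zpow_natCast]; ring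
  · rw [mem_hyperbolic.1 h3, abs_of_nonneg (not_lt.1 h4), zpow_neg, zpow_natCast]; ring
  · rw [mul_zero]

/-- On the cell `ω` the Haar sum is constant. -/
theorem haarSum_eq_of_mem {α : DyadicRectangle d → ℝ} {ω : BitCube d n} {x : Fin d → ℝ}
    (hx : ∀ m, x m ∈ (prefixInterval (ω m) (n + 1)).toSet) :
    haarSum d n α x = ∑ R ∈ rectanglesGE d n, α R * gridHaar n R ω := by
  unfold haarSum
  refine sum_congr rfl fun R hR => ?_
  congr 1
  exact prod_congr rfl fun m _ => haar_eq_of_mem_prefixInterval (hx m) (scale_eq hR m)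

theorem abs_gridSum_le (α : DyadicRectangle d → ℝ)
    (h : eLpNorm (haarSum d n α) ⊤ (volume.restrict (Set.Icc (0 : Fin d → ℝ) 1)) ≠ ⊤)
    (ω : BitCube d n) : |∑ R ∈ rectanglesGE d n, α R * gridHaar n R ω| ≤
      (eLpNorm (haarSum d n α) ⊤ (volume.restrict (Set.Icc (0 : Fin d → ℝ) 1))).toReal := by
  set K := eLpNorm (haarSum d n α) ⊤ (volume.restrict (Set.Icc (0 : Fin d → ℝ) 1)) with hK
  let Q : Set (Fin d → ℝ) := Set.univ.pi fun m => (prefixInterval (ω m) (n + 1)).toSet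
  have hQ : ∀ x ∈ Q, haarSum d n α x = ∑ R ∈ rectanglesGE d n, α R * gridHaar n R ω :=
    fun x hx => haarSum_eq_of_mem fun m => hx m (Set.mem_univ m)
  have hs : (0 : ℝ) < 2 ^ (-((n + 1 : ℕ) : ℤ)) := zpow_pos two_pos _
  have hQsub : Q ⊆ Set.Icc 0 1 := by
    intro x hx
    have h1 : ∀ m, 0 ≤ x m ∧ x m ≤ 1 := by
      intro m
      have h2 := hx m (Set.mem_univ m)
      simp only [prefixInterval, DyadicInterval.toSet, Set.mem_Ico] at h2
      have h3 : (0 : ℝ) ≤ prefixInt (ω m) (n + 1) := by exact_mod_cast prefixInt_nonneg _ _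
      have h4 : (prefixInt (ω m) (n + 1) : ℝ) + 1 ≤ 2 ^ (n + 1) := by
        have := prefixInt_lt (ω m) (n + 1)
        exact_mod_cast this
      refine ⟨(mul_nonneg h3 hs.le).trans h2.1, h2.2.le.trans ?_⟩
      calc ((prefixInt (ω m) (n + 1) : ℝ) + 1) * 2 ^ (-((n + 1 : ℕ) : ℤ))
          ≤ 2 ^ (n + 1) * 2 ^ (-((n + 1 : ℕ) : ℤ)) := mul_le_mul_of_nonneg_right h4 hs.le
        _ = 1 := by rw [zpow_neg, zpow_natCast, mul_inv_cancel₀ (by positivity)]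
    exact ⟨fun m => (h1 m).1, fun m => (h1 m).2⟩
  have hvol : (volume.restrict (Set.Icc (0 : Fin d → ℝ) 1)) Q ≠ 0 := by
    rw [Measure.restrict_eq_self _ hQsub]
    have : volume Q = ∏ _m : Fin d, ENNReal.ofReal (2 ^ (-((n + 1 : ℕ) : ℤ))) := by
      simp only [Q, prefixInterval, DyadicInterval.toSet]
      rw [Real.volume_pi_Ico]
      refine prod_congr rfl fun m _ => ?_
      congr 1
      ring
    rw [this]
    exact prod_ne_zero_iff.2 fun m _ => (ENNReal.ofReal_pos.2 hs).ne'
  have hae : ∀ᵐ x ∂(volume.restrict (Set.Icc (0 : Fin d → ℝ) 1)), ‖haarSum d n α x‖ₑ ≤ K := by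
    rw [hK, eLpNorm_exponent_top]
    exact ae_le_eLpNormEssSup
  obtain ⟨x, hxQ, hx⟩ : ∃ x ∈ Q, ‖haarSum d n α x‖ₑ ≤ K := by
    by_contra hno
    push Not at hno
    refine hvol (measure_mono_null (fun x hx => ?_) (ae_iff.1 hae))
    exact not_le.2 (hno x hx)
  rw [hQ x hxQ] at hx
  have h5 := ENNReal.toReal_mono h hx
  rwa [toReal_enorm, Real.norm_eq_abs] at h5

end Grid

/-! ### Conclusion -/

theorem sum_abs_le_of_riesz {d n q : ℕ} (hd : d ≠ 0) (hq : q ≠ 0) {D : RieszData d n q} {p : ℕ}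
    {Λ θ : ℝ} (h : D.Admissible p Λ θ)
    (hlink : 4 * 16 ^ d * θ * Λ ^ 2 * (4 ^ (d + 1) * Λ ^ 2) ^ (4 * d) ≤
      (1 / (4 * d * q ^ 2)) ^ (8 * d ^ 2)) {α : DyadicRectangle d → ℝ} (hf : D.f = signFun α)
    {K : ℝ} (hK : ∀ ω : BitCube d n, |∑ R ∈ rectanglesGE d n, α R * gridHaar n R ω| ≤ K) :
    D.ρ * ((2 : ℝ) ^ (-(n : ℤ)) * ∑ R ∈ rectanglesEQ d n, |α R|) ≤ 28 * K := by
  have := h.expect_sum_mul_le hd hq hlink (rectanglesGE d n)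
    (g := fun R ω => α R * gridHaar n R ω) (k := scaleVec n) (fun R hR => sum_scaleVec_le hR)
    (fun R _ m => (isScaleAt_gridHaar R m).const_mul _) hK
  rwa [hf, ← sum_abs_eq_expect] at this

/-- The bound for all `n`, by the triangle inequality over the scale vectors. -/
theorem sum_abs_le_card_mul {d n : ℕ} {α : DyadicRectangle d → ℝ} {K : ℝ}
    (hK : ∀ ω : BitCube d n, |∑ R ∈ rectanglesGE d n, α R * gridHaar n R ω| ≤ K) :
    (2 : ℝ) ^ (-(n : ℤ)) * ∑ R ∈ rectanglesEQ d n, |α R| ≤ #(hyperbolic d n) * K := by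
  have hK0 : 0 ≤ K := (abs_nonneg _).trans (hK fun _ _ => false)
  rw [sum_abs_eq_expect]
  calc _ ≤ 𝔼 _ω : BitCube d n, (#(hyperbolic d n) : ℝ) * K := by
        refine expect_le_expect fun ω _ => (le_abs_self _).trans ?_
        rw [abs_mul]
        refine mul_le_mul ((abs_sum_le_sum_abs _ _).trans ?_) (hK ω) (abs_nonneg _) (by positivity)
        refine (sum_le_sum fun r _ => (isRFamily_signFun α).bound r ω).trans ?_
        simp
    _ = _ := expect_const_univ _

/-- The size `ρ` of the linear part is at least a multiple of `n ^ {-(d-1)/2 + η}`, where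
`n ^ {2η}` is the order of the number `q` of factors. -/
theorem one_le_mul_rho {d n : ℕ} (hd : 3 ≤ d) (hn : 1 ≤ n) {q : ℕ}
    (hq : ((n : ℝ) + 1) ^ ((1 : ℝ) / (800 * d ^ 2)) ≤ 2 * q) :
    1 ≤ 2 ^ (d + 1) * (n : ℝ) ^ (((d : ℝ) - 1) / 2 - 1 / 1600 / (d : ℝ) ^ 2) *
      √(q / (2 * (n + 1) ^ (d - 1))) := by
  have hd0 : (3 : ℝ) ≤ d := by exact_mod_cast hd
  have hn1 : (1 : ℝ) ≤ n := by exact_mod_cast hn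
  have hN0 : (0 : ℝ) < n + 1 := by linarith
  set e : ℝ := ((d : ℝ) - 1) / 2 - 1 / 1600 / (d : ℝ) ^ 2 with he
  have hη : 1 / 1600 / (d : ℝ) ^ 2 ≤ 1 := by
    rw [div_le_one (by positivity)]
    nlinarith
  have he0 : 0 ≤ e := by linarith
  have hed : e ≤ d := by
    have : 0 ≤ 1 / 1600 / (d : ℝ) ^ 2 := by positivity
    linarith
  have h1 : ((n : ℝ) + 1) ^ e ≤ 2 ^ d * (n : ℝ) ^ e := by
    calc ((n : ℝ) + 1) ^ e ≤ (2 * n) ^ e := Real.rpow_le_rpow hN0.le (by linarith) he0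
      _ = 2 ^ e * (n : ℝ) ^ e := Real.mul_rpow (by norm_num) (by positivity)
      _ ≤ 2 ^ d * (n : ℝ) ^ e := by
          refine mul_le_mul_of_nonneg_right ?_ (by positivity)
          rw [← Real.rpow_natCast]
          exact Real.rpow_le_rpow_of_exponent_le (by norm_num) hed
  have h2 : (((n : ℝ) + 1) ^ e)⁻¹ / 2 ≤ √(q / (2 * (n + 1) ^ (d - 1))) := by
    refine Real.le_sqrt_of_sq_le ?_
    have h3 : (((n : ℝ) + 1) ^ e) ^ 2 * ((n : ℝ) + 1) ^ ((1 : ℝ) / (800 * d ^ 2)) =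
        ((n : ℝ) + 1) ^ (d - 1) := by
      rw [← Real.rpow_natCast, ← Real.rpow_mul hN0.le, ← Real.rpow_add hN0,
        ← Real.rpow_natCast (_ + 1) (d - 1)]
      congr 1
      rw [he]
      push_cast [Nat.cast_sub (show 1 ≤ d by omega)]
      field_simp
      ring
    rw [← h3]
    set A := ((n : ℝ) + 1) ^ e
    set B := ((n : ℝ) + 1) ^ ((1 : ℝ) / (800 * d ^ 2))
    have hA : 0 < A := Real.rpow_pos_of_pos hN0 _
    have hB : 0 < B := Real.rpow_pos_of_pos hN0 _
    rw [div_pow, inv_pow, ← one_div, div_div, div_le_div_iff₀ (by positivity) (by positivity)]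
    have : 0 < A ^ 2 := by positivity
    nlinarith
  have hA : 0 < ((n : ℝ) + 1) ^ e := Real.rpow_pos_of_pos hN0 _
  calc (1 : ℝ) = 2 * ((n : ℝ) + 1) ^ e * ((((n : ℝ) + 1) ^ e)⁻¹ / 2) := by field_simp
    _ ≤ 2 * (2 ^ d * (n : ℝ) ^ e) * √(q / (2 * (n + 1) ^ (d - 1))) := by
        refine mul_le_mul (by linarith) h2 (by positivity) (by positivity)
    _ = _ := by rw [pow_succ]; ring

/-- The inequality on the dyadic grid, with the bound `K` of the Haar sum on the cells. -/
theorem exists_grid_bound (d : ℕ) (hd : 3 ≤ d) :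
    ∃ C : ℝ, 0 < C ∧ ∀ n : ℕ, 1 ≤ n → ∀ (α : DyadicRectangle d → ℝ) (K : ℝ),
      (∀ ω : BitCube d n, |∑ R ∈ rectanglesGE d n, α R * gridHaar n R ω| ≤ K) →
      (2 : ℝ) ^ (-(n : ℤ)) * ∑ R ∈ rectanglesEQ d n, |α R| ≤
        C * (n : ℝ) ^ (((d : ℝ) - 1) / 2 - 1 / 1600 / (d : ℝ) ^ 2) * K := by
  obtain ⟨q₀, hq₀⟩ := RieszData.exists_admissible d hd
  let N : ℕ := (q₀ + 1) ^ (800 * d ^ 2)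
  refine ⟨28 * 2 ^ (d + 1) + N ^ (d - 1), by positivity, fun n hn α K hK => ?_⟩
  have hd0 : (3 : ℝ) ≤ d := by exact_mod_cast hd
  have hn1 : (1 : ℝ) ≤ n := by exact_mod_cast hn
  have hN0 : (0 : ℝ) < n + 1 := by linarith
  have hK0 : 0 ≤ K := (abs_nonneg _).trans (hK fun _ _ => false)
  set e : ℝ := ((d : ℝ) - 1) / 2 - 1 / 1600 / (d : ℝ) ^ 2 with he
  have hη : 1 / 1600 / (d : ℝ) ^ 2 ≤ 1 := by
    rw [div_le_one (by positivity)]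
    nlinarith
  have hne : 1 ≤ (n : ℝ) ^ e := Real.one_le_rpow hn1 (by linarith)
  rcases lt_or_ge (n + 1) N with hlt | hge
  · -- finitely many `n` are covered by the trivial bound
    refine (sum_abs_le_card_mul hK).trans (mul_le_mul_of_nonneg_right ?_ hK0)
    have h1 : (#(hyperbolic d n) : ℝ) ≤ (N : ℝ) ^ (d - 1) := by
      have := card_hyperbolic_le (n := n) (o := (⟨0, by omega⟩ : Fin d)) (l := ⟨1, by omega⟩)
        (by simp)
      exact_mod_cast this.trans (Nat.pow_le_pow_left hlt.le _)
    have h2 : (0 : ℝ) ≤ 28 * 2 ^ (d + 1) := by positivity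
    have h3 : (0 : ℝ) ≤ (N : ℝ) ^ (d - 1) := by positivity
    nlinarith
  · set x : ℝ := ((n : ℝ) + 1) ^ ((1 : ℝ) / (800 * d ^ 2)) with hx
    have hxpow : x ^ (800 * d ^ 2) = n + 1 := by
      rw [hx, ← Real.rpow_natCast, ← Real.rpow_mul hN0.le]
      push_cast
      rw [one_div, inv_mul_cancel₀ (by positivity), Real.rpow_one]
    have hx0 : 0 ≤ x := Real.rpow_nonneg hN0.le _
    have hxq : ((q₀ + 1 : ℕ) : ℝ) ≤ x := by
      refine (pow_le_pow_iff_left₀ (by positivity) hx0 (n := 800 * d ^ 2) (by positivity)).1 ?_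
      rw [hxpow]
      exact_mod_cast hge
    set q : ℕ := ⌊x⌋₊ with hqdef
    have hq1 : q₀ + 1 ≤ q := Nat.le_floor hxq
    have hqx : (q : ℝ) ≤ x := Nat.floor_le hx0
    have hxq2 : x ≤ 2 * q := by
      have h1 := (Nat.lt_floor_add_one x).le
      have h2 : (1 : ℝ) ≤ q := by exact_mod_cast (by omega : 1 ≤ q)
      rw [← hqdef] at h1
      linarith
    obtain ⟨D, p, Λ, θ, hf, hρ, hq0, hadm, hlink⟩ := hq₀ q (by omega) n
      (by rw [← hxpow]; exact pow_le_pow_left₀ (by positivity) hqx _)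
      (signFun α) (isRFamily_signFun α) (signFun_sq α)
    have h1 := sum_abs_le_of_riesz (by omega) hq0 hadm hlink hf hK
    have h2 := one_le_mul_rho hd hn hxq2
    rw [hρ] at h1
    set S := (2 : ℝ) ^ (-(n : ℤ)) * ∑ R ∈ rectanglesEQ d n, |α R| with hS
    have hS0 : 0 ≤ S := by positivity
    set ρ := √((q : ℝ) / (2 * (n + 1) ^ (d - 1)))
    calc S ≤ 2 ^ (d + 1) * (n : ℝ) ^ e * ρ * S := le_mul_of_one_le_left hS0 h2
      _ = 2 ^ (d + 1) * (n : ℝ) ^ e * (ρ * S) := by ring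
      _ ≤ 2 ^ (d + 1) * (n : ℝ) ^ e * (28 * K) := mul_le_mul_of_nonneg_left h1 (by positivity)
      _ = 28 * 2 ^ (d + 1) * (n : ℝ) ^ e * K := by ring
      _ ≤ (28 * 2 ^ (d + 1) + N ^ (d - 1)) * (n : ℝ) ^ e * K := by
          refine mul_le_mul_of_nonneg_right (mul_le_mul_of_nonneg_right ?_ (by positivity)) hK0
          have h3 : (0 : ℝ) ≤ (N : ℝ) ^ (d - 1) := by positivity
          linarith

end SmallBall

/-- Small Ball Inequality with a gain `η(d)`, of order `1/d²`, over the average case exponent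
`(d-1)/2`. The `L^∞([0,1]^d)` norm is the essential supremum for Lebesgue measure, with values
in `[0,∞]`, and `C` is the implied constant. -/
theorem theorem1p1 :
    ∃ η : ℕ → ℝ,
      (∃ c₁ c₂ : ℝ, 0 < c₁ ∧ 0 < c₂ ∧
        ∀ d : ℕ, 3 ≤ d → c₁ / (d : ℝ) ^ 2 ≤ η d ∧ η d ≤ c₂ / (d : ℝ) ^ 2) ∧
      ∀ d : ℕ, 3 ≤ d → 0 < η d ∧
        ∃ C : ℝ, 0 < C ∧ ∀ n : ℕ, 1 ≤ n → ∀ α : SmallBall.DyadicRectangle d → ℝ,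
          ENNReal.ofReal
              ((2 : ℝ) ^ (-(n : ℤ)) * ∑ R ∈ SmallBall.rectanglesEQ d n, |α R|) ≤
            ENNReal.ofReal (C * (n : ℝ) ^ (((d : ℝ) - 1) / 2 - η d)) *
              eLpNorm (SmallBall.haarSum d n α) ⊤
                (volume.restrict (Set.Icc (0 : Fin d → ℝ) 1)) := by
  refine ⟨fun d => 1 / 1600 / (d : ℝ) ^ 2, ⟨1 / 1600, 1 / 1600, by norm_num, by norm_num,
    fun d _ => ⟨le_rfl, le_rfl⟩⟩, fun d hd => ⟨by positivity, ?_⟩⟩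
  obtain ⟨C, hC, h⟩ := SmallBall.exists_grid_bound d hd
  refine ⟨C, hC, fun n hn α => ?_⟩
  have hn0 : (0 : ℝ) < n := by exact_mod_cast hn
  have hpos : 0 < C * (n : ℝ) ^ (((d : ℝ) - 1) / 2 - 1 / 1600 / (d : ℝ) ^ 2) := by positivity
  by_cases htop : eLpNorm (SmallBall.haarSum d n α) ⊤
      (volume.restrict (Set.Icc (0 : Fin d → ℝ) 1)) = ⊤
  · rw [htop, ENNReal.mul_top (ENNReal.ofReal_pos.2 hpos).ne']
    exact le_top
  · rw [← ENNReal.ofReal_toReal htop, ← ENNReal.ofReal_mul hpos.le]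
    exact ENNReal.ofReal_le_ofReal (h n hn α _ (SmallBall.abs_gridSum_le α htop))
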